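/- Let $K$ be a commutative ring; algebras are unital associative $K$-algebras, and modules over them are symmetric over $K$. Let $A|B$ be a proper algebra extension, i.e. an injective algebra homomorphism $B\to A$ (suppressed in the notation). **Definitions.** $A|B$ is *right depth two* (right D2) if for some $n$ the $A$-$B$-bimodule $A\otimes_BA$ is isomorphic to a direct summand of $A^n$, and *left depth two* (left D2) if for some $n$ the $B$-$A$-bimodule $A\otimes_BA$ is isomorphic to a direct summand of $A^n$. It is *right balanced* if the right $B$-module $A_B$ is balanced, i.e. every additive endomorphism of $A$ commuting with all elements of $\mathrm{End}(A_B)$ is right multiplication by a unique element of $B$, and *left balanced* if ${}_BA$ is balanced, i.e. every additive endomorphism of $A$ commuting with all elements of $\mathrm{End}({}_BA)$ is left multiplication by a unique element of $B$. A *right bialgebroid* $T$ over an algebra $R$ is an algebra $T$ with an algebra homomorphism $s:R\to T$ and an algebra anti-homomorphism $t:R\to T$ with commuting images, and, for the bimodule structure $r\cdot x\cdot r'=x\,s(r')\,t(r)$, an $R$-coring structure $(\Delta,\varepsilon)$ on $T$ (coassociative, counital, with $R$-bimodule maps $\Delta:T\to T\otimes_RT$ and $\varepsilon:T\to R$), such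 that for all $x,y\in T$ and $r\in R$: $\Delta(1)=1\otimes1$; $\varepsilon(1)=1$; $\varepsilon(xy)=\varepsilon(t(\varepsilon(x))y)=\varepsilon(s(\varepsilon(x))y)$; $(s(r)\otimes1)\Delta(x)=(1\otimes t(r))\Delta(x)$; $\Delta(xy)=\Delta(x)\Delta(y)$. It is *left finite projective* if ${}_RT$ is finitely generated projective. A *right $T$-comodule algebra* is an algebra $A$ with an algebra homomorphism $R\to A$ and a right $R$-linear coaction $\delta:A\to A\otimes_RT$, $\delta(a)=a_{(0)}\otimes a_{(1)}$, making $A$ a (coassociative, counital) right comodule over the $R$-coring $T$, with $\delta(1)=1\otimes1$, $ra_{(0)}\otimes a_{(1)}=a_{(0)}\otimes t(r)a_{(1)}$ and $\delta(aa')=\delta(a)\delta(a')$. Its coinvariants are $\{a\in A:\delta(a)=a\otimes1\}$. $A|B$ is a *right $T$-Galois extension* if $A$ has a right $T$-comodule algebra structure whose coinvariants are exactly (the image of) $B$ and for which $A\otimes_BA\to A\otimes_RT$, $a\otimes a'\mapsto aa'_{(0)}\otimes a'_{(1)}$, is bijective. A *left bialgebroid* $T$ over $R$ is defined in the same way with the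 bimodule structure $r\cdot x\cdot r'=s(r)t(r')x$ and, in place of the third and fourth identities, $\varepsilon(xy)=\varepsilon(x\,s(\varepsilon(y)))=\varepsilon(x\,t(\varepsilon(y)))$ and $\Delta(x)(t(r)\otimes1)=\Delta(x)(1\otimes s(r))$; it is *right finite projective* if $T_R$ is finitely generated projective. A *left $T$-comodule algebra* is an algebra $A$ with an algebra homomorphism $R\to A$ and a left $R$-linear coaction $\delta:A\to T\otimes_RA$, $\delta(a)=a_{(-1)}\otimes a_{(0)}$, making $A$ a left comodule over the $R$-coring $T$, with $\delta(1)=1\otimes1$, $a_{(-1)}t(r)\otimes a_{(0)}=a_{(-1)}\otimes a_{(0)}r$ and $\delta(aa')=\delta(a)\delta(a')$; its coinvariants are $\{a\in A:\delta(a)=1\otimes a\}$. $A|B$ is a *left $T$-Galois extension* if $A$ has a left $T$-comodule algebra structure whose coinvariants are exactly (the image of) $B$ and for which $A\otimes_BA\to T\otimes_RA$, $a\otimes a'\mapsto a_{(-1)}\otimes a_{(0)}a'$, is bijective. **Theorem.** Let $A|B$ be a proper algebra extension. 1. $A|B$ is a right $T$-Galois extension for some left finite projective right bialgebroid $T$ over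 some algebra $R$ if and only if $A|B$ is right D2 and right balanced. 2. $A|B$ is a left $T$-Galois extension for some right finite projective left bialgebroid $T$ over some algebra $R$ if and only if $A|B$ is left D2 and left balanced. -/

import Mathlib

open scoped TensorProduct

universe uK uB uA uR uT

namespace DepthTwo

/-! ### Tensor products over a noncommutative ring

A right action of `R` on the `K`-module `M` is recorded by its operators `ρ r : m ↦ m · r`, a left
action on `N` by its operators `l r : n ↦ r · n`. -/

section Tensor

variable {K : Type*} [CommRing K] {R S : Type*}
  {M N P M' N' : Type*} [AddCommGroup M] [Module K M] [AddCommGroup N] [Module K N]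
  [AddCommGroup P] [Module K P] [AddCommGroup M'] [Module K M'] [AddCommGroup N'] [Module K N']

/-- The submodule of `M ⊗[K] N` spanned by the elements `m · r ⊗ n - m ⊗ r · n`. -/
def balancingRel (ρ : R → Module.End K M) (l : R → Module.End K N) : Submodule K (M ⊗[K] N) :=
  Submodule.span K {z | ∃ r m n, z = ρ r m ⊗ₜ[K] n - m ⊗ₜ[K] l r n}

/-- The tensor product `M ⊗_R N` of a right `R`-module `M` and a left `R`-module `N`. -/
def BTensor (ρ : R → Module.End K M) (l : R → Module.End K N) : Type _ :=
  (M ⊗[K] N) ⧸ balancingRel ρ l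

instance (ρ : R → Module.End K M) (l : R → Module.End K N) : AddCommGroup (BTensor ρ l) :=
  inferInstanceAs (AddCommGroup ((M ⊗[K] N) ⧸ balancingRel ρ l))

instance (ρ : R → Module.End K M) (l : R → Module.End K N) : Module K (BTensor ρ l) :=
  inferInstanceAs (Module K ((M ⊗[K] N) ⧸ balancingRel ρ l))

namespace BTensor

variable {ρ : R → Module.End K M} {l : R → Module.End K N}
  {ρ' : R → Module.End K M'} {l' : R → Module.End K N'}

/-- The projection `M ⊗[K] N → M ⊗_R N`. -/
def proj (ρ : R → Module.End K M) (l : R → Module.End K N) : M ⊗[K] N →ₗ[K] BTensor ρ l :=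
  (balancingRel ρ l).mkQ

/-- The element `m ⊗ n` of `M ⊗_R N`. -/
def tmul (ρ : R → Module.End K M) (l : R → Module.End K N) (m : M) (n : N) : BTensor ρ l :=
  proj ρ l (m ⊗ₜ[K] n)

theorem add_tmul (m m' : M) (n : N) :
    tmul ρ l (m + m') n = tmul ρ l m n + tmul ρ l m' n := by
  simp [tmul, TensorProduct.add_tmul]

theorem tmul_add (m : M) (n n' : N) :
    tmul ρ l m (n + n') = tmul ρ l m n + tmul ρ l m n' := by
  simp [tmul, TensorProduct.tmul_add]

theorem smul_tmul (c : K) (m : M) (n : N) : tmul ρ l (c • m) n = c • tmul ρ l m n := by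
  simp [tmul, ← TensorProduct.smul_tmul']

theorem tmul_smul (c : K) (m : M) (n : N) : tmul ρ l m (c • n) = c • tmul ρ l m n := by
  simp [tmul]

theorem tmul_balanced (r : R) (m : M) (n : N) : tmul ρ l (ρ r m) n = tmul ρ l m (l r n) :=
  (Submodule.Quotient.eq (balancingRel ρ l)).2 (Submodule.subset_span ⟨r, m, n, rfl⟩)

/-- The universal property: a balanced `K`-bilinear map factors through `M ⊗_R N`. -/
def lift (φ : M →ₗ[K] N →ₗ[K] P) (h : ∀ r m n, φ (ρ r m) n = φ m (l r n)) :
    BTensor ρ l →ₗ[K] P :=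
  (balancingRel ρ l).liftQ (TensorProduct.lift φ) (by
    refine Submodule.span_le.2 ?_
    rintro _ ⟨r, m, n, rfl⟩
    simp [h])

theorem lift_tmul (φ : M →ₗ[K] N →ₗ[K] P) (h : ∀ r m n, φ (ρ r m) n = φ m (l r n)) (m : M)
    (n : N) : lift φ h (tmul ρ l m n) = φ m n :=
  (Submodule.liftQ_apply _ _ _).trans (TensorProduct.lift.tmul _ _)

theorem hom_ext {g g' : BTensor ρ l →ₗ[K] P}
    (h : ∀ m n, g (tmul ρ l m n) = g' (tmul ρ l m n)) : g = g' :=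
  Submodule.linearMap_qext (balancingRel ρ l) (TensorProduct.ext' h)

/-- The `K`-bilinear map `(m, n) ↦ m ⊗ n`. -/
def mk (ρ : R → Module.End K M) (l : R → Module.End K N) : M →ₗ[K] N →ₗ[K] BTensor ρ l :=
  LinearMap.mk₂ K (tmul ρ l) add_tmul smul_tmul tmul_add tmul_smul

theorem mk_apply (m : M) (n : N) : mk ρ l m n = tmul ρ l m n := rfl

/-- `g ⊗_R h : M ⊗_R N → M' ⊗_R N'` for `R`-linear maps `g` and `h`. -/
def map (g : M →ₗ[K] M') (h : N →ₗ[K] N') (hg : ∀ r m, g (ρ r m) = ρ' r (g m))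
    (hh : ∀ r n, h (l r n) = l' r (h n)) : BTensor ρ l →ₗ[K] BTensor ρ' l' :=
  lift ((mk ρ' l').compl₁₂ g h) (by
    intro r m n
    simp only [LinearMap.compl₁₂_apply, mk_apply, hg, hh, tmul_balanced])

theorem map_tmul (g : M →ₗ[K] M') (h : N →ₗ[K] N') (hg : ∀ r m, g (ρ r m) = ρ' r (g m))
    (hh : ∀ r n, h (l r n) = l' r (h n)) (m : M) (n : N) :
    map g h hg hh (tmul ρ l m n) = tmul ρ' l' (g m) (h n) :=
  lift_tmul _ _ _ _

/-- The operator `m ⊗ n ↦ g m ⊗ n` for an endomorphism `g` of the right `R`-module `M`. -/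
def onLeft (ρ : R → Module.End K M) (l : R → Module.End K N) (g : Module.End K M)
    (hg : ∀ r m, g (ρ r m) = ρ r (g m)) : Module.End K (BTensor ρ l) :=
  map g LinearMap.id hg (fun _ _ => rfl)

/-- The operator `m ⊗ n ↦ m ⊗ h n` for an endomorphism `h` of the left `R`-module `N`. -/
def onRight (ρ : R → Module.End K M) (l : R → Module.End K N) (h : Module.End K N)
    (hh : ∀ r n, h (l r n) = l r (h n)) : Module.End K (BTensor ρ l) :=
  map LinearMap.id h (fun _ _ => rfl) hh

theorem onLeft_tmul (g : Module.End K M) (hg : ∀ r m, g (ρ r m) = ρ r (g m)) (m : M) (n : N) :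
    onLeft ρ l g hg (tmul ρ l m n) = tmul ρ l (g m) n :=
  map_tmul _ _ _ _ _ _

theorem onRight_tmul (h : Module.End K N) (hh : ∀ r n, h (l r n) = l r (h n)) (m : M) (n : N) :
    onRight ρ l h hh (tmul ρ l m n) = tmul ρ l m (h n) :=
  map_tmul _ _ _ _ _ _

/-- For fixed `p`, the map `M ⊗_R N → M ⊗_R (N ⊗_S P)`, `m ⊗ n ↦ m ⊗ (n ⊗ p)`, as a bilinear map
in `m ⊗ n` and `p`. -/
def assocAux (ρ : R → Module.End K M) (l : R → Module.End K N) (σ : S → Module.End K N)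
    (k : S → Module.End K P) (h : ∀ r s n, l r (σ s n) = σ s (l r n)) :
    BTensor ρ l →ₗ[K] P →ₗ[K] BTensor ρ (fun r => onLeft σ k (l r) (fun s n => h r s n)) :=
  lift
    (LinearMap.mk₂ K
      (fun m n => (mk ρ (fun r => onLeft σ k (l r) (fun s n => h r s n)) m).comp (mk σ k n))
      (by intros; ext; simp) (by intros; ext; simp)
      (by intros; ext; simp [mk_apply, tmul_add])
      (by intros; ext; simp [mk_apply]))
    (by
      intro r m n
      ext p
      simp only [LinearMap.mk₂_apply, LinearMap.comp_apply, mk_apply]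
      rw [tmul_balanced, onLeft_tmul])

theorem assocAux_tmul (l : R → Module.End K N) (σ : S → Module.End K N)
    (k : S → Module.End K P) (h : ∀ r s n, l r (σ s n) = σ s (l r n)) (m : M) (n : N) (p : P) :
    assocAux ρ l σ k h (tmul ρ l m n) p = tmul ρ _ m (tmul σ k n p) := by
  unfold assocAux
  rw [lift_tmul]
  rfl

/-- The associativity map `(M ⊗_R N) ⊗_S P → M ⊗_R (N ⊗_S P)`, `(m ⊗ n) ⊗ p ↦ m ⊗ (n ⊗ p)`, where
`N` is an `R`-`S`-bimodule with left action `l` and right action `σ`, the right action of `S` on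
`M ⊗_R N` is that on `N`, and so is the left action of `R` on `N ⊗_S P`. -/
def assoc (ρ : R → Module.End K M) (l : R → Module.End K N) (σ : S → Module.End K N)
    (k : S → Module.End K P) (h : ∀ r s n, l r (σ s n) = σ s (l r n)) :
    BTensor (fun s => onRight ρ l (σ s) (fun r n => (h r s n).symm)) k →ₗ[K]
      BTensor ρ (fun r => onLeft σ k (l r) (fun s n => h r s n)) :=
  lift (assocAux ρ l σ k h) (by
    intro s x p
    have e : ((assocAux ρ l σ k h).flip p).comp (onRight ρ l (σ s) (fun r n => (h r s n).symm)) =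
        (assocAux ρ l σ k h).flip (k s p) := by
      refine hom_ext fun m n => ?_
      simp only [LinearMap.comp_apply, LinearMap.flip_apply, onRight_tmul, assocAux_tmul,
        tmul_balanced]
    exact LinearMap.congr_fun e x)

theorem assoc_tmul (l : R → Module.End K N) (σ : S → Module.End K N)
    (k : S → Module.End K P) (h : ∀ r s n, l r (σ s n) = σ s (l r n)) (m : M) (n : N) (p : P) :
    assoc ρ l σ k h (tmul _ k (tmul ρ l m n) p) = tmul ρ _ m (tmul σ k n p) :=
  (lift_tmul _ _ _ _).trans (assocAux_tmul l σ k h m n p)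

end BTensor

end Tensor

/-! ### Tensor products of algebras over `R`, and their Takeuchi products -/

section Takeuchi

variable {K : Type*} [CommRing K] {R : Type*} {P Q : Type*} [Ring P] [Algebra K P]
  [Ring Q] [Algebra K Q]

/-- `P ⊗_R Q` with `p · r = p * u r` and `r · q = q * v r`. -/
abbrev RTensor (K : Type*) [CommRing K] {R P Q : Type*} [Ring P] [Algebra K P] [Ring Q]
    [Algebra K Q] (u : R → P) (v : R → Q) : Type _ :=
  BTensor (K := K) (fun r => LinearMap.mulRight K (u r)) (fun r => LinearMap.mulRight K (v r))

/-- `P ⊗_R Q` with `p · r = u r * p` and `r · q = v r * q`. -/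
abbrev LTensor (K : Type*) [CommRing K] {R P Q : Type*} [Ring P] [Algebra K P] [Ring Q]
    [Algebra K Q] (u : R → P) (v : R → Q) : Type _ :=
  BTensor (K := K) (fun r => LinearMap.mulLeft K (u r)) (fun r => LinearMap.mulLeft K (v r))

namespace RTensor

variable (K) (u : R → P) (v : R → Q)

/-- The element `p ⊗ q`. -/
abbrev tmul (p : P) (q : Q) : RTensor K u v :=
  BTensor.tmul (K := K) (fun r => LinearMap.mulRight K (u r)) (fun r => LinearMap.mulRight K (v r))
    p q

theorem add_tmul (p p' : P) (q : Q) :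
    tmul K u v (p + p') q = tmul K u v p q + tmul K u v p' q :=
  BTensor.add_tmul _ _ _

theorem tmul_add (p : P) (q q' : Q) :
    tmul K u v p (q + q') = tmul K u v p q + tmul K u v p q' :=
  BTensor.tmul_add _ _ _

theorem smul_tmul (c : K) (p : P) (q : Q) : tmul K u v (c • p) q = c • tmul K u v p q :=
  BTensor.smul_tmul _ _ _

theorem tmul_smul (c : K) (p : P) (q : Q) : tmul K u v p (c • q) = c • tmul K u v p q :=
  BTensor.tmul_smul _ _ _

/-- The operator `p' ⊗ q' ↦ p * p' ⊗ q'`. -/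
def mulFst (p : P) : Module.End K (RTensor K u v) :=
  BTensor.onLeft _ _ (LinearMap.mulLeft K p) (fun r m => by simp [mul_assoc])

/-- The operator `p' ⊗ q' ↦ p' ⊗ q * q'`. -/
def mulSnd (q : Q) : Module.End K (RTensor K u v) :=
  BTensor.onRight _ _ (LinearMap.mulLeft K q) (fun r m => by simp [mul_assoc])

@[simp]
theorem mulFst_tmul (p p' : P) (q' : Q) :
    mulFst K u v p (tmul K u v p' q') = tmul K u v (p * p') q' := by
  exact BTensor.onLeft_tmul _ _ _ _

@[simp]
theorem mulSnd_tmul (q : Q) (p' : P) (q' : Q) :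
    mulSnd K u v q (tmul K u v p' q') = tmul K u v p' (q * q') := by
  exact BTensor.onRight_tmul _ _ _ _

/-- The Takeuchi condition `(u r ⊗ 1) y = (1 ⊗ v r) y` for all `r`. -/
def IsTakeuchi (y : RTensor K u v) : Prop :=
  ∀ r, mulFst K u v (u r) y = mulSnd K u v (v r) y

theorem mulFst_mul (p p' : P) (y : RTensor K u v) :
    mulFst K u v (p * p') y = mulFst K u v p (mulFst K u v p' y) := by
  refine LinearMap.congr_fun (g := mulFst K u v p * mulFst K u v p') ?_ y
  refine BTensor.hom_ext fun m n => ?_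
  rw [Module.End.mul_apply, mulFst_tmul, mulFst_tmul, mulFst_tmul, mul_assoc]

theorem mulSnd_mul (q q' : Q) (y : RTensor K u v) :
    mulSnd K u v (q * q') y = mulSnd K u v q (mulSnd K u v q' y) := by
  refine LinearMap.congr_fun (g := mulSnd K u v q * mulSnd K u v q') ?_ y
  refine BTensor.hom_ext fun m n => ?_
  rw [Module.End.mul_apply, mulSnd_tmul, mulSnd_tmul, mulSnd_tmul, mul_assoc]

theorem mulFst_mulSnd (p : P) (q : Q) (y : RTensor K u v) :
    mulFst K u v p (mulSnd K u v q y) = mulSnd K u v q (mulFst K u v p y) := by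
  refine LinearMap.congr_fun (f := mulFst K u v p * mulSnd K u v q)
    (g := mulSnd K u v q * mulFst K u v p) ?_ y
  refine BTensor.hom_ext fun m n => ?_
  rw [Module.End.mul_apply, Module.End.mul_apply, mulFst_tmul, mulSnd_tmul, mulSnd_tmul,
    mulFst_tmul]

/-- `p ↦ mulFst p` as a linear map. -/
def mulFstₗ : P →ₗ[K] Module.End K (RTensor K u v) where
  toFun := mulFst K u v
  map_add' p p' := BTensor.hom_ext fun m n => by
    rw [LinearMap.add_apply, mulFst_tmul, mulFst_tmul, mulFst_tmul, add_mul, add_tmul]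
  map_smul' c p := BTensor.hom_ext fun m n => by
    rw [RingHom.id_apply, LinearMap.smul_apply, mulFst_tmul, mulFst_tmul, smul_mul_assoc, smul_tmul]

/-- `q ↦ mulSnd q` as a linear map. -/
def mulSndₗ : Q →ₗ[K] Module.End K (RTensor K u v) where
  toFun := mulSnd K u v
  map_add' p p' := BTensor.hom_ext fun m n => by
    rw [LinearMap.add_apply, mulSnd_tmul, mulSnd_tmul, mulSnd_tmul, add_mul, tmul_add]
  map_smul' c p := BTensor.hom_ext fun m n => by
    rw [RingHom.id_apply, LinearMap.smul_apply, mulSnd_tmul, mulSnd_tmul, smul_mul_assoc, tmul_smul]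

/-- The product `x y = ∑ (p ⊗ q) y` for `x = ∑ p ⊗ q`, well defined when `y` satisfies the Takeuchi
condition; `(p ⊗ q) (p' ⊗ q') = p p' ⊗ q q'`. -/
def mul (x y : RTensor K u v) (hy : IsTakeuchi K u v y) : RTensor K u v :=
  BTensor.lift
    (LinearMap.mk₂ K (fun p q => mulFstₗ K u v p (mulSndₗ K u v q y))
      (by intros; simp) (by intros; simp) (by intros; simp) (by intros; simp))
    (by
      intro r p q
      have h := hy r
      simp only [LinearMap.mk₂_apply, mulFstₗ, mulSndₗ, LinearMap.coe_mk, AddHom.coe_mk,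
        LinearMap.mulRight_apply]
      rw [mulFst_mul, mulSnd_mul, ← h, mulFst_mulSnd K u v (u r)])
    x

end RTensor

namespace LTensor

variable (K) (u : R → P) (v : R → Q)

/-- The element `p ⊗ q`. -/
abbrev tmul (p : P) (q : Q) : LTensor K u v :=
  BTensor.tmul (K := K) (fun r => LinearMap.mulLeft K (u r)) (fun r => LinearMap.mulLeft K (v r))
    p q

theorem add_tmul (p p' : P) (q : Q) :
    tmul K u v (p + p') q = tmul K u v p q + tmul K u v p' q :=
  BTensor.add_tmul _ _ _

theorem tmul_add (p : P) (q q' : Q) :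
    tmul K u v p (q + q') = tmul K u v p q + tmul K u v p q' :=
  BTensor.tmul_add _ _ _

theorem smul_tmul (c : K) (p : P) (q : Q) : tmul K u v (c • p) q = c • tmul K u v p q :=
  BTensor.smul_tmul _ _ _

theorem tmul_smul (c : K) (p : P) (q : Q) : tmul K u v p (c • q) = c • tmul K u v p q :=
  BTensor.tmul_smul _ _ _

/-- The operator `p' ⊗ q' ↦ p' * p ⊗ q'`. -/
def mulFst (p : P) : Module.End K (LTensor K u v) :=
  BTensor.onLeft _ _ (LinearMap.mulRight K p) (fun r m => by simp [mul_assoc])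

/-- The operator `p' ⊗ q' ↦ p' ⊗ q' * q`. -/
def mulSnd (q : Q) : Module.End K (LTensor K u v) :=
  BTensor.onRight _ _ (LinearMap.mulRight K q) (fun r m => by simp [mul_assoc])

@[simp]
theorem mulFst_tmul (p p' : P) (q' : Q) :
    mulFst K u v p (tmul K u v p' q') = tmul K u v (p' * p) q' := by
  exact BTensor.onLeft_tmul _ _ _ _

@[simp]
theorem mulSnd_tmul (q : Q) (p' : P) (q' : Q) :
    mulSnd K u v q (tmul K u v p' q') = tmul K u v p' (q' * q) := by
  exact BTensor.onRight_tmul _ _ _ _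

/-- The Takeuchi condition `x (u r ⊗ 1) = x (1 ⊗ v r)` for all `r`. -/
def IsTakeuchi (x : LTensor K u v) : Prop :=
  ∀ r, mulFst K u v (u r) x = mulSnd K u v (v r) x

theorem mulFst_mul (p p' : P) (y : LTensor K u v) :
    mulFst K u v (p * p') y = mulFst K u v p' (mulFst K u v p y) := by
  refine LinearMap.congr_fun (g := mulFst K u v p' * mulFst K u v p) ?_ y
  refine BTensor.hom_ext fun m n => ?_
  rw [Module.End.mul_apply, mulFst_tmul, mulFst_tmul, mulFst_tmul, mul_assoc]

theorem mulSnd_mul (q q' : Q) (y : LTensor K u v) :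
    mulSnd K u v (q * q') y = mulSnd K u v q' (mulSnd K u v q y) := by
  refine LinearMap.congr_fun (g := mulSnd K u v q' * mulSnd K u v q) ?_ y
  refine BTensor.hom_ext fun m n => ?_
  rw [Module.End.mul_apply, mulSnd_tmul, mulSnd_tmul, mulSnd_tmul, mul_assoc]

theorem mulFst_mulSnd (p : P) (q : Q) (y : LTensor K u v) :
    mulFst K u v p (mulSnd K u v q y) = mulSnd K u v q (mulFst K u v p y) := by
  refine LinearMap.congr_fun (f := mulFst K u v p * mulSnd K u v q)
    (g := mulSnd K u v q * mulFst K u v p) ?_ y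
  refine BTensor.hom_ext fun m n => ?_
  rw [Module.End.mul_apply, Module.End.mul_apply, mulFst_tmul, mulSnd_tmul, mulSnd_tmul,
    mulFst_tmul]

/-- `p ↦ mulFst p` as a linear map. -/
def mulFstₗ : P →ₗ[K] Module.End K (LTensor K u v) where
  toFun := mulFst K u v
  map_add' p p' := BTensor.hom_ext fun m n => by
    rw [LinearMap.add_apply, mulFst_tmul, mulFst_tmul, mulFst_tmul, mul_add, add_tmul]
  map_smul' c p := BTensor.hom_ext fun m n => by
    rw [RingHom.id_apply, LinearMap.smul_apply, mulFst_tmul, mulFst_tmul, mul_smul_comm, smul_tmul]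

/-- `q ↦ mulSnd q` as a linear map. -/
def mulSndₗ : Q →ₗ[K] Module.End K (LTensor K u v) where
  toFun := mulSnd K u v
  map_add' p p' := BTensor.hom_ext fun m n => by
    rw [LinearMap.add_apply, mulSnd_tmul, mulSnd_tmul, mulSnd_tmul, mul_add, tmul_add]
  map_smul' c p := BTensor.hom_ext fun m n => by
    rw [RingHom.id_apply, LinearMap.smul_apply, mulSnd_tmul, mulSnd_tmul, mul_smul_comm, tmul_smul]

/-- The product `x y = ∑ x (p ⊗ q)` for `y = ∑ p ⊗ q`, well defined when `x` satisfies the Takeuchi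
condition; `(p' ⊗ q') (p ⊗ q) = p' p ⊗ q' q`. -/
def mul (x y : LTensor K u v) (hx : IsTakeuchi K u v x) : LTensor K u v :=
  BTensor.lift
    (LinearMap.mk₂ K (fun p q => mulFstₗ K u v p (mulSndₗ K u v q x))
      (by intros; simp) (by intros; simp) (by intros; simp) (by intros; simp))
    (by
      intro r p q
      have h := hx r
      simp only [LinearMap.mk₂_apply, mulFstₗ, mulSndₗ, LinearMap.coe_mk, AddHom.coe_mk,
        LinearMap.mulLeft_apply]
      rw [mulFst_mul, mulSnd_mul, ← h, mulFst_mulSnd K u v (u r)])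
    y

end LTensor

end Takeuchi

/-! ### Right bialgebroids, right comodule algebras, right Galois extensions -/

section Right

/-- Source and target maps `R → T`: an algebra homomorphism and an algebra anti-homomorphism with
commuting images. -/
structure SourceTarget (K : Type uK) (R : Type uR) (T : Type uT) [CommRing K] [Ring R]
    [Algebra K R] [Ring T] [Algebra K T] where
  src : R →ₐ[K] T
  tgtOp : Rᵐᵒᵖ →ₐ[K] T
  src_comm_tgtOp : ∀ r r', src r * tgtOp (MulOpposite.op r') = tgtOp (MulOpposite.op r') * src r

/-- The target map `R → T`. -/
def SourceTarget.tgt {K : Type uK} {R : Type uR} {T : Type uT} [CommRing K] [Ring R]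
    [Algebra K R] [Ring T] [Algebra K T] (E : SourceTarget K R T) (r : R) : T :=
  E.tgtOp (MulOpposite.op r)

variable {K : Type uK} {R : Type uR} {T : Type uT} [CommRing K] [Ring R] [Algebra K R] [Ring T]
  [Algebra K T]

theorem SourceTarget.tgt_mul (E : SourceTarget K R T) (r r' : R) :
    E.tgt (r * r') = E.tgt r' * E.tgt r := by
  simp [SourceTarget.tgt]

theorem SourceTarget.tgt_add (E : SourceTarget K R T) (r r' : R) :
    E.tgt (r + r') = E.tgt r + E.tgt r' := by
  simp [SourceTarget.tgt]

theorem SourceTarget.tgt_one (E : SourceTarget K R T) : E.tgt 1 = 1 := by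
  simp [SourceTarget.tgt]

theorem SourceTarget.tgt_zero (E : SourceTarget K R T) : E.tgt 0 = 0 := by
  simp [SourceTarget.tgt]

theorem SourceTarget.tgt_smul (E : SourceTarget K R T) (c : K) (r : R) :
    E.tgt (c • r) = c • E.tgt r := by
  simp [SourceTarget.tgt]

theorem SourceTarget.comm (E : SourceTarget K R T) (r r' : R) :
    E.src r * E.tgt r' = E.tgt r' * E.src r :=
  E.src_comm_tgtOp r r'

namespace SourceTarget

variable (E : SourceTarget K R T)

/-- `T ⊗_R T` for the bimodule structure `r · t · r' = t * src r' * tgt r` on `T`. -/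
abbrev TR : Type _ := RTensor K E.src E.tgt

/-- The left action `r · (t ⊗ t') = (t * tgt r) ⊗ t'` on `T ⊗_R T`. -/
def lactR (r : R) : Module.End K E.TR :=
  BTensor.onLeft _ _ (LinearMap.mulRight K (E.tgt r)) (fun r' m => by
    simp [mul_assoc, E.comm])

/-- The right action `(t ⊗ t') · r = t ⊗ (t' * src r)` on `T ⊗_R T`. -/
def ractR (r : R) : Module.End K E.TR :=
  BTensor.onRight _ _ (LinearMap.mulRight K (E.src r)) (fun r' m => by
    simp [mul_assoc, E.comm])

/-- The left `R`-module structure `r · t = t * tgt r` on `T`. -/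
abbrev leftModuleR : Module R T where
  smul r x := x * E.tgt r
  one_smul x := by change x * E.tgt 1 = x; rw [E.tgt_one, mul_one]
  mul_smul r r' x := by
    change x * E.tgt (r * r') = x * E.tgt r' * E.tgt r; rw [E.tgt_mul, mul_assoc]
  smul_zero r := zero_mul _
  smul_add r x y := add_mul _ _ _
  add_smul r r' x := by
    change x * E.tgt (r + r') = x * E.tgt r + x * E.tgt r'; rw [E.tgt_add, mul_add]
  zero_smul x := by change x * E.tgt 0 = 0; rw [E.tgt_zero, mul_zero]

end SourceTarget

variable (K R T) in
/-- A right bialgebroid `T` over `R`: with the bimodule structure `r · t · r' = t * src r' * tgt r`,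
`T` is an `R`-coring (comultiplication, counit) whose structure is compatible with the algebra
structure. -/
structure RightBialgebroid where
  st : SourceTarget K R T
  comul : T →ₗ[K] st.TR
  counit : T →ₗ[K] R
  comul_lact : ∀ r x, comul (x * st.tgt r) = st.lactR r (comul x)
  comul_ract : ∀ r x, comul (x * st.src r) = st.ractR r (comul x)
  counit_lact : ∀ r x, counit (x * st.tgt r) = r * counit x
  counit_ract : ∀ r x, counit (x * st.src r) = counit x * r
  /-- `(Δ ⊗ id) Δ = (id ⊗ Δ) Δ` in `T ⊗_R T ⊗_R T` -/
  coassoc : ∀ x,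
    BTensor.assoc _ _ _ _ (fun r s n => by simp [mul_assoc, st.comm])
      (BTensor.map (ρ' := fun r => st.ractR r)
        (l' := fun r => LinearMap.mulRight K (st.tgt r))
        comul LinearMap.id (fun r m => comul_ract r m) (fun _ _ => rfl) (comul x)) =
      BTensor.map (ρ' := fun r => LinearMap.mulRight K (st.src r))
        (l' := fun r => st.lactR r)
        LinearMap.id comul (fun _ _ => rfl) (fun r m => comul_lact r m) (comul x)
  /-- `(ε ⊗ id) Δ = id` under `R ⊗_R T = T` -/
  counit_comul : ∀ x,
    BTensor.lift (LinearMap.mk₂ K (fun y z => z * st.tgt (counit y))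
      (by intros; simp [SourceTarget.tgt_add, mul_add])
      (by intros; simp [SourceTarget.tgt_smul])
      (by intros; simp [add_mul]) (by intros; simp))
      (fun r y z => by simp [counit_ract, SourceTarget.tgt_mul, mul_assoc]) (comul x) = x
  /-- `(id ⊗ ε) Δ = id` under `T ⊗_R R = T` -/
  comul_counit : ∀ x,
    BTensor.lift (LinearMap.mk₂ K (fun y z => y * st.src (counit z))
      (by intros; simp [add_mul]) (by intros; simp)
      (by intros; simp [mul_add]) (by intros; simp))
      (fun r y z => by simp [counit_lact, mul_assoc]) (comul x) = x
  comul_one : comul 1 = RTensor.tmul K st.src st.tgt 1 1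
  counit_one : counit 1 = 1
  counit_mul_tgt : ∀ x y, counit (x * y) = counit (st.tgt (counit x) * y)
  counit_mul_src : ∀ x y, counit (x * y) = counit (st.src (counit x) * y)
  /-- `(src r ⊗ 1) Δ(x) = (1 ⊗ tgt r) Δ(x)` -/
  takeuchi : ∀ x, RTensor.IsTakeuchi K st.src st.tgt (comul x)
  comul_mul : ∀ x y, comul (x * y) =
    RTensor.mul K st.src st.tgt (comul x) (comul y) (takeuchi y)

/-- `T` is finitely generated projective as a left `R`-module, `r · t = t * tgt r`. -/
def RightBialgebroid.IsLeftFiniteProjective (H : RightBialgebroid K R T) : Prop :=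
  letI : Module R T := H.st.leftModuleR
  Module.Finite R T ∧ Module.Projective R T

/-- The right `R`-module structure `(a ⊗ t) · r = a ⊗ (t * src r)` on `A ⊗_R T`, where
`i : R → A` makes `A` a right `R`-module. -/
def SourceTarget.coractR (E : SourceTarget K R T) {A : Type uA} [Ring A] [Algebra K A]
    (i : R → A) (r : R) : Module.End K (RTensor K i E.tgt) :=
  BTensor.onRight _ _ (LinearMap.mulRight K (E.src r)) (fun r' m => by
    simp [mul_assoc, E.comm])

/-- A right `T`-comodule algebra structure on `A`: an algebra map `R → A` and a coaction
`δ : A → A ⊗_R T` making `A` a right comodule of the `R`-coring `T` (where `a · r = a * base r`),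
compatible with the algebra structures. -/
structure RightComoduleAlgebra (H : RightBialgebroid K R T) (A : Type uA) [Ring A]
    [Algebra K A] where
  base : R →ₐ[K] A
  coact : A →ₗ[K] RTensor K base H.st.tgt
  coact_ract : ∀ r a, coact (a * base r) = H.st.coractR base r (coact a)
  /-- `(δ ⊗ id) δ = (id ⊗ Δ) δ` in `A ⊗_R T ⊗_R T` -/
  coassoc : ∀ a,
    BTensor.assoc _ _ _ _ (fun r s n => by simp [mul_assoc, H.st.comm])
      (BTensor.map (ρ' := fun r => H.st.coractR base r)
        (l' := fun r => LinearMap.mulRight K (H.st.tgt r))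
        coact LinearMap.id (fun r m => coact_ract r m) (fun _ _ => rfl) (coact a)) =
      BTensor.map (ρ' := fun r => LinearMap.mulRight K (base r))
        (l' := fun r => H.st.lactR r)
        LinearMap.id H.comul (fun _ _ => rfl) (fun r m => H.comul_lact r m) (coact a)
  /-- `(id ⊗ ε) δ = id` under `A ⊗_R R = A` -/
  counital : ∀ a,
    BTensor.lift (LinearMap.mk₂ K (fun y z => y * base (H.counit z))
      (by intros; simp [add_mul]) (by intros; simp)
      (by intros; simp [mul_add]) (by intros; simp))
      (fun r y z => by simp [H.counit_lact, mul_assoc]) (coact a) = a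
  coact_one : coact 1 = RTensor.tmul K base H.st.tgt 1 1
  /-- `(base r ⊗ 1) δ(a) = (1 ⊗ tgt r) δ(a)` -/
  takeuchi : ∀ a, RTensor.IsTakeuchi K base H.st.tgt (coact a)
  coact_mul : ∀ a a', coact (a * a') =
    RTensor.mul K base H.st.tgt (coact a) (coact a') (takeuchi a')

end Right

/-! ### Left bialgebroids, left comodule algebras, left Galois extensions -/

section Left

variable {K : Type uK} {R : Type uR} {T : Type uT} [CommRing K] [Ring R] [Algebra K R] [Ring T]
  [Algebra K T]

namespace SourceTarget

variable (E : SourceTarget K R T)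

theorem comm_assoc (r r' : R) (x : T) :
    E.src r * (E.tgt r' * x) = E.tgt r' * (E.src r * x) := by
  rw [← mul_assoc, E.comm, mul_assoc]

/-- `T ⊗_R T` for the bimodule structure `r · t · r' = src r * tgt r' * t` on `T`. -/
abbrev TL : Type _ := LTensor K E.tgt E.src

/-- The left action `r · (t ⊗ t') = (src r * t) ⊗ t'` on `T ⊗_R T`. -/
def lactL (r : R) : Module.End K E.TL :=
  BTensor.onLeft _ _ (LinearMap.mulLeft K (E.src r)) (fun r' m => by simp [E.comm_assoc])

/-- The right action `(t ⊗ t') · r = t ⊗ (tgt r * t')` on `T ⊗_R T`. -/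
def ractL (r : R) : Module.End K E.TL :=
  BTensor.onRight _ _ (LinearMap.mulLeft K (E.tgt r)) (fun r' m => by simp [E.comm_assoc])

/-- The right `R`-module structure `t · r = tgt r * t` on `T`. -/
abbrev rightModuleL : Module Rᵐᵒᵖ T := Module.compHom T (E.tgtOp : Rᵐᵒᵖ →+* T)

end SourceTarget

variable (K R T) in
/-- A left bialgebroid `T` over `R`: with the bimodule structure `r · t · r' = src r * tgt r' * t`,
`T` is an `R`-coring (comultiplication, counit) whose structure is compatible with the algebra
structure. -/
structure LeftBialgebroid where
  st : SourceTarget K R T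
  comul : T →ₗ[K] st.TL
  counit : T →ₗ[K] R
  comul_lact : ∀ r x, comul (st.src r * x) = st.lactL r (comul x)
  comul_ract : ∀ r x, comul (st.tgt r * x) = st.ractL r (comul x)
  counit_lact : ∀ r x, counit (st.src r * x) = r * counit x
  counit_ract : ∀ r x, counit (st.tgt r * x) = counit x * r
  /-- `(Δ ⊗ id) Δ = (id ⊗ Δ) Δ` in `T ⊗_R T ⊗_R T` -/
  coassoc : ∀ x,
    BTensor.assoc _ _ _ _ (fun r s n => by simp [st.comm_assoc])
      (BTensor.map (ρ' := fun r => st.ractL r)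
        (l' := fun r => LinearMap.mulLeft K (st.src r))
        comul LinearMap.id (fun r m => comul_ract r m) (fun _ _ => rfl) (comul x)) =
      BTensor.map (ρ' := fun r => LinearMap.mulLeft K (st.tgt r))
        (l' := fun r => st.lactL r)
        LinearMap.id comul (fun _ _ => rfl) (fun r m => comul_lact r m) (comul x)
  /-- `(ε ⊗ id) Δ = id` under `R ⊗_R T = T` -/
  counit_comul : ∀ x,
    BTensor.lift (LinearMap.mk₂ K (fun y z => st.src (counit y) * z)
      (by intros; simp [add_mul]) (by intros; simp)
      (by intros; simp [mul_add]) (by intros; simp))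
      (fun r y z => by simp [counit_ract, mul_assoc]) (comul x) = x
  /-- `(id ⊗ ε) Δ = id` under `T ⊗_R R = T` -/
  comul_counit : ∀ x,
    BTensor.lift (LinearMap.mk₂ K (fun y z => st.tgt (counit z) * y)
      (by intros; simp [mul_add]) (by intros; simp)
      (by intros; simp [SourceTarget.tgt_add, add_mul])
      (by intros; simp [SourceTarget.tgt_smul]))
      (fun r y z => by simp [counit_lact, SourceTarget.tgt_mul, mul_assoc]) (comul x) = x
  comul_one : comul 1 = LTensor.tmul K st.tgt st.src 1 1
  counit_one : counit 1 = 1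
  counit_mul_src : ∀ x y, counit (x * y) = counit (x * st.src (counit y))
  counit_mul_tgt : ∀ x y, counit (x * y) = counit (x * st.tgt (counit y))
  /-- `Δ(x) (tgt r ⊗ 1) = Δ(x) (1 ⊗ src r)` -/
  takeuchi : ∀ x, LTensor.IsTakeuchi K st.tgt st.src (comul x)
  comul_mul : ∀ x y, comul (x * y) =
    LTensor.mul K st.tgt st.src (comul x) (comul y) (takeuchi x)

/-- `T` is finitely generated projective as a right `R`-module, `t · r = tgt r * t`. -/
def LeftBialgebroid.IsRightFiniteProjective (H : LeftBialgebroid K R T) : Prop :=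
  letI : Module Rᵐᵒᵖ T := H.st.rightModuleL
  Module.Finite Rᵐᵒᵖ T ∧ Module.Projective Rᵐᵒᵖ T

/-- The left `R`-module structure `r · (t ⊗ a) = (src r * t) ⊗ a` on `T ⊗_R A`, where `i : R → A`
makes `A` a left `R`-module. -/
def SourceTarget.colactL (E : SourceTarget K R T) {A : Type uA} [Ring A] [Algebra K A]
    (i : R → A) (r : R) : Module.End K (LTensor K E.tgt i) :=
  BTensor.onLeft _ _ (LinearMap.mulLeft K (E.src r)) (fun r' m => by simp [E.comm_assoc])

/-- A left `T`-comodule algebra structure on `A`: an algebra map `R → A` and a coaction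
`δ : A → T ⊗_R A` making `A` a left comodule of the `R`-coring `T` (where `r · a = base r * a`),
compatible with the algebra structures. -/
structure LeftComoduleAlgebra (H : LeftBialgebroid K R T) (A : Type uA) [Ring A]
    [Algebra K A] where
  base : R →ₐ[K] A
  coact : A →ₗ[K] LTensor K H.st.tgt base
  coact_lact : ∀ r a, coact (base r * a) = H.st.colactL base r (coact a)
  /-- `(Δ ⊗ id) δ = (id ⊗ δ) δ` in `T ⊗_R T ⊗_R A` -/
  coassoc : ∀ a,
    BTensor.assoc _ _ _ _ (fun r s n => by simp [H.st.comm_assoc])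
      (BTensor.map (ρ' := fun r => H.st.ractL r)
        (l' := fun r => LinearMap.mulLeft K (base r))
        H.comul LinearMap.id (fun r m => H.comul_ract r m) (fun _ _ => rfl) (coact a)) =
      BTensor.map (ρ' := fun r => LinearMap.mulLeft K (H.st.tgt r))
        (l' := fun r => H.st.colactL base r)
        LinearMap.id coact (fun _ _ => rfl) (fun r m => coact_lact r m) (coact a)
  /-- `(ε ⊗ id) δ = id` under `R ⊗_R A = A` -/
  counital : ∀ a,
    BTensor.lift (LinearMap.mk₂ K (fun y z => base (H.counit y) * z)
      (by intros; simp [add_mul]) (by intros; simp)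
      (by intros; simp [mul_add]) (by intros; simp))
      (fun r y z => by simp [H.counit_ract, mul_assoc]) (coact a) = a
  coact_one : coact 1 = LTensor.tmul K H.st.tgt base 1 1
  /-- `δ(a) (tgt r ⊗ 1) = δ(a) (1 ⊗ base r)` -/
  takeuchi : ∀ a, LTensor.IsTakeuchi K H.st.tgt base (coact a)
  coact_mul : ∀ a a', coact (a * a') =
    LTensor.mul K H.st.tgt base (coact a) (coact a') (takeuchi a)

end Left

/-! ### Algebra extensions -/

section Extension

variable {K : Type uK} {B : Type uB} {A : Type uA} [CommRing K] [Ring B] [Algebra K B] [Ring A]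
  [Algebra K A]

/-- The tensor square `A ⊗_B A` of an algebra extension `f : B → A`. -/
abbrev TensorSquare (f : B →ₐ[K] A) : Type _ :=
  BTensor (fun b => LinearMap.mulRight K (f b)) (fun b => LinearMap.mulLeft K (f b))

namespace TensorSquare

variable (f : B →ₐ[K] A)

/-- The element `x ⊗ y`. -/
abbrev tmul (x y : A) : TensorSquare f :=
  BTensor.tmul (fun b => LinearMap.mulRight K (f b)) (fun b => LinearMap.mulLeft K (f b)) x y

/-- The left action `a · (x ⊗ y) = a x ⊗ y`. -/
def lact (a : A) : Module.End K (TensorSquare f) :=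
  BTensor.onLeft _ _ (LinearMap.mulLeft K a) (fun b m => by simp [mul_assoc])

/-- The right action `(x ⊗ y) · a = x ⊗ y a`. -/
def ract (a : A) : Module.End K (TensorSquare f) :=
  BTensor.onRight _ _ (LinearMap.mulRight K a) (fun b m => by simp [mul_assoc])

end TensorSquare

/-- Right depth two: for some `n`, the `A`-`B`-bimodule `A ⊗_B A` is isomorphic to a direct summand
of `A ^ n`. -/
def IsRightDepthTwo (f : B →ₐ[K] A) : Prop :=
  ∃ (n : ℕ) (ι : TensorSquare f →ₗ[K] (Fin n → A)) (π : (Fin n → A) →ₗ[K] TensorSquare f),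
    (∀ a x j, ι (TensorSquare.lact f a x) j = a * ι x j) ∧
    (∀ b x j, ι (TensorSquare.ract f (f b) x) j = ι x j * f b) ∧
    (∀ a v, π (fun j => a * v j) = TensorSquare.lact f a (π v)) ∧
    (∀ b v, π (fun j => v j * f b) = TensorSquare.ract f (f b) (π v)) ∧
    ∀ x, π (ι x) = x

/-- Left depth two: for some `n`, the `B`-`A`-bimodule `A ⊗_B A` is isomorphic to a direct summand
of `A ^ n`. -/
def IsLeftDepthTwo (f : B →ₐ[K] A) : Prop :=
  ∃ (n : ℕ) (ι : TensorSquare f →ₗ[K] (Fin n → A)) (π : (Fin n → A) →ₗ[K] TensorSquare f),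
    (∀ b x j, ι (TensorSquare.lact f (f b) x) j = f b * ι x j) ∧
    (∀ a x j, ι (TensorSquare.ract f a x) j = ι x j * a) ∧
    (∀ b v, π (fun j => f b * v j) = TensorSquare.lact f (f b) (π v)) ∧
    (∀ a v, π (fun j => v j * a) = TensorSquare.ract f a (π v)) ∧
    ∀ x, π (ι x) = x

/-- A module `M` over `S` is balanced if the canonical map from `S` to the endomorphism ring of `M`
over `End_S M` is bijective. -/
def IsBalancedModule (S : Type*) (M : Type*) [Ring S] [AddCommGroup M] [Module S M] : Prop :=
  Function.Bijective (Module.toModuleEnd (Module.End S M) (S := S) M)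

/-- Right balanced: the right `B`-module `A` is balanced. -/
def IsRightBalanced (f : B →ₐ[K] A) : Prop :=
  letI : Module Bᵐᵒᵖ A := Module.compHom A (RingHom.op (f : B →+* A))
  IsBalancedModule Bᵐᵒᵖ A

/-- Left balanced: the left `B`-module `A` is balanced. -/
def IsLeftBalanced (f : B →ₐ[K] A) : Prop :=
  letI : Module B A := Module.compHom A (f : B →+* A)
  IsBalancedModule B A

end Extension

/-! ### Galois extensions -/

section Galois

variable {K : Type uK} {R : Type uR} {T : Type uT} [CommRing K] [Ring R] [Algebra K R] [Ring T]
  [Algebra K T] {B : Type uB} {A : Type uA} [Ring B] [Algebra K B] [Ring A] [Algebra K A]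

namespace RightComoduleAlgebra

variable {H : RightBialgebroid K R T} (C : RightComoduleAlgebra H A)

/-- The coinvariants `{a | δ(a) = a ⊗ 1}`. -/
def coinvariants : Set A := {a | C.coact a = RTensor.tmul K C.base H.st.tgt a 1}

/-- The Galois map `A ⊗_B A → A ⊗_R T`, `a ⊗ a' ↦ a a'₍₀₎ ⊗ a'₍₁₎`. -/
def galoisMap (f : B →ₐ[K] A) (hf : Set.range f = C.coinvariants) :
    TensorSquare f →ₗ[K] RTensor K C.base H.st.tgt :=
  BTensor.lift ((RTensor.mulFstₗ K C.base H.st.tgt).compl₂ C.coact) (by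
    intro b a a'
    have hb : C.coact (f b) = RTensor.tmul K C.base H.st.tgt (f b) 1 :=
      (hf ▸ Set.mem_range_self b : f b ∈ C.coinvariants)
    have h1 : RTensor.mulSnd K C.base H.st.tgt 1 (C.coact a') = C.coact a' := by
      refine LinearMap.congr_fun (g := LinearMap.id) (BTensor.hom_ext fun m n => ?_) _
      simp [RTensor.mulSnd, BTensor.onRight_tmul]
    simp only [LinearMap.compl₂_apply, LinearMap.mulRight_apply, LinearMap.mulLeft_apply,
      C.coact_mul, hb, RTensor.mul, BTensor.lift_tmul, LinearMap.mk₂_apply, RTensor.mulFstₗ,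
      RTensor.mulSndₗ, LinearMap.coe_mk, AddHom.coe_mk, h1, RTensor.mulFst_mul])

/-- `f : B → A` is a right `T`-Galois extension: its image is the set of coinvariants and the
Galois map is bijective. -/
def IsGalois (f : B →ₐ[K] A) : Prop :=
  ∃ hf : Set.range f = C.coinvariants, Function.Bijective (C.galoisMap f hf)

end RightComoduleAlgebra

namespace LeftComoduleAlgebra

variable {H : LeftBialgebroid K R T} (C : LeftComoduleAlgebra H A)

/-- The coinvariants `{a | δ(a) = 1 ⊗ a}`. -/
def coinvariants : Set A := {a | C.coact a = LTensor.tmul K H.st.tgt C.base 1 a}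

/-- The Galois map `A ⊗_B A → T ⊗_R A`, `a ⊗ a' ↦ a₍₋₁₎ ⊗ a₍₀₎ a'`. -/
def galoisMap (f : B →ₐ[K] A) (hf : Set.range f = C.coinvariants) :
    TensorSquare f →ₗ[K] LTensor K H.st.tgt C.base :=
  BTensor.lift ((LTensor.mulSndₗ K H.st.tgt C.base).compl₂ C.coact).flip (by
    intro b a a'
    have hb : C.coact (f b) = LTensor.tmul K H.st.tgt C.base 1 (f b) :=
      (hf ▸ Set.mem_range_self b : f b ∈ C.coinvariants)
    have h1 : ∀ y, LTensor.mulFst K H.st.tgt C.base 1 y = y := by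
      refine LinearMap.congr_fun (g := LinearMap.id) (BTensor.hom_ext fun m n => ?_)
      simp [LTensor.mulFst, BTensor.onLeft_tmul]
    simp only [LinearMap.flip_apply, LinearMap.compl₂_apply, LinearMap.mulRight_apply,
      LinearMap.mulLeft_apply, C.coact_mul, hb, LTensor.mul, BTensor.lift_tmul,
      LinearMap.mk₂_apply, LTensor.mulFstₗ, LTensor.mulSndₗ, LinearMap.coe_mk, AddHom.coe_mk, h1,
      LTensor.mulSnd_mul])

/-- `f : B → A` is a left `T`-Galois extension: its image is the set of coinvariants and the
Galois map is bijective. -/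
def IsGalois (f : B →ₐ[K] A) : Prop :=
  ∃ hf : Set.range f = C.coinvariants, Function.Bijective (C.galoisMap f hf)

end LeftComoduleAlgebra

/-- `f : B → A` is a right `T`-Galois extension for some left finite projective right bialgebroid
`T` over some algebra `R` (with `R` and `T` in prescribed universes). -/
def IsRightBialgebroidGalois (f : B →ₐ[K] A) : Prop :=
  ∃ (R : Type uR) (T : Type uT) (_ : Ring R) (_ : Algebra K R) (_ : Ring T) (_ : Algebra K T)
    (H : RightBialgebroid K R T) (C : RightComoduleAlgebra H A),
    H.IsLeftFiniteProjective ∧ C.IsGalois f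

/-- `f : B → A` is a left `T`-Galois extension for some right finite projective left bialgebroid
`T` over some algebra `R` (with `R` and `T` in prescribed universes). -/
def IsLeftBialgebroidGalois (f : B →ₐ[K] A) : Prop :=
  ∃ (R : Type uR) (T : Type uT) (_ : Ring R) (_ : Algebra K R) (_ : Ring T) (_ : Algebra K T)
    (H : LeftBialgebroid K R T) (C : LeftComoduleAlgebra H A),
    H.IsRightFiniteProjective ∧ C.IsGalois f

end Galois

end DepthTwo

/-! Galois implies depth two and balanced. A finite dual basis (eⱼ, cⱼ) of `T` over `R` expands
every z in A ⊗_R T as ∑ (id ⊗ cⱼ)(z) ⊗ eⱼ, so A ⊗_R T is a direct summand of Aⁿ, and the Galois map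
carries this splitting over to A ⊗_B A. Coinvariants commute with the image of R in A, which makes
the splitting compatible with the right action of B. For the same reason the maps (id ⊗ cⱼ)δ and the
right multiplications by elements of R are endomorphisms of A_B. If right multiplication by x
commutes with all of these, then δ(x) and x ⊗ 1 have the same slices, so x is coinvariant and lies
in B.

Conversely, take for R the centralizer of B in A and for T the algebra of endomorphisms of the
A-A-bimodule A ⊗_B A. Evaluation at 1 ⊗ 1 identifies T with the elements t = t¹ ⊗ t² of A ⊗_B A that
commute with B. The depth two splitting amounts to a quasibasis: γⱼ in Γ = End(_B A_B) and uⱼ in T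
with 1 ⊗ a = ∑ γⱼ(a) uⱼ. Each γ in Γ defines a left R-linear functional t ↦ t¹ γ(t²) on T, and the
functionals of the γⱼ together with the uⱼ form a dual basis. So T is left finite projective, and Γ
plays the part of its dual.

Coactions of T are therefore built from actions of Γ (`RightDualSystem`, `RightModuleAlgebra`). The
formula δ(a) = ∑ γⱼ(a) ⊗ uⱼ gives a map whose slice by any γ is the action of γ, by
`RightModuleAlgebra.slice_coact`. Slices separate points, so the comodule algebra axioms reduce to
identities about the action of Γ. Evaluation on A gives the coaction; the action t ↦ t¹ ⊗ γ(t²) on T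
gives the comultiplication, with the multiplication map t ↦ t¹ t² as counit.

The slice of the Galois map by γ is x ⊗ y ↦ x γ(y), and the quasibasis recovers an element of A ⊗_B
A from these contractions; this gives bijectivity. Balancedness enters only in identifying the
coinvariants. If a is coinvariant, then γ(a) = a γ(1) for all γ, so the quasibasis gives 1 ⊗ a = a ⊗
1 in A ⊗_B A, and right multiplication by a commutes with End(A_B).

The left-handed theorem is the mirror image, with a ⊗ 1 = ∑ uⱼ γⱼ(a), the functionals t ↦ γ(t¹) t²,
and the opposite of the algebra T. -/

namespace DepthTwo

/-! ### Separating points of M ⊗_R N by maps out of one factor -/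

section Slices

variable {K : Type*} [CommRing K] {R : Type*}
  {M N P M' N' N'' : Type*} [AddCommGroup M] [Module K M] [AddCommGroup N] [Module K N]
  [AddCommGroup P] [Module K P] [AddCommGroup M'] [Module K M'] [AddCommGroup N'] [Module K N']
  [AddCommGroup N''] [Module K N'']

/-- Jointly split families of `R`-linear maps out of `N` are jointly injective on `M ⊗_R N`. -/
theorem BTensor.ext_of_map_right {ρ : R → Module.End K M} {l : R → Module.End K N}
    {l' : R → Module.End K N'} {ι : Type*} [Fintype ι] (h : ι → N →ₗ[K] N') (g : ι → N' →ₗ[K] N)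
    (hh : ∀ j r n, h j (l r n) = l' r (h j n)) (hg : ∀ j r n, g j (l' r n) = l r (g j n))
    (hgh : ∀ n, ∑ j, g j (h j n) = n) {x y : BTensor ρ l}
    (hxy : ∀ j, BTensor.map (ρ' := ρ) LinearMap.id (h j) (fun _ _ => rfl) (hh j) x =
      BTensor.map (ρ' := ρ) LinearMap.id (h j) (fun _ _ => rfl) (hh j) y) : x = y := by
  -- The decomposition ∑ gⱼ hⱼ = 1 of the identity of N survives M ⊗_R -, so an element is recovered
  -- from its images under the id ⊗ hⱼ.
  have key : ∑ j, (BTensor.map (ρ := ρ) (ρ' := ρ) LinearMap.id (g j) (fun _ _ => rfl) (hg j)) ∘ₗ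
      (BTensor.map (ρ' := ρ) LinearMap.id (h j) (fun _ _ => rfl) (hh j)) =
      (LinearMap.id : BTensor ρ l →ₗ[K] BTensor ρ l) := by
    refine BTensor.hom_ext fun m n => ?_
    simp only [LinearMap.sum_apply, LinearMap.comp_apply, BTensor.map_tmul, LinearMap.id_apply]
    simp only [← BTensor.mk_apply]
    rw [← map_sum, hgh]
  rw [← LinearMap.id_apply (R := K) x, ← LinearMap.id_apply (R := K) y, ← key]
  simp only [LinearMap.sum_apply, LinearMap.comp_apply, hxy]

end Slices

/-! ### Slices and dual bases for left R-modules -/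

section RightSlices

variable {K : Type*} [CommRing K] {R P Q : Type*} [Ring R] [Algebra K R] [Ring P] [Algebra K P]
  [Ring Q] [Algebra K Q]

/-- The map `id ⊗ α : P ⊗_R Q → P`, `p ⊗ q ↦ p * u (α q)`, for a left `R`-linear `α : Q → R`. -/
def RTensor.slice (u : R →ₐ[K] P) (v : R → Q) (α : Q →ₗ[K] R)
    (hα : ∀ r q, α (q * v r) = r * α q) : RTensor K u v →ₗ[K] P :=
  BTensor.lift (LinearMap.mk₂ K (fun p q => p * u (α q))
    (by intros; simp [add_mul]) (by intros; simp)
    (by intros; simp [mul_add]) (by intros; simp))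
    (fun r p q => by simp [hα, mul_assoc])

@[simp]
theorem RTensor.slice_tmul (u : R →ₐ[K] P) (v : R → Q) (α : Q →ₗ[K] R)
    (hα : ∀ r q, α (q * v r) = r * α q) (p : P) (q : Q) :
    RTensor.slice u v α hα (RTensor.tmul K u v p q) = p * u (α q) :=
  BTensor.lift_tmul _ _ _ _

theorem RTensor.slice_mulFst (u : R →ₐ[K] P) (v : R → Q) (α : Q →ₗ[K] R)
    (hα : ∀ r q, α (q * v r) = r * α q) (p : P) (w : RTensor K u v) :
    RTensor.slice u v α hα (RTensor.mulFst K u v p w) = p * RTensor.slice u v α hα w := by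
  refine LinearMap.congr_fun (f := RTensor.slice u v α hα ∘ₗ RTensor.mulFst K u v p)
    (g := LinearMap.mulLeft K p ∘ₗ RTensor.slice u v α hα) (BTensor.hom_ext fun m n => ?_) w
  simp [mul_assoc]

/-- A finite dual basis of the left `R`-module `Q`, `r · q = q * v r`. -/
structure RightDualBasis (K : Type*) [CommRing K] {R Q : Type*} [Ring R] [Algebra K R] [Ring Q]
    [Algebra K Q] (v : R → Q) where
  n : ℕ
  elem : Fin n → Q
  coord : Fin n → Q →ₗ[K] R
  coord_mul : ∀ j r q, coord j (q * v r) = r * coord j q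
  sum_eq : ∀ q, ∑ j, elem j * v (coord j q) = q

variable {v : R → Q}

/-- On p ⊗ q the coefficient of eⱼ is p · cⱼ(q); moving the scalar cⱼ(q) across the tensor sign
leaves p ⊗ ∑ eⱼ v(cⱼ(q)) = p ⊗ q. This is what exhibits P ⊗_R Q as a summand of Pⁿ. -/
theorem RightDualBasis.sum_slice (D : RightDualBasis K v) (u : R →ₐ[K] P) (w : RTensor K u v) :
    ∑ j, RTensor.tmul K u v (RTensor.slice u v (D.coord j) (D.coord_mul j) w) (D.elem j) = w := by
  have key : ∑ j, ((BTensor.mk _ _).flip (D.elem j)) ∘ₗ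
      (RTensor.slice u v (D.coord j) (D.coord_mul j)) =
      (LinearMap.id : RTensor K u v →ₗ[K] RTensor K u v) := by
    refine BTensor.hom_ext fun p q => ?_
    simp only [LinearMap.sum_apply, LinearMap.comp_apply, LinearMap.id_apply, LinearMap.flip_apply]
    have h : ∀ j, BTensor.mk (K := K) (fun r => LinearMap.mulRight K (u r))
        (fun r => LinearMap.mulRight K (v r))
        (RTensor.slice u v (D.coord j) (D.coord_mul j) (BTensor.tmul _ _ p q)) (D.elem j) =
        BTensor.mk (K := K) (fun r => LinearMap.mulRight K (u r))
        (fun r => LinearMap.mulRight K (v r)) p (D.elem j * v (D.coord j q)) := by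
      intro j
      rw [BTensor.mk_apply, BTensor.mk_apply, RTensor.slice_tmul]
      exact BTensor.tmul_balanced (D.coord j q) p (D.elem j)
    rw [Finset.sum_congr rfl fun j _ => h j, ← map_sum, D.sum_eq, BTensor.mk_apply]
  refine Eq.trans ?_ (LinearMap.congr_fun key w)
  rw [LinearMap.sum_apply]
  rfl

/-- The slices along a dual basis separate points; equations in P ⊗_R Q are tested in P through
this. -/
theorem RightDualBasis.ext_slice (D : RightDualBasis K v) {u : R →ₐ[K] P} {w w' : RTensor K u v}
    (h : ∀ j, RTensor.slice u v (D.coord j) (D.coord_mul j) w =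
      RTensor.slice u v (D.coord j) (D.coord_mul j) w') : w = w' := by
  rw [← D.sum_slice u w, ← D.sum_slice u w']
  exact Finset.sum_congr rfl fun j _ => by rw [h j]

end RightSlices

namespace TensorSquare

variable {K : Type*} {B : Type*} {A : Type*} [CommRing K] [Ring B] [Algebra K B] [Ring A]
  [Algebra K A] (f : B →ₐ[K] A)

@[simp]
theorem lact_tmul (a x y : A) : lact f a (tmul f x y) = tmul f (a * x) y := by
  exact BTensor.onLeft_tmul _ _ _ _

@[simp]
theorem ract_tmul (a x y : A) : ract f a (tmul f x y) = tmul f x (y * a) := by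
  exact BTensor.onRight_tmul _ _ _ _

end TensorSquare

/-! ### Right Galois extensions are right depth two and right balanced -/

section RightGaloisForward

variable {K : Type uK} {R : Type uR} {T : Type uT} [CommRing K] [Ring R] [Algebra K R] [Ring T]
  [Algebra K T] {B : Type uB} {A : Type uA} [Ring B] [Algebra K B] [Ring A] [Algebra K A]

theorem RightBialgebroid.IsLeftFiniteProjective.exists_dualBasis {H : RightBialgebroid K R T}
    (h : H.IsLeftFiniteProjective) : Nonempty (RightDualBasis K H.st.tgt) := by
  let _ : Module R T := H.st.leftModuleR
  obtain ⟨h1, h2⟩ := h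
  obtain ⟨n, p, hp⟩ := Module.Finite.exists_fin' R T
  obtain ⟨i, hi⟩ := Module.projective_lifting_property p LinearMap.id hp
  have smul_def : ∀ (r : R) (x : T), r • x = x * H.st.tgt r := fun _ _ => rfl
  -- `K` acts on `T` through the target map, so the coordinates of an R-linear splitting are
  -- automatically K-linear.
  have hK : ∀ (c : K) (x : T), c • x = algebraMap K R c • x := by
    intro c x
    rw [smul_def, Algebra.algebraMap_eq_smul_one, SourceTarget.tgt_smul, SourceTarget.tgt_one,
      mul_smul_comm, mul_one]
  refine ⟨⟨n, fun j => p (Pi.single j 1), fun j =>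
    { toFun := fun x => i x j
      map_add' := fun x y => by rw [map_add, Pi.add_apply]
      map_smul' := fun c x => ?_ }, fun j r q => ?_, fun q => ?_⟩⟩
  · rw [hK, map_smul, Pi.smul_apply, smul_eq_mul, RingHom.id_apply, Algebra.smul_def]
  · exact congrFun (map_smul i r q) j
  · have : p (i q) = q := LinearMap.congr_fun hi q
    conv_rhs => rw [← this, ← Finset.univ_sum_single (i q), map_sum]
    refine Finset.sum_congr rfl fun j _ => ?_
    change (i q j) • p (Pi.single j 1) = _
    rw [← map_smul, ← Pi.single_smul', smul_eq_mul, mul_one]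

namespace RightComoduleAlgebra

variable {H : RightBialgebroid K R T} (C : RightComoduleAlgebra H A)

/-- For δ(x) = x ⊗ 1 the Takeuchi condition reads rx ⊗ 1 = x ⊗ t(r). Applying id ⊗ ε gives rx = xr,
since ε(t(r)) = r ε(1) = r. -/
theorem base_comm_of_mem_coinvariants {x : A} (hx : x ∈ C.coinvariants) (r : R) :
    C.base r * x = x * C.base r := by
  have h := C.takeuchi x r
  rw [show C.coact x = _ from hx, RTensor.mulFst_tmul, RTensor.mulSnd_tmul, mul_one] at h
  have h' := congrArg (RTensor.slice C.base H.st.tgt H.counit H.counit_lact) h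
  rw [RTensor.slice_tmul, RTensor.slice_tmul] at h'
  have e : H.counit (H.st.tgt r) = r := by
    simpa [H.counit_one] using H.counit_lact r 1
  simpa [H.counit_one, e] using h'

/-- The operator `a ⊗ t ↦ a * x ⊗ t` on `A ⊗_R T` for a coinvariant `x`. -/
def mulCoinv {x : A} (hx : x ∈ C.coinvariants) : Module.End K (RTensor K C.base H.st.tgt) :=
  BTensor.onLeft _ _ (LinearMap.mulRight K x) (fun r m => by
    simp [mul_assoc, C.base_comm_of_mem_coinvariants hx])

theorem mulCoinv_tmul {x : A} (hx : x ∈ C.coinvariants) (a : A) (t : T) :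
    C.mulCoinv hx (RTensor.tmul K C.base H.st.tgt a t) =
      RTensor.tmul K C.base H.st.tgt (a * x) t := by
  exact BTensor.onLeft_tmul _ _ _ _

/-- Multiplicativity of δ together with δ(x) = x ⊗ 1 shows that δ is right linear over the
coinvariants, which act on the first factor of A ⊗_R T. -/
theorem coact_mul_coinvariant {x : A} (hx : x ∈ C.coinvariants) (a : A) :
    C.coact (a * x) = C.mulCoinv hx (C.coact a) := by
  rw [C.coact_mul]
  -- The product takes a proof of the Takeuchi condition for its right factor, so that factor and
  -- its proof are generalized before x ⊗ 1 is substituted.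
  suffices h : ∀ (y : RTensor K C.base H.st.tgt) (hy : RTensor.IsTakeuchi K C.base H.st.tgt y),
      y = RTensor.tmul K C.base H.st.tgt x 1 → ∀ w,
      RTensor.mul K C.base H.st.tgt w y hy = C.mulCoinv hx w from h _ _ hx _
  rintro _ hy rfl w
  refine LinearMap.congr_fun (g := C.mulCoinv hx) (BTensor.hom_ext fun m n => ?_) w
  rw [mulCoinv_tmul, BTensor.lift_tmul]
  simp [RTensor.mulFstₗ, RTensor.mulSndₗ]

theorem slice_mulCoinv (α : T →ₗ[K] R) (hα : ∀ r q, α (q * H.st.tgt r) = r * α q) {x : A}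
    (hx : x ∈ C.coinvariants) (w : RTensor K C.base H.st.tgt) :
    RTensor.slice C.base H.st.tgt α hα (C.mulCoinv hx w) =
      RTensor.slice C.base H.st.tgt α hα w * x := by
  refine LinearMap.congr_fun (f := RTensor.slice C.base H.st.tgt α hα ∘ₗ C.mulCoinv hx)
    (g := LinearMap.mulRight K x ∘ₗ RTensor.slice C.base H.st.tgt α hα)
    (BTensor.hom_ext fun m n => ?_) w
  simp only [LinearMap.comp_apply, mulCoinv_tmul, RTensor.slice_tmul, LinearMap.mulRight_apply,
    mul_assoc, C.base_comm_of_mem_coinvariants hx]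

variable {f : B →ₐ[K] A} (hf : Set.range f = C.coinvariants)

theorem galoisMap_tmul (a a' : A) :
    C.galoisMap f hf (TensorSquare.tmul f a a') =
      RTensor.mulFst K C.base H.st.tgt a (C.coact a') :=
  BTensor.lift_tmul _ _ _ _

theorem galoisMap_lact (a : A) (w : TensorSquare f) :
    C.galoisMap f hf (TensorSquare.lact f a w) =
      RTensor.mulFst K C.base H.st.tgt a (C.galoisMap f hf w) := by
  refine LinearMap.congr_fun (f := C.galoisMap f hf ∘ₗ TensorSquare.lact f a)
    (g := RTensor.mulFst K C.base H.st.tgt a ∘ₗ C.galoisMap f hf)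
    (BTensor.hom_ext fun m n => ?_) w
  rw [LinearMap.comp_apply, LinearMap.comp_apply, TensorSquare.lact_tmul,
    galoisMap_tmul, galoisMap_tmul, ← RTensor.mulFst_mul]

/-- The right action of B on the second factor of A ⊗_B A turns into right multiplication in the
first factor of A ⊗_R T, by `coact_mul_coinvariant`. -/
theorem galoisMap_ract {b : B} (hb : f b ∈ C.coinvariants) (w : TensorSquare f) :
    C.galoisMap f hf (TensorSquare.ract f (f b) w) = C.mulCoinv hb (C.galoisMap f hf w) := by
  refine LinearMap.congr_fun (f := C.galoisMap f hf ∘ₗ TensorSquare.ract f (f b))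
    (g := C.mulCoinv hb ∘ₗ C.galoisMap f hf)
    (BTensor.hom_ext fun m n => ?_) w
  rw [LinearMap.comp_apply, LinearMap.comp_apply, TensorSquare.ract_tmul,
    galoisMap_tmul, galoisMap_tmul, C.coact_mul_coinvariant hb]
  refine LinearMap.congr_fun (f := RTensor.mulFst K C.base H.st.tgt m * C.mulCoinv hb)
    (g := C.mulCoinv hb * RTensor.mulFst K C.base H.st.tgt m)
    (BTensor.hom_ext fun p q => ?_) _
  simp only [Module.End.mul_apply, mulCoinv_tmul, RTensor.mulFst_tmul, mul_assoc]

/-- With β the Galois map, the splitting is ι = ((id ⊗ cⱼ) β)ⱼ and π(v) = β⁻¹(∑ vⱼ ⊗ eⱼ); that π ι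
is the identity is `RightDualBasis.sum_slice`. Linearity of π is checked after applying β. -/
theorem isRightDepthTwo_of_isGalois (D : RightDualBasis K H.st.tgt) (h : C.IsGalois f) :
    IsRightDepthTwo f := by
  obtain ⟨hf, hbij⟩ := h
  have hb : ∀ b, f b ∈ C.coinvariants := fun b => hf ▸ Set.mem_range_self b
  let e := LinearEquiv.ofBijective (C.galoisMap f hf) hbij
  have he : ∀ w, e w = C.galoisMap f hf w := fun _ => rfl
  let σ : (Fin D.n → A) →ₗ[K] RTensor K C.base H.st.tgt :=
    ∑ j, (BTensor.mk (K := K) (fun r => LinearMap.mulRight K (C.base r))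
      (fun r => LinearMap.mulRight K (H.st.tgt r))).flip (D.elem j) ∘ₗ LinearMap.proj j
  have hσ : ∀ v, σ v = ∑ j, RTensor.tmul K C.base H.st.tgt (v j) (D.elem j) := fun v => by
    simp [σ, LinearMap.sum_apply, BTensor.mk_apply]
  refine ⟨D.n, LinearMap.pi fun j =>
    RTensor.slice C.base H.st.tgt (D.coord j) (D.coord_mul j) ∘ₗ C.galoisMap f hf,
    e.symm.toLinearMap ∘ₗ σ, ?_, ?_, ?_, ?_, ?_⟩
  · intro a x j
    simp only [LinearMap.pi_apply, LinearMap.comp_apply, galoisMap_lact, RTensor.slice_mulFst]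
  · intro b x j
    simp only [LinearMap.pi_apply, LinearMap.comp_apply, C.galoisMap_ract hf (hb b),
      slice_mulCoinv]
  · intro a v
    apply e.injective
    rw [he (TensorSquare.lact f a _), galoisMap_lact, ← he]
    simp only [LinearMap.comp_apply, LinearEquiv.coe_coe, LinearEquiv.apply_symm_apply, hσ,
      map_sum, RTensor.mulFst_tmul]
  · intro b v
    apply e.injective
    rw [he (TensorSquare.ract f (f b) _), C.galoisMap_ract hf (hb b), ← he]
    simp only [LinearMap.comp_apply, LinearEquiv.coe_coe, LinearEquiv.apply_symm_apply, hσ,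
      map_sum, mulCoinv_tmul]
  · intro x
    apply e.injective
    rw [LinearMap.comp_apply, LinearEquiv.coe_coe, LinearEquiv.apply_symm_apply, hσ, he]
    exact D.sum_slice C.base _

end RightComoduleAlgebra

/-- Left multiplications lie in End(A_B), so a map commuting with End(A_B) is right multiplication
by its value at 1. Balancedness thus becomes a condition on elements of A; uniqueness of the element
of B is the injectivity of f. -/
theorem isRightBalanced_iff (f : B →ₐ[K] A) (hf : Function.Injective f) :
    IsRightBalanced f ↔ ∀ x : A, (∀ g : A →+ A, (∀ a b, g (a * f b) = g a * f b) →
      ∀ a, g (a * x) = g a * x) → x ∈ Set.range f := by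
  let _ : Module Bᵐᵒᵖ A := Module.compHom A (RingHom.op (f : B →+* A))
  have smul_def : ∀ (b : Bᵐᵒᵖ) (a : A), b • a = a * f b.unop := fun _ _ => rfl
  change Function.Bijective (Module.toModuleEnd (Module.End Bᵐᵒᵖ A) (S := Bᵐᵒᵖ) A) ↔ _
  constructor
  · intro h x hx
    obtain ⟨b, hb⟩ := h.2
      { toFun := fun a => a * x
        map_add' := fun a a' => add_mul _ _ _
        map_smul' := fun g a => (hx g.toAddMonoidHom
          (fun a b => (g.map_smul (MulOpposite.op b) a)) a).symm }
    refine ⟨b.unop, ?_⟩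
    have := LinearMap.congr_fun hb 1
    change (1 : A) * f b.unop = 1 * x at this
    simpa using this
  · intro h
    constructor
    · intro b b' hbb
      have := LinearMap.congr_fun hbb 1
      change (1 : A) * f b.unop = 1 * f b'.unop at this
      rw [one_mul, one_mul] at this
      exact MulOpposite.unop_injective (hf this)
    · intro φ
      have hφ : ∀ (g : A →+ A), (∀ a b, g (a * f b) = g a * f b) → ∀ a, φ (g a) = g (φ a) := by
        intro g hg a
        exact φ.map_smul (⟨⟨g, g.map_add⟩, fun b a => hg a b.unop⟩ : Module.End Bᵐᵒᵖ A) a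
      have hφ1 : ∀ a, φ a = a * φ 1 := fun a => by
        simpa using hφ (AddMonoidHom.mulLeft a) (fun a b => by simp [mul_assoc]) 1
      obtain ⟨b, hb⟩ := h (φ 1) (fun g hg a => by
        rw [← hφ1, ← hφ g hg, hφ1])
      refine ⟨MulOpposite.op b, LinearMap.ext fun a => ?_⟩
      change a * f b = φ a
      rw [hb, ← hφ1]

/-- Two kinds of right B-linear maps are fed to the hypothesis on x: the slices g = (id ⊗ cⱼ)δ and
right multiplication by r = cⱼ(1). The first gives g(x) = g(1)x = rx, the second rx = xr, and xr is
the slice of x ⊗ 1. -/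
theorem RightComoduleAlgebra.isRightBalanced_of_isGalois {H : RightBialgebroid K R T}
    (C : RightComoduleAlgebra H A) {f : B →ₐ[K] A} (hinj : Function.Injective f)
    (D : RightDualBasis K H.st.tgt) (hf : Set.range f = C.coinvariants) : IsRightBalanced f := by
  rw [isRightBalanced_iff f hinj]
  intro x hx
  have hb : ∀ b, f b ∈ C.coinvariants := fun b => hf ▸ Set.mem_range_self b
  rw [hf]
  change C.coact x = _
  refine D.ext_slice fun j => ?_
  have h := hx ((RTensor.slice C.base H.st.tgt (D.coord j) (D.coord_mul j) ∘ₗ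
    C.coact).toAddMonoidHom) (fun a b => by
      simp only [LinearMap.toAddMonoidHom_coe, LinearMap.comp_apply,
        C.coact_mul_coinvariant (hb b), C.slice_mulCoinv]) 1
  simp only [LinearMap.toAddMonoidHom_coe, LinearMap.comp_apply, one_mul, C.coact_one,
    RTensor.slice_tmul] at h
  have h' := hx (AddMonoidHom.mulRight (C.base (D.coord j 1))) (fun a b => by
    simp [mul_assoc, C.base_comm_of_mem_coinvariants (hb b)]) 1
  rw [h, RTensor.slice_tmul]
  simpa using h'.symm

theorem isRightDepthTwo_and_isRightBalanced {f : B →ₐ[K] A} (hinj : Function.Injective f)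
    (h : IsRightBialgebroidGalois.{uK, uB, uA, uR, uT} f) :
    IsRightDepthTwo f ∧ IsRightBalanced f := by
  obtain ⟨R, T, _, _, _, _, H, C, hfp, hG⟩ := h
  obtain ⟨D⟩ := hfp.exists_dualBasis
  exact ⟨C.isRightDepthTwo_of_isGalois D hG, C.isRightBalanced_of_isGalois hinj D hG.1⟩

end RightGaloisForward

/-! ### The centralizer, the endomorphisms of _B A_B, and the endomorphism algebra of A ⊗_B A -/

section Extension

variable {K : Type uK} {B : Type uB} {A : Type uA} [CommRing K] [Ring B] [Algebra K B] [Ring A]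
  [Algebra K A] (f : B →ₐ[K] A)

/-- The centralizer of `B` in `A`. -/
def centralizer : Subalgebra K A := Subalgebra.centralizer K (Set.range f)

theorem centralizer_comm (r : centralizer f) (b : B) : f b * (r : A) = r * f b :=
  (Subalgebra.mem_centralizer_iff K).1 r.2 _ ⟨b, rfl⟩

/-- The algebra of endomorphisms of the `B`-`B`-bimodule `A`. -/
def bimoduleEnd : Subalgebra K (Module.End K A) :=
  Subalgebra.centralizer K (Set.range (fun b => LinearMap.mulLeft K (f b)) ∪
    Set.range (fun b => LinearMap.mulRight K (f b)))

variable {f} in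
theorem mem_bimoduleEnd {γ : Module.End K A} : γ ∈ bimoduleEnd f ↔
    (∀ b a, γ (f b * a) = f b * γ a) ∧ ∀ b a, γ (a * f b) = γ a * f b := by
  rw [bimoduleEnd, Subalgebra.mem_centralizer_iff]
  refine ⟨fun h => ⟨fun b a => (LinearMap.congr_fun (h _ (Or.inl ⟨b, rfl⟩)) a).symm,
    fun b a => (LinearMap.congr_fun (h _ (Or.inr ⟨b, rfl⟩)) a).symm⟩, ?_⟩
  rintro h _ (⟨b, rfl⟩ | ⟨b, rfl⟩)
  · exact LinearMap.ext fun a => (h.1 b a).symm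
  · exact LinearMap.ext fun a => (h.2 b a).symm

variable {f} in
theorem bimoduleEnd_mul_left (γ : bimoduleEnd f) (b : B) (a : A) :
    γ.1 (f b * a) = f b * γ.1 a := (mem_bimoduleEnd.1 γ.2).1 b a

variable {f} in
theorem bimoduleEnd_mul_right (γ : bimoduleEnd f) (b : B) (a : A) :
    γ.1 (a * f b) = γ.1 a * f b := (mem_bimoduleEnd.1 γ.2).2 b a

variable {f} in
/-- Left multiplication by an element of the centralizer. -/
def centralizerMulLeft (r : centralizer f) : bimoduleEnd f :=
  ⟨LinearMap.mulLeft K (r : A), mem_bimoduleEnd.2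
    ⟨fun b a => by simp [← mul_assoc, centralizer_comm], fun b a => by simp [mul_assoc]⟩⟩

variable {f} in
/-- Right multiplication by an element of the centralizer. -/
def centralizerMulRight (r : centralizer f) : bimoduleEnd f :=
  ⟨LinearMap.mulRight K (r : A), mem_bimoduleEnd.2
    ⟨fun b a => by simp [mul_assoc], fun b a => by simp [mul_assoc, centralizer_comm]⟩⟩

namespace TensorSquare

variable {f}

theorem hom_ext {P : Type*} [AddCommGroup P] [Module K P] {g h : TensorSquare f →ₗ[K] P}
    (H : ∀ x y, g (tmul f x y) = h (tmul f x y)) : g = h :=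
  BTensor.hom_ext H

theorem tmul_mul_base (x : A) (b : B) (y : A) :
    tmul f (x * f b) y = tmul f x (f b * y) :=
  BTensor.tmul_balanced b x y

theorem lact_ract (a a' : A) (w : TensorSquare f) :
    lact f a (ract f a' w) = ract f a' (lact f a w) := by
  refine LinearMap.congr_fun (f := lact f a * ract f a') (g := ract f a' * lact f a)
    (hom_ext fun x y => ?_) w
  simp

theorem lact_mul (a a' : A) (w : TensorSquare f) :
    lact f (a * a') w = lact f a (lact f a' w) := by
  refine LinearMap.congr_fun (g := lact f a * lact f a') (hom_ext fun x y => ?_) w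
  simp [mul_assoc]

theorem ract_mul (a a' : A) (w : TensorSquare f) :
    ract f (a * a') w = ract f a' (ract f a w) := by
  refine LinearMap.congr_fun (g := ract f a' * ract f a) (hom_ext fun x y => ?_) w
  simp [mul_assoc]

theorem lact_one (w : TensorSquare f) : lact f 1 w = w := by
  refine LinearMap.congr_fun (g := LinearMap.id) (hom_ext fun x y => ?_) w
  simp

theorem ract_one (w : TensorSquare f) : ract f 1 w = w := by
  refine LinearMap.congr_fun (g := LinearMap.id) (hom_ext fun x y => ?_) w
  simp

variable (f) in
/-- `a ↦ lact a` as a linear map. -/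
def lactₗ : A →ₗ[K] Module.End K (TensorSquare f) where
  toFun := lact f
  map_add' a a' := hom_ext fun x y => by
    rw [LinearMap.add_apply, lact_tmul, lact_tmul, lact_tmul, add_mul, tmul, BTensor.add_tmul]
  map_smul' c a := hom_ext fun x y => by
    rw [RingHom.id_apply, LinearMap.smul_apply, lact_tmul, lact_tmul, smul_mul_assoc, tmul,
      BTensor.smul_tmul]

variable (f) in
/-- `a ↦ ract a` as a linear map. -/
def ractₗ : A →ₗ[K] Module.End K (TensorSquare f) where
  toFun := ract f
  map_add' a a' := hom_ext fun x y => by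
    rw [LinearMap.add_apply, ract_tmul, ract_tmul, ract_tmul, mul_add, tmul, BTensor.tmul_add]
  map_smul' c a := hom_ext fun x y => by
    rw [RingHom.id_apply, LinearMap.smul_apply, ract_tmul, ract_tmul, mul_smul_comm, tmul,
      BTensor.tmul_smul]

theorem lactₗ_apply (a : A) : lactₗ f a = lact f a := rfl

theorem ractₗ_apply (a : A) : ractₗ f a = ract f a := rfl

variable (f) in
/-- The submodule of elements of `A ⊗_B A` that commute with `B`. -/
def central : Submodule K (TensorSquare f) :=
  ⨅ b, LinearMap.ker (lact f (f b) - ract f (f b))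

theorem mem_central {w : TensorSquare f} :
    w ∈ central f ↔ ∀ b, lact f (f b) w = ract f (f b) w := by
  simp [central, sub_eq_zero]

/-- `x ⊗ y ↦ x ⊗ γ y` -/
def mapSnd (γ : Module.End K A) (hγ : ∀ b a, γ (f b * a) = f b * γ a) :
    Module.End K (TensorSquare f) :=
  BTensor.onRight _ _ γ hγ

@[simp]
theorem mapSnd_tmul (γ : Module.End K A) (hγ : ∀ b a, γ (f b * a) = f b * γ a) (x y : A) :
    mapSnd γ hγ (tmul f x y) = tmul f x (γ y) := by
  exact BTensor.onRight_tmul _ _ _ _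

theorem mapSnd_lact (γ : Module.End K A) (hγ : ∀ b a, γ (f b * a) = f b * γ a) (a : A)
    (w : TensorSquare f) : mapSnd γ hγ (lact f a w) = lact f a (mapSnd γ hγ w) := by
  refine LinearMap.congr_fun (f := mapSnd γ hγ * lact f a) (g := lact f a * mapSnd γ hγ)
    (hom_ext fun x y => ?_) w
  simp

/-- `x ⊗ y ↦ x * γ y` -/
def contractSnd (γ : Module.End K A) (hγ : ∀ b a, γ (f b * a) = f b * γ a) :
    TensorSquare f →ₗ[K] A :=
  BTensor.lift ((LinearMap.mul K A).compl₂ γ) (fun b x y => by simp [hγ, mul_assoc])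

@[simp]
theorem contractSnd_tmul (γ : Module.End K A) (hγ : ∀ b a, γ (f b * a) = f b * γ a) (x y : A) :
    contractSnd γ hγ (tmul f x y) = x * γ y := by
  exact BTensor.lift_tmul _ _ _ _

theorem contractSnd_lact (γ : Module.End K A) (hγ : ∀ b a, γ (f b * a) = f b * γ a) (a : A)
    (w : TensorSquare f) : contractSnd γ hγ (lact f a w) = a * contractSnd γ hγ w := by
  refine LinearMap.congr_fun (f := contractSnd γ hγ ∘ₗ lact f a)
    (g := LinearMap.mulLeft K a ∘ₗ contractSnd γ hγ) (hom_ext fun x y => ?_) w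
  simp [mul_assoc]

theorem contractSnd_ract (γ : Module.End K A) (hγ : ∀ b a, γ (f b * a) = f b * γ a) (a : A)
    (h : ∀ b x, (γ * LinearMap.mulRight K a) (f b * x) = f b * (γ * LinearMap.mulRight K a) x)
    (w : TensorSquare f) : contractSnd γ hγ (ract f a w) =
      contractSnd (γ * LinearMap.mulRight K a) h w := by
  refine LinearMap.congr_fun (f := contractSnd γ hγ ∘ₗ ract f a) (hom_ext fun x y => ?_) w
  simp

theorem contractSnd_mapSnd (γ γ' : Module.End K A) (hγ : ∀ b a, γ (f b * a) = f b * γ a)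
    (hγ' : ∀ b a, γ' (f b * a) = f b * γ' a)
    (h : ∀ b x, (γ' * γ) (f b * x) = f b * (γ' * γ) x) (w : TensorSquare f) :
    contractSnd γ' hγ' (mapSnd γ hγ w) = contractSnd (γ' * γ) h w := by
  refine LinearMap.congr_fun (f := contractSnd γ' hγ' ∘ₗ mapSnd γ hγ) (hom_ext fun x y => ?_) w
  simp

theorem mapSnd_ract (γ : bimoduleEnd f) (b : B) (w : TensorSquare f) :
    mapSnd γ.1 (bimoduleEnd_mul_left γ) (ract f (f b) w) =
      ract f (f b) (mapSnd γ.1 (bimoduleEnd_mul_left γ) w) := by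
  refine LinearMap.congr_fun (f := mapSnd γ.1 (bimoduleEnd_mul_left γ) * ract f (f b))
    (g := ract f (f b) * mapSnd γ.1 (bimoduleEnd_mul_left γ)) (hom_ext fun x y => ?_) w
  simp [bimoduleEnd_mul_right]

/-- Contraction by a map γ linear over B on both sides is B-bilinear, so it sends elements commuting
with B to elements commuting with B. The functionals attached to γ therefore take values in the
centralizer R. -/
theorem contractSnd_mem (γ : bimoduleEnd f) {w : TensorSquare f} (hw : w ∈ central f) :
    contractSnd γ.1 (bimoduleEnd_mul_left γ) w ∈ centralizer f := by
  refine (Subalgebra.mem_centralizer_iff K).2 ?_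
  rintro _ ⟨b, rfl⟩
  rw [← contractSnd_lact, mem_central.1 hw]
  refine LinearMap.congr_fun (f := contractSnd γ.1 (bimoduleEnd_mul_left γ) ∘ₗ ract f (f b))
    (g := LinearMap.mulRight K (f b) ∘ₗ contractSnd γ.1 (bimoduleEnd_mul_left γ))
    (hom_ext fun x y => ?_) w
  simp [bimoduleEnd_mul_right, mul_assoc]

/-- The endomorphism `x ⊗ y ↦ x w y` of `A ⊗_B A`, for `w` commuting with `B`. -/
def sandwich (w : TensorSquare f) (hw : w ∈ central f) : Module.End K (TensorSquare f) :=
  BTensor.lift (LinearMap.mk₂ K (fun x y => lactₗ f x (ractₗ f y w))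
    (by intros; simp) (by intros; simp) (by intros; simp) (by intros; simp))
    (fun b x y => by
      change lact f (x * f b) (ract f y w) = lact f x (ract f (f b * y) w)
      rw [lact_mul, ract_mul, ← mem_central.1 hw, lact_ract (f b)])

@[simp]
theorem sandwich_tmul (w : TensorSquare f) (hw : w ∈ central f) (x y : A) :
    sandwich w hw (tmul f x y) = lact f x (ract f y w) :=
  BTensor.lift_tmul _ _ _ _

theorem sandwich_lact (w : TensorSquare f) (hw : w ∈ central f) (a : A) (x : TensorSquare f) :
    sandwich w hw (lact f a x) = lact f a (sandwich w hw x) := by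
  refine LinearMap.congr_fun (f := sandwich w hw * lact f a) (g := lact f a * sandwich w hw)
    (hom_ext fun x y => ?_) x
  simp [lact_mul]

theorem sandwich_ract (w : TensorSquare f) (hw : w ∈ central f) (a : A) (x : TensorSquare f) :
    sandwich w hw (ract f a x) = ract f a (sandwich w hw x) := by
  refine LinearMap.congr_fun (f := sandwich w hw * ract f a) (g := ract f a * sandwich w hw)
    (hom_ext fun x y => ?_) x
  simp [ract_mul, lact_ract]

variable (f) in
/-- The algebra of endomorphisms of the `A`-`A`-bimodule `A ⊗_B A`. -/
def endAlgebra : Subalgebra K (Module.End K (TensorSquare f)) :=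
  Subalgebra.centralizer K (Set.range (lact f) ∪ Set.range (ract f))

theorem mem_endAlgebra {t : Module.End K (TensorSquare f)} : t ∈ endAlgebra f ↔
    (∀ a w, t (lact f a w) = lact f a (t w)) ∧ ∀ a w, t (ract f a w) = ract f a (t w) := by
  rw [endAlgebra, Subalgebra.mem_centralizer_iff]
  refine ⟨fun h => ⟨fun a w => (LinearMap.congr_fun (h _ (Or.inl ⟨a, rfl⟩)) w).symm,
    fun a w => (LinearMap.congr_fun (h _ (Or.inr ⟨a, rfl⟩)) w).symm⟩, ?_⟩
  rintro h _ (⟨a, rfl⟩ | ⟨a, rfl⟩)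
  · exact LinearMap.ext fun w => (h.1 a w).symm
  · exact LinearMap.ext fun w => (h.2 a w).symm

theorem endAlgebra_lact (t : endAlgebra f) (a : A) (w : TensorSquare f) :
    t.1 (lact f a w) = lact f a (t.1 w) := (mem_endAlgebra.1 t.2).1 a w

theorem endAlgebra_ract (t : endAlgebra f) (a : A) (w : TensorSquare f) :
    t.1 (ract f a w) = ract f a (t.1 w) := (mem_endAlgebra.1 t.2).2 a w

theorem endAlgebra_tmul (t : endAlgebra f) (x y : A) :
    t.1 (tmul f x y) = lact f x (ract f y (t.1 (tmul f 1 1))) := by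
  rw [← endAlgebra_ract, ← endAlgebra_lact, ract_tmul, lact_tmul, mul_one, one_mul]

variable (f) in
/-- An endomorphism of the `A`-`A`-bimodule `A ⊗_B A` is determined by the image of `1 ⊗ 1`, which
is an arbitrary element commuting with `B`. -/
def endAlgebraEquiv : endAlgebra f ≃ₗ[K] central f where
  toFun t := ⟨t.1 (tmul f 1 1), mem_central.2 fun b => by
    rw [← endAlgebra_ract, ← endAlgebra_lact, ract_tmul, lact_tmul]
    simpa using congrArg t.1 (tmul_mul_base (f := f) 1 b 1)⟩
  map_add' _ _ := rfl
  map_smul' _ _ := rfl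
  invFun w := ⟨sandwich w.1 w.2, mem_endAlgebra.2 ⟨sandwich_lact w.1 w.2, sandwich_ract w.1 w.2⟩⟩
  left_inv t := Subtype.ext (hom_ext fun x y => by
    rw [sandwich_tmul]
    exact (endAlgebra_tmul t x y).symm)
  right_inv w := Subtype.ext (by
    change sandwich w.1 w.2 (tmul f 1 1) = w.1
    rw [sandwich_tmul, lact_one, ract_one])

theorem endAlgebra_apply_tmul (t : endAlgebra f) (x y : A) :
    t.1 (tmul f x y) = lact f x (ract f y (endAlgebraEquiv f t).1) :=
  endAlgebra_tmul t x y

theorem endAlgebra_ext {t t' : endAlgebra f}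
    (h : (endAlgebraEquiv f t).1 = (endAlgebraEquiv f t').1) : t = t' :=
  (endAlgebraEquiv f).injective (Subtype.ext h)

variable (f) in
/-- The endomorphism `x ⊗ y ↦ x ⊗ r * y` of `A ⊗_B A`. -/
def insertRight (r : centralizer f) : endAlgebra f :=
  (endAlgebraEquiv f).symm ⟨tmul f 1 r, mem_central.2 fun b => by
    rw [lact_tmul, ract_tmul, ← centralizer_comm, mul_one, ← tmul_mul_base, one_mul]⟩

variable (f) in
/-- The endomorphism `x ⊗ y ↦ x * r ⊗ y` of `A ⊗_B A`. -/
def insertLeft (r : centralizer f) : endAlgebra f :=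
  (endAlgebraEquiv f).symm ⟨tmul f r 1, mem_central.2 fun b => by
    rw [lact_tmul, ract_tmul, centralizer_comm, tmul_mul_base, mul_one, one_mul]⟩

@[simp]
theorem insertRight_tmul (r : centralizer f) (x y : A) :
    (insertRight f r).1 (tmul f x y) = tmul f x (r * y) := by
  rw [endAlgebra_apply_tmul, insertRight, LinearEquiv.apply_symm_apply, ract_tmul, lact_tmul,
    mul_one]

@[simp]
theorem insertLeft_tmul (r : centralizer f) (x y : A) :
    (insertLeft f r).1 (tmul f x y) = tmul f (x * r) y := by
  rw [endAlgebra_apply_tmul, insertLeft, LinearEquiv.apply_symm_apply, ract_tmul, lact_tmul,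
    one_mul]

end TensorSquare

end Extension

/-! ### Functionals, twists and counit on the endomorphism algebra; right quasibases -/

section Extension

variable {K : Type uK} {B : Type uB} {A : Type uA} [CommRing K] [Ring B] [Algebra K B] [Ring A]
  [Algebra K A] {f : B →ₐ[K] A}

namespace TensorSquare

theorem endAlgebraEquiv_coe (t : endAlgebra f) :
    (endAlgebraEquiv f t : TensorSquare f) = t.1 (tmul f 1 1) := rfl

/-- In terms of elements of A ⊗_B A, composition is t t' = t'¹ t¹ ⊗ t² t'²: the right factor ends up
outside. Hence right multiplication by the source and target maps gives the usual R-R-bimodule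
structure r t¹ ⊗ t² r'. -/
theorem endAlgebraEquiv_mul (t t' : endAlgebra f) :
    (endAlgebraEquiv f (t * t') : TensorSquare f) = t.1 (endAlgebraEquiv f t').1 := rfl

theorem endAlgebraEquiv_one :
    (endAlgebraEquiv f 1 : TensorSquare f) = tmul f 1 1 := rfl

theorem endAlgebraEquiv_mul_insertRight (t : endAlgebra f) (r : centralizer f) :
    (endAlgebraEquiv f (t * insertRight f r) : TensorSquare f) =
      ract f r (endAlgebraEquiv f t).1 := by
  rw [endAlgebraEquiv_mul, endAlgebraEquiv_coe, insertRight_tmul, endAlgebra_apply_tmul,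
    lact_one, mul_one]

theorem endAlgebraEquiv_mul_insertLeft (t : endAlgebra f) (r : centralizer f) :
    (endAlgebraEquiv f (t * insertLeft f r) : TensorSquare f) =
      lact f r (endAlgebraEquiv f t).1 := by
  rw [endAlgebraEquiv_mul, endAlgebraEquiv_coe, insertLeft_tmul, endAlgebra_apply_tmul,
    ract_one, one_mul]

/-- The left `R`-linear functional `t ↦ t¹ γ(t²)`, where `R` is the centralizer. -/
def coordSnd (γ : bimoduleEnd f) : endAlgebra f →ₗ[K] centralizer f :=
  LinearMap.codRestrict (Subalgebra.toSubmodule (centralizer f))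
    (contractSnd γ.1 (bimoduleEnd_mul_left γ) ∘ₗ (central f).subtype ∘ₗ
      (endAlgebraEquiv f).toLinearMap)
    (fun t => contractSnd_mem γ (endAlgebraEquiv f t).2)

theorem coordSnd_coe (γ : bimoduleEnd f) (t : endAlgebra f) :
    (coordSnd γ t : A) =
      contractSnd γ.1 (bimoduleEnd_mul_left γ) (endAlgebraEquiv f t).1 := rfl

theorem coordSnd_mul_insertLeft (γ : bimoduleEnd f) (r : centralizer f)
    (t : endAlgebra f) : coordSnd γ (t * insertLeft f r) = r * coordSnd γ t := by
  refine Subtype.ext ?_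
  rw [coordSnd_coe, endAlgebraEquiv_mul_insertLeft, contractSnd_lact]
  rfl

theorem coordSnd_mul_insertRight (γ : bimoduleEnd f) (r : centralizer f)
    (t : endAlgebra f) :
    coordSnd γ (t * insertRight f r) = coordSnd (γ * centralizerMulRight r) t := by
  refine Subtype.ext ?_
  rw [coordSnd_coe, endAlgebraEquiv_mul_insertRight]
  exact contractSnd_ract _ _ _ (bimoduleEnd_mul_left (γ * centralizerMulRight r)) _

theorem contractSnd_one_ract (a : A) (w : TensorSquare f) :
    contractSnd (1 : bimoduleEnd f).1 (bimoduleEnd_mul_left 1) (ract f a w) =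
      contractSnd (1 : bimoduleEnd f).1 (bimoduleEnd_mul_left 1) w * a := by
  refine LinearMap.congr_fun
    (f := contractSnd (1 : bimoduleEnd f).1 (bimoduleEnd_mul_left 1) ∘ₗ ract f a)
    (g := LinearMap.mulRight K a ∘ₗ contractSnd (1 : bimoduleEnd f).1
      (bimoduleEnd_mul_left 1)) (hom_ext fun x y => ?_) w
  simp [mul_assoc]

theorem coordSnd_one_mul_insertRight (r : centralizer f) (t : endAlgebra f) :
    coordSnd (1 : bimoduleEnd f) (t * insertRight f r) = coordSnd 1 t * r := by
  refine Subtype.ext ?_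
  rw [coordSnd_coe, endAlgebraEquiv_mul_insertRight, contractSnd_one_ract]
  rfl

theorem coordSnd_apply_one (γ : bimoduleEnd f) :
    (coordSnd γ 1 : A) = γ.1 1 := by
  rw [coordSnd_coe, endAlgebraEquiv_one, contractSnd_tmul, one_mul]

/-- The endomorphism `t ↦ t¹ ⊗ γ(t²)`. -/
def twistSnd (γ : bimoduleEnd f) : endAlgebra f →ₗ[K] endAlgebra f :=
  (endAlgebraEquiv f).symm.toLinearMap ∘ₗ
    (mapSnd γ.1 (bimoduleEnd_mul_left γ)).restrict (p := central f) (q := central f)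
      (fun w hw => mem_central.2 fun b => by
        rw [← mapSnd_lact, mem_central.1 hw, mapSnd_ract]) ∘ₗ
    (endAlgebraEquiv f).toLinearMap

theorem endAlgebraEquiv_twistSnd (γ : bimoduleEnd f) (t : endAlgebra f) :
    (endAlgebraEquiv f (twistSnd γ t) : TensorSquare f) =
      mapSnd γ.1 (bimoduleEnd_mul_left γ) (endAlgebraEquiv f t).1 :=
  congrArg Subtype.val ((endAlgebraEquiv f).apply_symm_apply _)

theorem twistSnd_mul_insertLeft (γ : bimoduleEnd f) (r : centralizer f)
    (t : endAlgebra f) : twistSnd γ (t * insertLeft f r) = twistSnd γ t * insertLeft f r := by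
  refine endAlgebra_ext ?_
  rw [endAlgebraEquiv_twistSnd, endAlgebraEquiv_mul_insertLeft, endAlgebraEquiv_mul_insertLeft,
    endAlgebraEquiv_twistSnd, mapSnd_lact]

theorem twistSnd_mul_insertRight (γ : bimoduleEnd f) (r : centralizer f)
    (t : endAlgebra f) :
    twistSnd γ (t * insertRight f r) = twistSnd (γ * centralizerMulRight r) t := by
  refine endAlgebra_ext ?_
  rw [endAlgebraEquiv_twistSnd, endAlgebraEquiv_mul_insertRight, endAlgebraEquiv_twistSnd]
  refine LinearMap.congr_fun (f := mapSnd γ.1 (bimoduleEnd_mul_left γ) ∘ₗ ract f (r : A))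
    (g := mapSnd (γ * centralizerMulRight r).1 _) (hom_ext fun x y => ?_) _
  simp [centralizerMulRight]

theorem insertRight_mul_twistSnd (γ : bimoduleEnd f) (r : centralizer f)
    (t : endAlgebra f) :
    insertRight f r * twistSnd γ t = twistSnd (centralizerMulLeft r * γ) t := by
  refine endAlgebra_ext ?_
  rw [endAlgebraEquiv_twistSnd, endAlgebraEquiv_mul, endAlgebraEquiv_twistSnd]
  refine LinearMap.congr_fun (f := (insertRight f r).1 ∘ₗ mapSnd γ.1 (bimoduleEnd_mul_left γ))
    (g := mapSnd (centralizerMulLeft r * γ).1 _) (hom_ext fun x y => ?_) _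
  simp [centralizerMulLeft]

theorem coordSnd_twistSnd (γ γ' : bimoduleEnd f) (t : endAlgebra f) :
    coordSnd γ' (twistSnd γ t) = coordSnd (γ' * γ) t := by
  refine Subtype.ext ?_
  rw [coordSnd_coe, coordSnd_coe, endAlgebraEquiv_twistSnd, contractSnd_mapSnd]
  rfl

theorem twistSnd_twistSnd (γ γ' : bimoduleEnd f) (t : endAlgebra f) :
    twistSnd γ' (twistSnd γ t) = twistSnd (γ' * γ) t := by
  refine endAlgebra_ext ?_
  rw [endAlgebraEquiv_twistSnd, endAlgebraEquiv_twistSnd, endAlgebraEquiv_twistSnd]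
  refine LinearMap.congr_fun (f := mapSnd γ'.1 (bimoduleEnd_mul_left γ') ∘ₗ mapSnd γ.1 (bimoduleEnd_mul_left γ))
    (g := mapSnd (γ' * γ).1 _) (hom_ext fun x y => ?_) _
  simp

theorem twistSnd_one_apply (t : endAlgebra f) : twistSnd 1 t = t := by
  refine endAlgebra_ext ?_
  rw [endAlgebraEquiv_twistSnd]
  refine LinearMap.congr_fun (f := mapSnd _ _) (g := LinearMap.id) (hom_ext fun x y => ?_) _
  simp

/-- Both sides correspond to 1 ⊗ γ(1); this will say Δ(1) = 1 ⊗ 1. -/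
theorem twistSnd_apply_one (γ : bimoduleEnd f) :
    twistSnd γ 1 = insertRight f (coordSnd γ 1) := by
  refine endAlgebra_ext ?_
  rw [endAlgebraEquiv_twistSnd, endAlgebraEquiv_one, mapSnd_tmul, endAlgebraEquiv_coe,
    insertRight_tmul, coordSnd_apply_one, mul_one]

/-- The endomorphism `a ↦ t¹ γ(t² a)` of the `B`-`B`-bimodule `A`. -/
def actSnd (t : endAlgebra f) (γ : bimoduleEnd f) : bimoduleEnd f :=
  ⟨contractSnd γ.1 (bimoduleEnd_mul_left γ) ∘ₗ (ractₗ f).flip (endAlgebraEquiv f t).1,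
    mem_bimoduleEnd.2 ⟨fun b a => by
      simp only [LinearMap.comp_apply, LinearMap.flip_apply, ractₗ_apply, ract_mul]
      rw [← mem_central.1 (endAlgebraEquiv f t).2, ← lact_ract, contractSnd_lact], fun b a => by
      simp only [LinearMap.comp_apply, LinearMap.flip_apply, ractₗ_apply, ract_mul]
      refine LinearMap.congr_fun (f := contractSnd γ.1 (bimoduleEnd_mul_left γ) ∘ₗ ract f (f b))
        (g := LinearMap.mulRight K (f b) ∘ₗ contractSnd γ.1 (bimoduleEnd_mul_left γ))
        (hom_ext fun x y => ?_) _
      simp [bimoduleEnd_mul_right, mul_assoc]⟩⟩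

theorem actSnd_apply (t : endAlgebra f) (γ : bimoduleEnd f) (a : A) :
    (actSnd t γ).1 a =
      contractSnd γ.1 (bimoduleEnd_mul_left γ) (ract f a (endAlgebraEquiv f t).1) := rfl

/-- Since t t' = t'¹ t¹ ⊗ t² t'², the functional of γ takes the value t'¹ · t¹ γ(t² t'²), in which a
↦ t¹ γ(t² a) is applied to t'². So the functionals from Γ are stable under left multiplication by t
in the argument. -/
theorem coordSnd_mul (γ : bimoduleEnd f) (t t' : endAlgebra f) :
    coordSnd γ (t * t') = coordSnd (actSnd t γ) t' := by
  refine Subtype.ext ?_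
  rw [coordSnd_coe, coordSnd_coe, endAlgebraEquiv_mul]
  refine LinearMap.congr_fun (f := contractSnd γ.1 (bimoduleEnd_mul_left γ) ∘ₗ t.1)
    (g := contractSnd (actSnd t γ).1 (bimoduleEnd_mul_left (actSnd t γ)))
    (hom_ext fun x y => ?_) _
  rw [LinearMap.comp_apply, endAlgebra_apply_tmul, contractSnd_lact, contractSnd_tmul,
    actSnd_apply]

/-- For γ = 1 the functional is the counit ε(t) = t¹ t², and ε(t t') = t'¹ ε(t) t'² depends on t
only through ε(t). The element s stands for the source or the target of ε(t), which yields both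
counit identities of a bialgebroid at once. -/
theorem coordSnd_one_mul (t t' s : endAlgebra f)
    (h : ∀ x y, contractSnd (1 : bimoduleEnd f).1 (bimoduleEnd_mul_left 1)
      (s.1 (tmul f x y)) = x * (coordSnd 1 t : A) * y) :
    coordSnd 1 (t * t') = coordSnd 1 (s * t') := by
  refine Subtype.ext ?_
  rw [coordSnd_coe, coordSnd_coe, endAlgebraEquiv_mul, endAlgebraEquiv_mul]
  refine LinearMap.congr_fun
    (f := contractSnd (1 : bimoduleEnd f).1 (bimoduleEnd_mul_left 1) ∘ₗ t.1)
    (g := contractSnd (1 : bimoduleEnd f).1 (bimoduleEnd_mul_left 1) ∘ₗ s.1)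
    (hom_ext fun x y => ?_) _
  rw [LinearMap.comp_apply, LinearMap.comp_apply, h, endAlgebra_apply_tmul, contractSnd_lact,
    contractSnd_one_ract, mul_assoc, coordSnd_coe]

variable (f) in
/-- The source and target maps `r ↦ 1 ⊗ r` and `r ↦ r ⊗ 1`. -/
def sourceTarget : SourceTarget K (centralizer f) (endAlgebra f) where
  src :=
    { toFun := insertRight f
      map_one' := Subtype.ext (hom_ext fun x y => by simp)
      map_mul' := fun r r' => Subtype.ext (hom_ext fun x y => by simp [mul_assoc])
      map_zero' := Subtype.ext (hom_ext fun x y => by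
        rw [insertRight_tmul]; simp [tmul, ← BTensor.mk_apply])
      map_add' := fun r r' => Subtype.ext (hom_ext fun x y => by
        simp [add_mul, BTensor.tmul_add])
      commutes' := fun c => Subtype.ext (hom_ext fun x y => by
        simp [Algebra.algebraMap_eq_smul_one, BTensor.tmul_smul]) }
  tgtOp :=
    { toFun := fun r => insertLeft f r.unop
      map_one' := Subtype.ext (hom_ext fun x y => by simp)
      map_mul' := fun r r' => Subtype.ext (hom_ext fun x y => by simp [mul_assoc])
      map_zero' := Subtype.ext (hom_ext fun x y => by
        rw [MulOpposite.unop_zero, insertLeft_tmul]; simp [tmul, ← BTensor.mk_apply])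
      map_add' := fun r r' => Subtype.ext (hom_ext fun x y => by
        simp [mul_add, BTensor.add_tmul])
      commutes' := fun c => Subtype.ext (hom_ext fun x y => by
        simp [Algebra.algebraMap_eq_smul_one, BTensor.smul_tmul]) }
  src_comm_tgtOp r r' := Subtype.ext (hom_ext fun x y => by simp)

end TensorSquare

/-- A right depth two quasibasis: `x ⊗ y = ∑ x γⱼ(y) uⱼ`. -/
structure RightQuasibasis (f : B →ₐ[K] A) where
  n : ℕ
  map : Fin n → bimoduleEnd f
  elem : Fin n → TensorSquare.endAlgebra f
  sum_eq : ∀ a, ∑ j, TensorSquare.lact f ((map j).1 a)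
    (TensorSquare.endAlgebraEquiv f (elem j)).1 = TensorSquare.tmul f 1 a

/-- Take γⱼ(a) to be the j-th component of ι(1 ⊗ a) and uⱼ = π(eⱼ) for the standard basis of Aⁿ.
Left A-linearity of π turns π ι(1 ⊗ a) = 1 ⊗ a into the quasibasis identity. -/
theorem IsRightDepthTwo.exists_quasibasis (h : IsRightDepthTwo f) :
    Nonempty (RightQuasibasis f) := by
  obtain ⟨n, ι, π, h1, h2, h3, h4, h5⟩ := h
  refine ⟨⟨n, fun j => ⟨LinearMap.proj j ∘ₗ ι ∘ₗ BTensor.mk _ _ 1, mem_bimoduleEnd.2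
    ⟨fun b a => ?_, fun b a => ?_⟩⟩, fun j => (TensorSquare.endAlgebraEquiv f).symm
    ⟨π (Pi.single j 1), TensorSquare.mem_central.2 fun b => ?_⟩, fun a => ?_⟩⟩
  · simp only [LinearMap.comp_apply, LinearMap.proj_apply, BTensor.mk_apply]
    rw [← h1, TensorSquare.lact_tmul, mul_one]
    exact congrArg (ι · j) (by simpa using (TensorSquare.tmul_mul_base (f := f) 1 b a).symm)
  · simp only [LinearMap.comp_apply, LinearMap.proj_apply, BTensor.mk_apply]
    rw [← h2, TensorSquare.ract_tmul]
  -- The standard basis vector commutes with B, hence so does its image under the B-bilinear map π.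
  · rw [← h3, ← h4]
    congr 1
    funext j'
    by_cases hj : j' = j
    · subst hj; simp
    · simp [hj]
  · simp only [LinearEquiv.apply_symm_apply, LinearMap.comp_apply, LinearMap.proj_apply,
      BTensor.mk_apply, ← h3]
    rw [← map_sum]
    refine Eq.trans ?_ (h5 _)
    congr 1
    funext j
    simp [Finset.sum_apply, Pi.single_apply]

end Extension

/-! ### Right bialgebroids and comodule algebras from actions of a dual monoid of functionals -/

section RightDualSystem

variable {K : Type uK} {R : Type uR} {T : Type uT} [CommRing K] [Ring R] [Algebra K R] [Ring T]
  [Algebra K T]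

@[simp]
theorem SourceTarget.lactR_tmul (S : SourceTarget K R T) (r : R) (x y : T) :
    S.lactR r (RTensor.tmul K S.src S.tgt x y) = RTensor.tmul K S.src S.tgt (x * S.tgt r) y := by
  exact BTensor.onLeft_tmul _ _ _ _

@[simp]
theorem SourceTarget.coractR_tmul (S : SourceTarget K R T) {P : Type*} [Ring P] [Algebra K P]
    (i : R → P) (r : R) (x : P) (y : T) : S.coractR i r (RTensor.tmul K i S.tgt x y) =
      RTensor.tmul K i S.tgt x (y * S.src r) := by
  exact BTensor.onRight_tmul _ _ _ _

theorem RightDualBasis.finite_projective {S : SourceTarget K R T} (D : RightDualBasis K S.tgt) :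
    let _ : Module R T := S.leftModuleR
    Module.Finite R T ∧ Module.Projective R T := by
  intro _
  have smul_def : ∀ (r : R) (x : T), r • x = x * S.tgt r := fun _ _ => rfl
  let i : T →ₗ[R] (Fin D.n → R) :=
    LinearMap.pi fun j =>
      { toFun := D.coord j
        map_add' := map_add _
        map_smul' := fun r x => D.coord_mul j r x }
  let s : (Fin D.n → R) →ₗ[R] T := Fintype.linearCombination R D.elem
  have hs : s ∘ₗ i = LinearMap.id := LinearMap.ext fun x => by
    simp only [LinearMap.comp_apply, s, Fintype.linearCombination_apply, smul_def]
    exact D.sum_eq x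
  exact ⟨Module.Finite.of_surjective s fun x => ⟨i x, LinearMap.congr_fun hs x⟩,
    Module.Projective.of_split i s hs⟩

/-- A monoid `Γ` of left `R`-linear functionals on `T`, containing a finite dual basis and closed
under the operations by which `T` and `R` act on functionals. -/
structure RightDualSystem (S : SourceTarget K R T) (Γ : Type*) [Monoid Γ] where
  coord : Γ → T →ₗ[K] R
  coord_mul_tgt : ∀ γ r t, coord γ (t * S.tgt r) = r * coord γ t
  mulSrc : Γ → R → Γ
  coord_mul_src : ∀ γ r t, coord γ (t * S.src r) = coord (mulSrc γ r) t
  act : T → Γ → Γ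
  coord_mul : ∀ γ t t', coord γ (t * t') = coord (act t γ) t'
  n : ℕ
  elem : Fin n → T
  map : Fin n → Γ
  sum_eq : ∀ t, ∑ j, elem j * S.tgt (coord (map j) t) = t

variable {S : SourceTarget K R T} {Γ : Type*} [Monoid Γ]

namespace RightDualSystem

variable (D : RightDualSystem S Γ)

/-- The dual basis of a dual system. -/
def dualBasis : RightDualBasis K S.tgt where
  n := D.n
  elem := D.elem
  coord j := D.coord (D.map j)
  coord_mul j := D.coord_mul_tgt (D.map j)
  sum_eq := D.sum_eq

variable {P : Type*} [Ring P] [Algebra K P] {u : R →ₐ[K] P}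

variable (u) in
/-- The slice `id ⊗ γ : P ⊗_R T → P`. -/
def slice (γ : Γ) : RTensor K u S.tgt →ₗ[K] P :=
  RTensor.slice u S.tgt (D.coord γ) (D.coord_mul_tgt γ)

theorem slice_tmul (γ : Γ) (p : P) (t : T) :
    D.slice u γ (RTensor.tmul K u S.tgt p t) = p * u (D.coord γ t) :=
  RTensor.slice_tmul _ _ _ _ _ _

theorem slice_mulFst (γ : Γ) (p : P) (w : RTensor K u S.tgt) :
    D.slice u γ (RTensor.mulFst K u S.tgt p w) = p * D.slice u γ w :=
  RTensor.slice_mulFst _ _ _ _ _ _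

theorem sum_slice (w : RTensor K u S.tgt) :
    ∑ j, RTensor.tmul K u S.tgt (D.slice u (D.map j) w) (D.elem j) = w :=
  D.dualBasis.sum_slice u w

theorem ext_slice {w w' : RTensor K u S.tgt} (h : ∀ γ, D.slice u γ w = D.slice u γ w') : w = w' :=
  D.dualBasis.ext_slice fun j => h (D.map j)

theorem slice_coractR {P : Type uA} [Ring P] [Algebra K P] {u : R →ₐ[K] P} (γ : Γ) (r : R)
    (w : RTensor K u S.tgt) :
    D.slice u γ (S.coractR u r w) = D.slice u (D.mulSrc γ r) w := by
  refine LinearMap.congr_fun (f := D.slice u γ ∘ₗ S.coractR u r)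
    (BTensor.hom_ext fun p t => ?_) w
  rw [LinearMap.comp_apply, SourceTarget.coractR_tmul, slice_tmul, slice_tmul, D.coord_mul_src]

theorem slice_lactR (γ : Γ) (r : R) (w : S.TR) :
    D.slice S.src γ (S.lactR r w) = D.slice S.src γ w * S.tgt r := by
  refine LinearMap.congr_fun (f := D.slice S.src γ ∘ₗ S.lactR r)
    (g := LinearMap.mulRight K (S.tgt r) ∘ₗ D.slice S.src γ)
    (BTensor.hom_ext fun p t => ?_) w
  rw [LinearMap.comp_apply, LinearMap.comp_apply, SourceTarget.lactR_tmul, slice_tmul,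
    slice_tmul, LinearMap.mulRight_apply, mul_assoc, mul_assoc, SourceTarget.comm]

theorem slice_mulSnd (γ : Γ) (t : T) (w : RTensor K u S.tgt) :
    D.slice u γ (RTensor.mulSnd K u S.tgt t w) = D.slice u (D.act t γ) w := by
  refine LinearMap.congr_fun (f := D.slice u γ ∘ₗ RTensor.mulSnd K u S.tgt t)
    (BTensor.hom_ext fun p q => ?_) w
  rw [LinearMap.comp_apply, RTensor.mulSnd_tmul, slice_tmul, slice_tmul, D.coord_mul]

variable (u) in
/-- The slice `id ⊗ id ⊗ γ : P ⊗_R T ⊗_R T → P ⊗_R T`. -/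
def mapSlice (γ : Γ) :
    BTensor (fun r => LinearMap.mulRight K (u r)) (fun r => S.lactR r) →ₗ[K] RTensor K u S.tgt :=
  BTensor.map LinearMap.id (D.slice S.src γ) (fun _ _ => rfl) (fun r w => D.slice_lactR γ r w)

theorem mapSlice_tmul (γ : Γ) (p : P) (w : S.TR) :
    D.mapSlice u γ (BTensor.tmul _ _ p w) = RTensor.tmul K u S.tgt p (D.slice S.src γ w) :=
  BTensor.map_tmul _ _ _ _ _ _

/-- The maps id ⊗ γⱼ from T ⊗_R T to T are jointly split by the maps t ↦ t ⊗ uⱼ, so they remain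
jointly injective after P ⊗_R -. -/
theorem ext_mapSlice
    {x y : BTensor (fun r => LinearMap.mulRight K (u r)) (fun r => S.lactR r)}
    (h : ∀ γ, D.mapSlice u γ x = D.mapSlice u γ y) : x = y :=
  BTensor.ext_of_map_right (fun j => D.slice S.src (D.map j))
    (fun j => (BTensor.mk (K := K) (fun r => LinearMap.mulRight K (S.src r))
      (fun r => LinearMap.mulRight K (S.tgt r))).flip (D.elem j))
    (fun j r w => D.slice_lactR (D.map j) r w)
    (fun j r t => (S.lactR_tmul r t (D.elem j)).symm)
    (fun w => D.sum_slice w) (fun j => h (D.map j))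

/-- The scalar γ(t) coming from the last factor is absorbed by the middle factor through its source
map. -/
theorem mapSlice_assoc_tmul {P : Type uA} [Ring P] [Algebra K P] {u : R →ₐ[K] P} (γ : Γ)
    (h : ∀ r s n, LinearMap.mulRight K (S.tgt r) (LinearMap.mulRight K (S.src s) n) =
      LinearMap.mulRight K (S.src s) (LinearMap.mulRight K (S.tgt r) n))
    (w : RTensor K u S.tgt) (t : T) :
    D.mapSlice u γ (BTensor.assoc (fun r => LinearMap.mulRight K (u r)) _ _ _ h
      (BTensor.tmul _ (fun r => LinearMap.mulRight K (S.tgt r)) w t)) =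
      S.coractR u (D.coord γ t) w := by
  refine LinearMap.congr_fun (f := D.mapSlice u γ ∘ₗ
    BTensor.assoc (fun r => LinearMap.mulRight K (u r)) _ _ _ h ∘ₗ
    (BTensor.mk _ (fun r => LinearMap.mulRight K (S.tgt r))).flip t)
    (BTensor.hom_ext fun p q => ?_) w
  rw [SourceTarget.coractR_tmul]
  refine (congrArg (D.mapSlice u γ) (BTensor.assoc_tmul _ _ _ h p q t)).trans ?_
  refine (D.mapSlice_tmul γ p _).trans ?_
  rw [slice_tmul]

end RightDualSystem

/-- An algebra `P` over `R` with a compatible action of a dual system `Γ` of `T`; this is the same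
as a coaction of `T`. -/
structure RightModuleAlgebra (D : RightDualSystem S Γ) {P : Type*} [Ring P] [Algebra K P]
    (u : R →ₐ[K] P) where
  act : Γ → P →ₗ[K] P
  act_mul : ∀ γ γ' p, act (γ' * γ) p = act γ' (act γ p)
  act_one : ∀ p, act 1 p = p
  base_mul_act : ∀ γ r p, u r * act γ p = act (D.act (S.tgt r) γ) p
  act_mul_base : ∀ γ r p, act γ (p * u r) = act (D.mulSrc γ r) p
  act_apply_one : ∀ γ, act γ 1 = u (D.coord γ 1)
  sum_act_mul_base : ∀ γ p, ∑ j, act (D.map j) p * u (D.coord γ (D.elem j)) = act γ p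
  sum_act_mul_act : ∀ γ p p', ∑ j, act (D.map j) p * act (D.act (D.elem j) γ) p' = act γ (p * p')

namespace RightModuleAlgebra

variable {D : RightDualSystem S Γ} {P : Type uA} [Ring P] [Algebra K P] {u : R →ₐ[K] P}
  (C : RightModuleAlgebra D u)

/-- The coaction `p ↦ ∑ γⱼ(p) ⊗ uⱼ`. -/
def coact : P →ₗ[K] RTensor K u S.tgt :=
  ∑ j, (BTensor.mk (K := K) (fun r => LinearMap.mulRight K (u r))
    (fun r => LinearMap.mulRight K (S.tgt r))).flip (D.elem j) ∘ₗ C.act (D.map j)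

theorem coact_apply (p : P) : C.coact p =
    ∑ j, RTensor.tmul K u S.tgt (C.act (D.map j) p) (D.elem j) := by
  rw [coact, LinearMap.sum_apply]
  rfl

/-- The property that characterizes δ: slicing by γ gives back the action of γ. Applied to δ(p), the
comodule algebra axioms become the axioms of the action. -/
theorem slice_coact (γ : Γ) (p : P) : D.slice u γ (C.coact p) = C.act γ p := by
  rw [coact_apply, map_sum]
  simp only [D.slice_tmul]
  exact C.sum_act_mul_base γ p

theorem coact_mul_base (r : R) (p : P) :
    C.coact (p * u r) = S.coractR u r (C.coact p) :=
  D.ext_slice fun γ => by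
    rw [D.slice_coractR, slice_coact, slice_coact, C.act_mul_base]

theorem coact_one : C.coact 1 = RTensor.tmul K u S.tgt 1 1 :=
  D.ext_slice fun γ => by
    rw [slice_coact, D.slice_tmul, C.act_apply_one, one_mul]

theorem takeuchi (p : P) : RTensor.IsTakeuchi K u S.tgt (C.coact p) :=
  fun r => D.ext_slice fun γ => by
    rw [D.slice_mulFst, D.slice_mulSnd, slice_coact, slice_coact, C.base_mul_act]

theorem coact_mul (p p' : P) : C.coact (p * p') =
    RTensor.mul K u S.tgt (C.coact p) (C.coact p') (C.takeuchi p') :=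
  D.ext_slice fun γ => by
    rw [slice_coact, C.coact_apply p, RTensor.mul, map_sum, map_sum, ← C.sum_act_mul_act]
    refine Finset.sum_congr rfl fun j _ => ?_
    rw [BTensor.lift_tmul]
    change _ = D.slice u γ (RTensor.mulFst K _ _ _ (RTensor.mulSnd K _ _ _ _))
    rw [D.slice_mulFst, D.slice_mulSnd, slice_coact]

/-- Slicing the last factor commutes with δ ⊗ id because δ is right R-linear. -/
theorem mapSlice_assoc_map (γ : Γ)
    (h : ∀ r s n, LinearMap.mulRight K (S.tgt r) (LinearMap.mulRight K (S.src s) n) =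
      LinearMap.mulRight K (S.src s) (LinearMap.mulRight K (S.tgt r) n))
    (z : RTensor K u S.tgt) :
    D.mapSlice u γ (BTensor.assoc _ _ _ _ h
        (BTensor.map (ρ' := fun r => S.coractR u r) (l' := fun r => LinearMap.mulRight K (S.tgt r))
          C.coact LinearMap.id (fun r p => C.coact_mul_base r p) (fun _ _ => rfl) z)) =
      C.coact (D.slice u γ z) := by
  refine LinearMap.congr_fun (f := D.mapSlice u γ ∘ₗ BTensor.assoc _ _ _ _ h ∘ₗ
    BTensor.map (ρ' := fun r => S.coractR u r) (l' := fun r => LinearMap.mulRight K (S.tgt r))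
      C.coact LinearMap.id (fun r p => C.coact_mul_base r p) (fun _ _ => rfl))
    (g := C.coact ∘ₗ D.slice u γ) (BTensor.hom_ext fun p t => ?_) z
  refine (congrArg (fun y => D.mapSlice u γ (BTensor.assoc _ _ _ _ h y))
    (BTensor.map_tmul (ρ := fun r => LinearMap.mulRight K (u r))
      (l := fun r => LinearMap.mulRight K (S.tgt r)) (ρ' := fun r => S.coractR u r)
      (l' := fun r => LinearMap.mulRight K (S.tgt r)) C.coact LinearMap.id
      (fun r p => C.coact_mul_base r p) (fun _ _ => rfl) p t)).trans ?_
  refine (D.mapSlice_assoc_tmul γ h _ t).trans ?_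
  rw [LinearMap.comp_apply, D.slice_tmul, C.coact_mul_base]

variable (C₀ : RightModuleAlgebra D S.src)

theorem comul_mul_tgt (hact : ∀ γ r t, C₀.act γ (t * S.tgt r) = C₀.act γ t * S.tgt r) (r : R)
    (t : T) : C₀.coact (t * S.tgt r) = S.lactR r (C₀.coact t) := by
  rw [coact_apply, coact_apply, map_sum]
  refine Finset.sum_congr rfl fun j _ => ?_
  rw [hact, S.lactR_tmul]

/-- The slice of Δ(t) by γ is γ acting on t, and `hcoord` says that γ' then takes the value of γ'γ
on t. So Δ is dual to the product of Γ. -/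
theorem slice_mapSlice_comul (hact : ∀ γ r t, C₀.act γ (t * S.tgt r) = C₀.act γ t * S.tgt r)
    (hcoord : ∀ γ γ' t, D.coord γ' (C₀.act γ t) = D.coord (γ' * γ) t)
    (γ γ' : Γ) (z : RTensor K u S.tgt) :
    D.slice u γ' (D.mapSlice u γ
      (BTensor.map (ρ' := fun r => LinearMap.mulRight K (u r)) (l' := fun r => S.lactR r)
        LinearMap.id C₀.coact (fun _ _ => rfl) (fun r t => C₀.comul_mul_tgt hact r t) z)) =
      D.slice u (γ' * γ) z := by
  refine LinearMap.congr_fun (f := D.slice u γ' ∘ₗ D.mapSlice u γ ∘ₗ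
    BTensor.map (ρ' := fun r => LinearMap.mulRight K (u r)) (l' := fun r => S.lactR r)
      LinearMap.id C₀.coact (fun _ _ => rfl) (fun r t => C₀.comul_mul_tgt hact r t))
    (BTensor.hom_ext fun p t => ?_) z
  refine (congrArg (fun y => D.slice u γ' (D.mapSlice u γ y))
    (BTensor.map_tmul (ρ := fun r => LinearMap.mulRight K (u r))
      (l := fun r => LinearMap.mulRight K (S.tgt r)) (ρ' := fun r => LinearMap.mulRight K (u r))
      (l' := fun r => S.lactR r) LinearMap.id C₀.coact (fun _ _ => rfl)
      (fun r t => C₀.comul_mul_tgt hact r t) p t)).trans ?_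
  rw [D.mapSlice_tmul, slice_coact, D.slice_tmul, D.slice_tmul, hcoord, LinearMap.id_apply]

/-- Sliced by γ in the last factor and γ' in the middle one, the two sides are γ'(γ(p)) and
(γ'γ)(p). Coassociativity is the associativity of the action. With P = T and the same action it is
also the coassociativity of Δ. -/
theorem coassoc (hact : ∀ γ r t, C₀.act γ (t * S.tgt r) = C₀.act γ t * S.tgt r)
    (hcoord : ∀ γ γ' t, D.coord γ' (C₀.act γ t) = D.coord (γ' * γ) t)
    (h : ∀ r s n, LinearMap.mulRight K (S.tgt r) (LinearMap.mulRight K (S.src s) n) =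
      LinearMap.mulRight K (S.src s) (LinearMap.mulRight K (S.tgt r) n)) (p : P) :
    BTensor.assoc _ _ _ _ h
      (BTensor.map (ρ' := fun r => S.coractR u r) (l' := fun r => LinearMap.mulRight K (S.tgt r))
        C.coact LinearMap.id (fun r p => C.coact_mul_base r p) (fun _ _ => rfl) (C.coact p)) =
      BTensor.map (ρ' := fun r => LinearMap.mulRight K (u r)) (l' := fun r => S.lactR r)
        LinearMap.id C₀.coact (fun _ _ => rfl) (fun r t => C₀.comul_mul_tgt hact r t)
        (C.coact p) :=
  D.ext_mapSlice fun γ => D.ext_slice fun γ' => by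
    rw [C₀.slice_mapSlice_comul hact hcoord]
    refine (congrArg (D.slice u γ') (C.mapSlice_assoc_map γ h (C.coact p))).trans ?_
    rw [slice_coact, slice_coact, slice_coact, C.act_mul]

end RightModuleAlgebra

/-- An action of a dual system of `T` on `T` that makes `T` a right bialgebroid with the given
functionals as slices of the comultiplication. -/
structure RightRegularAction (D : RightDualSystem S Γ) extends RightModuleAlgebra D S.src where
  act_mul_tgt : ∀ γ r t, act γ (t * S.tgt r) = act γ t * S.tgt r
  coord_act : ∀ γ γ' t, D.coord γ' (act γ t) = D.coord (γ' * γ) t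
  coord_one_mul_src : ∀ r t, D.coord 1 (t * S.src r) = D.coord 1 t * r
  coord_one_one : D.coord 1 1 = 1
  coord_mul_tgt' : ∀ t t', D.coord 1 (t * t') = D.coord 1 (S.tgt (D.coord 1 t) * t')
  coord_mul_src' : ∀ t t', D.coord 1 (t * t') = D.coord 1 (S.src (D.coord 1 t) * t')

namespace RightRegularAction

variable {D : RightDualSystem S Γ} (C₀ : RightRegularAction D)

/-- The right bialgebroid dual to a dual system. -/
def bialgebroid : RightBialgebroid K R T where
  st := S
  comul := C₀.coact
  counit := D.coord 1
  comul_lact := C₀.comul_mul_tgt C₀.act_mul_tgt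
  comul_ract := C₀.coact_mul_base
  counit_lact := D.coord_mul_tgt 1
  counit_ract := C₀.coord_one_mul_src
  coassoc := C₀.coassoc _ C₀.act_mul_tgt C₀.coord_act _
  counit_comul t := by
    rw [RightModuleAlgebra.coact_apply, map_sum]
    refine Eq.trans (Finset.sum_congr rfl fun j _ => BTensor.lift_tmul _ _ _ _) ?_
    -- Applying ε to the action of γⱼ on t gives the functional of 1 · γⱼ, so the sum is the dual
    -- basis expansion of t.
    refine Eq.trans (Finset.sum_congr rfl fun j _ => ?_) (D.sum_eq t)
    rw [LinearMap.mk₂_apply, C₀.coord_act, one_mul]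
  comul_counit t := (C₀.slice_coact 1 t).trans (C₀.act_one t)
  comul_one := C₀.coact_one
  counit_one := C₀.coord_one_one
  counit_mul_tgt := C₀.coord_mul_tgt'
  counit_mul_src := C₀.coord_mul_src'
  takeuchi := C₀.takeuchi
  comul_mul := C₀.coact_mul

theorem isLeftFiniteProjective : C₀.bialgebroid.IsLeftFiniteProjective :=
  D.dualBasis.finite_projective

/-- The comodule algebra of a module algebra over a dual system. -/
def comoduleAlgebra {P : Type uA} [Ring P] [Algebra K P] {u : R →ₐ[K] P}
    (C : RightModuleAlgebra D u) : RightComoduleAlgebra C₀.bialgebroid P where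
  base := u
  coact := C.coact
  coact_ract := C.coact_mul_base
  coassoc := C.coassoc _ C₀.act_mul_tgt C₀.coord_act _
  counital p := (C.slice_coact 1 p).trans (C.act_one p)
  coact_one := C.coact_one
  takeuchi := C.takeuchi
  coact_mul := C.coact_mul

/-- The slices of δ(p) and of p ⊗ 1 by γ are γ(p) and p γ(1). -/
theorem mem_coinvariants_iff {P : Type uA} [Ring P] [Algebra K P] {u : R →ₐ[K] P}
    (C : RightModuleAlgebra D u) (p : P) :
    p ∈ (C₀.comoduleAlgebra C).coinvariants ↔ ∀ γ, C.act γ p = p * C.act γ 1 := by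
  change C.coact p = RTensor.tmul K u S.tgt p 1 ↔ _
  refine ⟨fun h γ => ?_, fun h => D.ext_slice fun γ => ?_⟩
  · rw [← C.slice_coact, h, D.slice_tmul, C.act_apply_one]
  · rw [C.slice_coact, h, D.slice_tmul, C.act_apply_one]

theorem slice_galoisMap {A : Type uA} [Ring A] [Algebra K A] {u : R →ₐ[K] A}
    (C : RightModuleAlgebra D u) {B : Type uB} [Ring B] [Algebra K B] {f : B →ₐ[K] A}
    (hf : Set.range f = (C₀.comoduleAlgebra C).coinvariants) (γ : Γ) (x y : A) :
    D.slice u γ ((C₀.comoduleAlgebra C).galoisMap f hf (TensorSquare.tmul f x y)) =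
      x * C.act γ y := by
  rw [RightComoduleAlgebra.galoisMap_tmul, ← C.slice_coact]
  exact D.slice_mulFst γ x _

end RightRegularAction

end RightDualSystem

/-! ### Right depth two and right balanced imply right Galois -/

section Extension

variable {K : Type uK} {B : Type uB} {A : Type uA} [CommRing K] [Ring B] [Algebra K B] [Ring A]
  [Algebra K A] {f : B →ₐ[K] A}

open TensorSquare

theorem sourceTarget_src (r : centralizer f) : (sourceTarget f).src r = insertRight f r := rfl

theorem sourceTarget_tgt (r : centralizer f) : (sourceTarget f).tgt r = insertLeft f r := rfl

theorem actSnd_insertLeft (γ : bimoduleEnd f) (r : centralizer f) :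
    actSnd (insertLeft f r) γ = centralizerMulLeft r * γ := by
  refine Subtype.ext (LinearMap.ext fun a => ?_)
  rw [actSnd_apply, endAlgebraEquiv_coe, insertLeft_tmul, ract_tmul, contractSnd_tmul, one_mul,
    one_mul]
  rfl

/-- A right B-linear g makes x ⊗ y ↦ g(x)y well defined on A ⊗_B A. This is how an equation between
tensors tells about arbitrary elements of End(A_B), which need not be left B-linear. -/
theorem TensorSquare.map_mul_eq_of_tmul_eq (g : A →+ A) (hg : ∀ a b, g (a * f b) = g a * f b)
    {x y x' y' : A} (h : tmul f x y = tmul f x' y') : g x * y = g x' * y' := by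
  -- `K` acts on `A` through the image of `B`, so an additive right B-linear map is K-linear.
  let g' : A →ₗ[K] A := { g with
    map_smul' := fun c a => by
      have e : ∀ a : A, c • a = a * f (algebraMap K B c) := fun a => by
        rw [AlgHom.commutes, Algebra.smul_def, Algebra.commutes]
      change g (c • a) = c • g a
      rw [e, e, hg] }
  exact congrArg (BTensor.lift ((LinearMap.mul K A).comp g') (fun b x y => by
    change g (x * f b) * y = g x * (f b * y)
    rw [hg, mul_assoc]) : TensorSquare f →ₗ[K] A) h |> fun h => by
      rwa [tmul, tmul, BTensor.lift_tmul, BTensor.lift_tmul] at h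

namespace RightQuasibasis

variable (D : RightQuasibasis f)

theorem sum_map_mul_contractSnd (γ : Module.End K A) (hγ : ∀ b a, γ (f b * a) = f b * γ a) (a : A) :
    ∑ j, (D.map j).1 a * contractSnd γ hγ (endAlgebraEquiv f (D.elem j)).1 = γ a := by
  simpa [contractSnd_lact] using congrArg (contractSnd γ hγ) (D.sum_eq a)

/-- Multiplying 1 ⊗ y = ∑ γⱼ(y) uⱼ by x on the left expands x ⊗ y with the contractions x γⱼ(y) as
coefficients. On elements commuting with B the coefficients lie in R, and the expansion becomes the
dual basis identity of `sum_elem_mul_insertLeft`. -/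
theorem sum_lact_contractSnd (w : TensorSquare f) :
    ∑ j, lact f (contractSnd (D.map j).1 (bimoduleEnd_mul_left (D.map j)) w)
      (endAlgebraEquiv f (D.elem j)).1 = w := by
  have key : ∑ j, (lactₗ f).flip (endAlgebraEquiv f (D.elem j)).1 ∘ₗ
      contractSnd (D.map j).1 (bimoduleEnd_mul_left (D.map j)) = LinearMap.id := by
    refine hom_ext fun x y => ?_
    simp only [LinearMap.sum_apply, LinearMap.comp_apply, LinearMap.flip_apply, lactₗ_apply,
      contractSnd_tmul, lact_mul, LinearMap.id_apply, ← map_sum, D.sum_eq, lact_tmul, mul_one]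
  refine Eq.trans ?_ (LinearMap.congr_fun key w)
  rw [LinearMap.sum_apply]
  rfl

theorem sum_elem_mul_insertLeft (t : endAlgebra f) :
    ∑ j, D.elem j * insertLeft f (coordSnd (D.map j) t) = t :=
  endAlgebra_ext (by
    rw [map_sum, Submodule.coe_sum]
    simp only [endAlgebraEquiv_mul_insertLeft, coordSnd_coe]
    exact D.sum_lact_contractSnd _)

/-- This is `sum_map_mul_contractSnd` for the map x ↦ γ(x a'), which is still left B-linear. It is
the identity behind the multiplicativity of δ. -/
theorem sum_map_mul_actSnd (γ : bimoduleEnd f) (a a' : A) :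
    ∑ j, (D.map j).1 a * (actSnd (D.elem j) γ).1 a' = γ.1 (a * a') := by
  have h : ∀ b x, (γ.1 * LinearMap.mulRight K a') (f b * x) =
      f b * (γ.1 * LinearMap.mulRight K a') x := fun b x => by
    simp [mul_assoc, bimoduleEnd_mul_left]
  simp only [actSnd_apply, contractSnd_ract γ.1 (bimoduleEnd_mul_left γ) a' h]
  exact D.sum_map_mul_contractSnd _ h a

/-- The expansion of γ in `sum_map_mul_contractSnd`, performed in the second leg of t. -/
theorem sum_twistSnd_mul_insertRight (γ : bimoduleEnd f)
    (t : endAlgebra f) :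
    ∑ j, twistSnd (D.map j) t * insertRight f (coordSnd γ (D.elem j)) = twistSnd γ t := by
  refine endAlgebra_ext ?_
  rw [map_sum, Submodule.coe_sum]
  simp only [endAlgebraEquiv_mul_insertRight, endAlgebraEquiv_twistSnd]
  have key : ∑ j, ract f (coordSnd γ (D.elem j) : A) ∘ₗ
      mapSnd (D.map j).1 (bimoduleEnd_mul_left (D.map j)) =
      mapSnd γ.1 (bimoduleEnd_mul_left γ) := by
    refine hom_ext fun x y => ?_
    simp only [LinearMap.sum_apply, LinearMap.comp_apply, mapSnd_tmul, ract_tmul]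
    simp only [tmul, ← BTensor.mk_apply, ← map_sum]
    rw [← D.sum_map_mul_contractSnd γ.1 (bimoduleEnd_mul_left γ) y]
    rfl
  refine Eq.trans ?_ (LinearMap.congr_fun key _)
  rw [LinearMap.sum_apply]
  rfl

/-- The product rule `sum_map_mul_actSnd` in the second legs of t and t': on x ⊗ y both sides give x
t¹ ⊗ γ(t² y). It makes Δ multiplicative. -/
theorem sum_twistSnd_mul_twistSnd (γ : bimoduleEnd f)
    (t t' : endAlgebra f) :
    ∑ j, twistSnd (D.map j) t * twistSnd (actSnd (D.elem j) γ) t' = twistSnd γ (t * t') := by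
  refine endAlgebra_ext ?_
  rw [map_sum, Submodule.coe_sum, endAlgebraEquiv_twistSnd]
  simp only [endAlgebraEquiv_mul, endAlgebraEquiv_twistSnd]
  have key : ∑ j, (twistSnd (D.map j) t).1 ∘ₗ mapSnd (actSnd (D.elem j) γ).1
      (bimoduleEnd_mul_left (actSnd (D.elem j) γ)) =
      mapSnd γ.1 (bimoduleEnd_mul_left γ) ∘ₗ t.1 := by
    refine hom_ext fun x y => ?_
    simp only [LinearMap.sum_apply, LinearMap.comp_apply, mapSnd_tmul, endAlgebra_apply_tmul,
      endAlgebraEquiv_twistSnd, mapSnd_lact, ← map_sum]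
    congr 1
    -- The element of T is replaced by an arbitrary tensor v ⊗ w, on which the product rule reads v
    -- ⊗ ∑ γⱼ(w) · (uⱼ acting on γ)(y) = v ⊗ γ(w y).
    have key' : ∑ j, ract f ((actSnd (D.elem j) γ).1 y) ∘ₗ
        mapSnd (D.map j).1 (bimoduleEnd_mul_left (D.map j)) =
        mapSnd γ.1 (bimoduleEnd_mul_left γ) ∘ₗ ract f y := by
      refine hom_ext fun v w => ?_
      simp only [LinearMap.sum_apply, LinearMap.comp_apply, mapSnd_tmul, ract_tmul]
      simp only [tmul, ← BTensor.mk_apply, ← map_sum]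
      rw [D.sum_map_mul_actSnd]
    refine Eq.trans ?_ (LinearMap.congr_fun key' _)
    rw [LinearMap.sum_apply]
    rfl
  refine Eq.trans ?_ (LinearMap.congr_fun key _)
  rw [LinearMap.sum_apply]
  rfl

/-- The endomorphisms of the `B`-`B`-bimodule `A` as functionals on the algebra of bimodule
endomorphisms of `A ⊗_B A`. -/
def dualSystem : RightDualSystem (sourceTarget f) (bimoduleEnd f) where
  coord := coordSnd
  coord_mul_tgt := coordSnd_mul_insertLeft
  mulSrc γ r := γ * centralizerMulRight r
  coord_mul_src := coordSnd_mul_insertRight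
  act := actSnd
  coord_mul := coordSnd_mul
  n := D.n
  elem := D.elem
  map := D.map
  sum_eq := D.sum_elem_mul_insertLeft

/-- The action of the endomorphisms of the `B`-`B`-bimodule `A` on the algebra of bimodule
endomorphisms of `A ⊗_B A`. -/
def regularAction : RightRegularAction D.dualSystem where
  act := twistSnd
  act_mul γ γ' p := (twistSnd_twistSnd γ γ' p).symm
  act_one := twistSnd_one_apply
  base_mul_act γ r t := by
    rw [sourceTarget_src, insertRight_mul_twistSnd, ← actSnd_insertLeft]
    rfl
  act_mul_base γ r t := twistSnd_mul_insertRight γ r t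
  act_apply_one := twistSnd_apply_one
  sum_act_mul_base := D.sum_twistSnd_mul_insertRight
  sum_act_mul_act := D.sum_twistSnd_mul_twistSnd
  act_mul_tgt := twistSnd_mul_insertLeft
  coord_act := coordSnd_twistSnd
  coord_one_mul_src := coordSnd_one_mul_insertRight
  coord_one_one := Subtype.ext (coordSnd_apply_one 1)
  coord_mul_tgt' t t' := coordSnd_one_mul t t' _ fun x y => by
    rw [sourceTarget_tgt, insertLeft_tmul, contractSnd_tmul]
    rfl
  coord_mul_src' t t' := coordSnd_one_mul t t' _ fun x y => by
    rw [sourceTarget_src, insertRight_tmul, contractSnd_tmul, mul_assoc]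
    rfl

/-- The action of the endomorphisms of the `B`-`B`-bimodule `A` on `A`. -/
def moduleAlgebra : RightModuleAlgebra D.dualSystem (centralizer f).val where
  act γ := γ.1
  act_mul _ _ _ := rfl
  act_one _ := rfl
  base_mul_act γ r a := by
    change _ = (actSnd (insertLeft f r) γ).1 a
    rw [actSnd_insertLeft]
    rfl
  act_mul_base _ _ _ := rfl
  act_apply_one γ := (coordSnd_apply_one γ).symm
  sum_act_mul_base γ a := D.sum_map_mul_contractSnd γ.1 (bimoduleEnd_mul_left γ) a
  sum_act_mul_act := D.sum_map_mul_actSnd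

/-- The coaction of the right bialgebroid of endomorphisms of the `A`-`A`-bimodule `A ⊗_B A` on
`A`. -/
def comoduleAlgebra : RightComoduleAlgebra D.regularAction.bialgebroid A :=
  D.regularAction.comoduleAlgebra D.moduleAlgebra

/-- The only use of balancedness. Elements of B are coinvariant because each γ is left B-linear. A
coinvariant a satisfies 1 ⊗ a = a ⊗ 1 in A ⊗_B A, and so right multiplication by it commutes with
all of End(A_B). -/
theorem range_eq_coinvariants (hinj : Function.Injective f) (hbal : IsRightBalanced f) :
    Set.range f = D.comoduleAlgebra.coinvariants := by
  ext a
  refine Iff.trans ?_ (D.regularAction.mem_coinvariants_iff D.moduleAlgebra a).symm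
  change _ ↔ ∀ γ : bimoduleEnd f, γ.1 a = a * γ.1 1
  constructor
  · rintro ⟨b, rfl⟩ γ
    rw [← bimoduleEnd_mul_left, mul_one]
  · intro h
    refine (isRightBalanced_iff f hinj).1 hbal a fun g hg x => ?_
    -- By the quasibasis and γⱼ(a) = a γⱼ(1), 1 ⊗ a = ∑ γⱼ(a) uⱼ = a ∑ γⱼ(1) uⱼ = a ⊗ 1.
    have h1 : tmul f 1 a = tmul f a 1 := by
      have := congrArg (lact f a) (D.sum_eq 1)
      rw [lact_tmul, mul_one, map_sum] at this
      rw [← D.sum_eq a, ← this]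
      exact Finset.sum_congr rfl fun j _ => by rw [h, lact_mul]
    have h2 : tmul f (x * a) 1 = tmul f x a := by
      simpa using congrArg (lact f x) h1.symm
    simpa using map_mul_eq_of_tmul_eq g hg h2

theorem isGalois (hinj : Function.Injective f) (hbal : IsRightBalanced f) :
    D.comoduleAlgebra.IsGalois f := by
  refine ⟨D.range_eq_coinvariants hinj hbal, ?_⟩
  -- The slices of the Galois map are the contractions x ⊗ y ↦ x γ(y); injectivity is then
  -- `sum_lact_contractSnd`.
  have hs : ∀ γ w, D.dualSystem.slice (centralizer f).val γ
      (D.comoduleAlgebra.galoisMap f (D.range_eq_coinvariants hinj hbal) w) =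
      contractSnd γ.1 (bimoduleEnd_mul_left γ) w := fun γ w => by
    refine LinearMap.congr_fun (f := D.dualSystem.slice (centralizer f).val γ ∘ₗ
      D.comoduleAlgebra.galoisMap f (D.range_eq_coinvariants hinj hbal))
      (hom_ext fun x y => ?_) w
    rw [contractSnd_tmul]
    exact D.regularAction.slice_galoisMap D.moduleAlgebra _ γ x y
  constructor
  · intro w w' h
    rw [← D.sum_lact_contractSnd w, ← D.sum_lact_contractSnd w']
    simp only [← hs, h]
  · intro z
    -- Writing z = ∑ zⱼ ⊗ uⱼ with zⱼ the slice by γⱼ, the preimage is ∑ zⱼ uⱼ, taken in A ⊗_B A.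
    refine ⟨∑ j, lact f (D.dualSystem.slice (centralizer f).val (D.map j) z)
      (endAlgebraEquiv f (D.elem j)).1, D.dualSystem.ext_slice fun γ => ?_⟩
    refine (hs γ _).trans ?_
    rw [map_sum]
    simp only [contractSnd_lact]
    refine Eq.trans ?_ (congrArg _ (D.dualSystem.sum_slice z))
    rw [map_sum]
    exact Finset.sum_congr rfl fun j _ =>
      (D.dualSystem.slice_tmul (u := (centralizer f).val) γ _ (D.elem j)).symm

end RightQuasibasis

theorem isRightBialgebroidGalois (hinj : Function.Injective f) (h : IsRightDepthTwo f)
    (hbal : IsRightBalanced f) : IsRightBialgebroidGalois.{uK, uB, uA, uA, uA} f := by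
  obtain ⟨D⟩ := h.exists_quasibasis
  exact ⟨_, _, _, _, _, _, D.regularAction.bialgebroid, D.comoduleAlgebra,
    D.regularAction.isLeftFiniteProjective, D.isGalois hinj hbal⟩

end Extension

/-! ### Slices and dual bases for right R-modules -/

section LeftSlices

variable {K : Type*} [CommRing K] {R P Q : Type*} [Ring R] [Algebra K R] [Ring P] [Algebra K P]
  [Ring Q] [Algebra K Q]

/-- The map `α ⊗ id : P ⊗_R Q → Q`, `p ⊗ q ↦ v (α p) * q`, for a right `R`-linear `α : P → R`. -/
def LTensor.slice (u : R → P) (v : R →ₐ[K] Q) (α : P →ₗ[K] R)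
    (hα : ∀ r p, α (u r * p) = α p * r) : LTensor K u v →ₗ[K] Q :=
  BTensor.lift (LinearMap.mk₂ K (fun p q => v (α p) * q)
    (by intros; simp [add_mul]) (by intros; simp)
    (by intros; simp [mul_add]) (by intros; simp))
    (fun r p q => by simp [hα, mul_assoc])

@[simp]
theorem LTensor.slice_tmul (u : R → P) (v : R →ₐ[K] Q) (α : P →ₗ[K] R)
    (hα : ∀ r p, α (u r * p) = α p * r) (p : P) (q : Q) :
    LTensor.slice u v α hα (LTensor.tmul K u v p q) = v (α p) * q :=
  BTensor.lift_tmul _ _ _ _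

theorem LTensor.slice_mulSnd (u : R → P) (v : R →ₐ[K] Q) (α : P →ₗ[K] R)
    (hα : ∀ r p, α (u r * p) = α p * r) (q : Q) (w : LTensor K u v) :
    LTensor.slice u v α hα (LTensor.mulSnd K u v q w) = LTensor.slice u v α hα w * q := by
  refine LinearMap.congr_fun (f := LTensor.slice u v α hα ∘ₗ LTensor.mulSnd K u v q)
    (g := LinearMap.mulRight K q ∘ₗ LTensor.slice u v α hα) (BTensor.hom_ext fun m n => ?_) w
  simp [mul_assoc]

/-- A finite dual basis of the right `R`-module `P`, `p · r = u r * p`. -/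
structure LeftDualBasis (K : Type*) [CommRing K] {R P : Type*} [Ring R] [Algebra K R] [Ring P]
    [Algebra K P] (u : R → P) where
  n : ℕ
  elem : Fin n → P
  coord : Fin n → P →ₗ[K] R
  coord_mul : ∀ j r p, coord j (u r * p) = coord j p * r
  sum_eq : ∀ p, ∑ j, u (coord j p) * elem j = p

variable {u : R → P}

/-- On p ⊗ q the coefficient of eⱼ is cⱼ(p) · q; moved to the left of the tensor sign, the scalars
reassemble p. -/
theorem LeftDualBasis.sum_slice (D : LeftDualBasis K u) (v : R →ₐ[K] Q) (w : LTensor K u v) :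
    ∑ j, LTensor.tmul K u v (D.elem j) (LTensor.slice u v (D.coord j) (D.coord_mul j) w) = w := by
  have key : ∑ j, (BTensor.mk _ _ (D.elem j)) ∘ₗ
      (LTensor.slice u v (D.coord j) (D.coord_mul j)) =
      (LinearMap.id : LTensor K u v →ₗ[K] LTensor K u v) := by
    refine BTensor.hom_ext fun p q => ?_
    simp only [LinearMap.sum_apply, LinearMap.comp_apply, LinearMap.id_apply]
    have h : ∀ j, BTensor.mk (K := K) (fun r => LinearMap.mulLeft K (u r))
        (fun r => LinearMap.mulLeft K (v r)) (D.elem j)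
        (LTensor.slice u v (D.coord j) (D.coord_mul j) (BTensor.tmul _ _ p q)) =
        (BTensor.mk (K := K) (fun r => LinearMap.mulLeft K (u r))
        (fun r => LinearMap.mulLeft K (v r))).flip q (u (D.coord j p) * D.elem j) := by
      intro j
      rw [LinearMap.flip_apply, BTensor.mk_apply, BTensor.mk_apply, LTensor.slice_tmul]
      exact (BTensor.tmul_balanced (D.coord j p) (D.elem j) q).symm
    rw [Finset.sum_congr rfl fun j _ => h j, ← map_sum, D.sum_eq, LinearMap.flip_apply,
      BTensor.mk_apply]
  refine Eq.trans ?_ (LinearMap.congr_fun key w)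
  rw [LinearMap.sum_apply]
  rfl

theorem LeftDualBasis.ext_slice (D : LeftDualBasis K u) {v : R →ₐ[K] Q} {w w' : LTensor K u v}
    (h : ∀ j, LTensor.slice u v (D.coord j) (D.coord_mul j) w =
      LTensor.slice u v (D.coord j) (D.coord_mul j) w') : w = w' := by
  rw [← D.sum_slice v w, ← D.sum_slice v w']
  exact Finset.sum_congr rfl fun j _ => by rw [h j]

end LeftSlices

/-! ### Left Galois extensions are left depth two and left balanced -/

section LeftGaloisForward

variable {K : Type uK} {R : Type uR} {T : Type uT} [CommRing K] [Ring R] [Algebra K R] [Ring T]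
  [Algebra K T] {B : Type uB} {A : Type uA} [Ring B] [Algebra K B] [Ring A] [Algebra K A]

theorem LeftBialgebroid.IsRightFiniteProjective.exists_dualBasis {H : LeftBialgebroid K R T}
    (h : H.IsRightFiniteProjective) : Nonempty (LeftDualBasis K H.st.tgt) := by
  let _ : Module Rᵐᵒᵖ T := H.st.rightModuleL
  obtain ⟨h1, h2⟩ := h
  obtain ⟨n, p, hp⟩ := Module.Finite.exists_fin' Rᵐᵒᵖ T
  obtain ⟨i, hi⟩ := Module.projective_lifting_property p LinearMap.id hp
  have smul_def : ∀ (r : Rᵐᵒᵖ) (x : T), r • x = H.st.tgt r.unop * x := fun _ _ => rfl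
  have hK : ∀ (c : K) (x : T), c • x = algebraMap K Rᵐᵒᵖ c • x := by
    intro c x
    rw [smul_def, Algebra.algebraMap_eq_smul_one, MulOpposite.unop_smul, SourceTarget.tgt_smul,
      MulOpposite.unop_one, SourceTarget.tgt_one, smul_mul_assoc, one_mul]
  refine ⟨⟨n, fun j => p (Pi.single j 1), fun j =>
    { toFun := fun x => (i x j).unop
      map_add' := fun x y => by rw [map_add, Pi.add_apply, MulOpposite.unop_add]
      map_smul' := fun c x => ?_ }, fun j r q => ?_, fun q => ?_⟩⟩
  · rw [hK, map_smul, Pi.smul_apply, smul_eq_mul, RingHom.id_apply, ← Algebra.smul_def,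
      MulOpposite.unop_smul]
  · exact congrArg MulOpposite.unop (congrFun (map_smul i (MulOpposite.op r) q) j)
  · have : p (i q) = q := LinearMap.congr_fun hi q
    conv_rhs => rw [← this, ← Finset.univ_sum_single (i q), map_sum]
    refine Finset.sum_congr rfl fun j _ => ?_
    change (i q j) • p (Pi.single j 1) = _
    rw [← map_smul, ← Pi.single_smul', smul_eq_mul, mul_one]

namespace LeftComoduleAlgebra

variable {H : LeftBialgebroid K R T} (C : LeftComoduleAlgebra H A)

/-- For δ(x) = 1 ⊗ x the Takeuchi condition reads t(r) ⊗ x = 1 ⊗ xr; apply ε ⊗ id. -/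
theorem base_comm_of_mem_coinvariants {x : A} (hx : x ∈ C.coinvariants) (r : R) :
    C.base r * x = x * C.base r := by
  have h := C.takeuchi x r
  rw [show C.coact x = _ from hx, LTensor.mulFst_tmul, LTensor.mulSnd_tmul, one_mul] at h
  have h' := congrArg (LTensor.slice H.st.tgt C.base H.counit H.counit_ract) h
  rw [LTensor.slice_tmul, LTensor.slice_tmul] at h'
  have e : H.counit (H.st.tgt r) = r := by
    simpa [H.counit_one] using H.counit_ract r 1
  simpa [H.counit_one, e] using h'

/-- The operator `t ⊗ a ↦ t ⊗ x * a` on `T ⊗_R A` for a coinvariant `x`. -/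
def mulCoinv {x : A} (hx : x ∈ C.coinvariants) : Module.End K (LTensor K H.st.tgt C.base) :=
  BTensor.onRight _ _ (LinearMap.mulLeft K x) (fun r m => by
    simp [← mul_assoc, C.base_comm_of_mem_coinvariants hx])

theorem mulCoinv_tmul {x : A} (hx : x ∈ C.coinvariants) (t : T) (a : A) :
    C.mulCoinv hx (LTensor.tmul K H.st.tgt C.base t a) =
      LTensor.tmul K H.st.tgt C.base t (x * a) := by
  exact BTensor.onRight_tmul _ _ _ _

theorem coact_coinvariant_mul {x : A} (hx : x ∈ C.coinvariants) (a : A) :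
    C.coact (x * a) = C.mulCoinv hx (C.coact a) := by
  rw [C.coact_mul]
  suffices h : ∀ (y : LTensor K H.st.tgt C.base) (hy : LTensor.IsTakeuchi K H.st.tgt C.base y),
      y = LTensor.tmul K H.st.tgt C.base 1 x → ∀ w,
      LTensor.mul K H.st.tgt C.base y w hy = C.mulCoinv hx w from h _ _ hx _
  rintro _ hy rfl w
  refine LinearMap.congr_fun (g := C.mulCoinv hx) (BTensor.hom_ext fun m n => ?_) w
  rw [mulCoinv_tmul, BTensor.lift_tmul]
  simp [LTensor.mulFstₗ, LTensor.mulSndₗ]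

theorem slice_mulCoinv (α : T →ₗ[K] R) (hα : ∀ r q, α (H.st.tgt r * q) = α q * r) {x : A}
    (hx : x ∈ C.coinvariants) (w : LTensor K H.st.tgt C.base) :
    LTensor.slice H.st.tgt C.base α hα (C.mulCoinv hx w) =
      x * LTensor.slice H.st.tgt C.base α hα w := by
  refine LinearMap.congr_fun (f := LTensor.slice H.st.tgt C.base α hα ∘ₗ C.mulCoinv hx)
    (g := LinearMap.mulLeft K x ∘ₗ LTensor.slice H.st.tgt C.base α hα)
    (BTensor.hom_ext fun m n => ?_) w
  simp only [LinearMap.comp_apply, mulCoinv_tmul, LTensor.slice_tmul, LinearMap.mulLeft_apply,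
    ← mul_assoc, C.base_comm_of_mem_coinvariants hx]

variable {f : B →ₐ[K] A} (hf : Set.range f = C.coinvariants)

theorem galoisMap_tmul (a a' : A) :
    C.galoisMap f hf (TensorSquare.tmul f a a') =
      LTensor.mulSnd K H.st.tgt C.base a' (C.coact a) :=
  BTensor.lift_tmul _ _ _ _

theorem galoisMap_ract (a : A) (w : TensorSquare f) :
    C.galoisMap f hf (TensorSquare.ract f a w) =
      LTensor.mulSnd K H.st.tgt C.base a (C.galoisMap f hf w) := by
  refine LinearMap.congr_fun (f := C.galoisMap f hf ∘ₗ TensorSquare.ract f a)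
    (g := LTensor.mulSnd K H.st.tgt C.base a ∘ₗ C.galoisMap f hf)
    (BTensor.hom_ext fun m n => ?_) w
  rw [LinearMap.comp_apply, LinearMap.comp_apply, TensorSquare.ract_tmul,
    galoisMap_tmul, galoisMap_tmul, ← LTensor.mulSnd_mul]

theorem galoisMap_lact {b : B} (hb : f b ∈ C.coinvariants) (w : TensorSquare f) :
    C.galoisMap f hf (TensorSquare.lact f (f b) w) = C.mulCoinv hb (C.galoisMap f hf w) := by
  refine LinearMap.congr_fun (f := C.galoisMap f hf ∘ₗ TensorSquare.lact f (f b))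
    (g := C.mulCoinv hb ∘ₗ C.galoisMap f hf)
    (BTensor.hom_ext fun m n => ?_) w
  rw [LinearMap.comp_apply, LinearMap.comp_apply, TensorSquare.lact_tmul,
    galoisMap_tmul, galoisMap_tmul, C.coact_coinvariant_mul hb]
  refine LinearMap.congr_fun (f := LTensor.mulSnd K H.st.tgt C.base n * C.mulCoinv hb)
    (g := C.mulCoinv hb * LTensor.mulSnd K H.st.tgt C.base n)
    (BTensor.hom_ext fun p q => ?_) _
  simp only [Module.End.mul_apply, mulCoinv_tmul, LTensor.mulSnd_tmul, mul_assoc]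

/-- With β the Galois map, ι = ((cⱼ ⊗ id) β)ⱼ and π(v) = β⁻¹(∑ eⱼ ⊗ vⱼ). -/
theorem isLeftDepthTwo_of_isGalois (D : LeftDualBasis K H.st.tgt) (h : C.IsGalois f) :
    IsLeftDepthTwo f := by
  obtain ⟨hf, hbij⟩ := h
  have hb : ∀ b, f b ∈ C.coinvariants := fun b => hf ▸ Set.mem_range_self b
  let e := LinearEquiv.ofBijective (C.galoisMap f hf) hbij
  have he : ∀ w, e w = C.galoisMap f hf w := fun _ => rfl
  let σ : (Fin D.n → A) →ₗ[K] LTensor K H.st.tgt C.base :=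
    ∑ j, BTensor.mk (K := K) (fun r => LinearMap.mulLeft K (H.st.tgt r))
      (fun r => LinearMap.mulLeft K (C.base r)) (D.elem j) ∘ₗ LinearMap.proj j
  have hσ : ∀ v, σ v = ∑ j, LTensor.tmul K H.st.tgt C.base (D.elem j) (v j) := fun v => by
    simp [σ, LinearMap.sum_apply, BTensor.mk_apply]
  refine ⟨D.n, LinearMap.pi fun j =>
    LTensor.slice H.st.tgt C.base (D.coord j) (D.coord_mul j) ∘ₗ C.galoisMap f hf,
    e.symm.toLinearMap ∘ₗ σ, ?_, ?_, ?_, ?_, ?_⟩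
  · intro b x j
    simp only [LinearMap.pi_apply, LinearMap.comp_apply, C.galoisMap_lact hf (hb b),
      slice_mulCoinv]
  · intro a x j
    simp only [LinearMap.pi_apply, LinearMap.comp_apply, galoisMap_ract, LTensor.slice_mulSnd]
  · intro b v
    apply e.injective
    rw [he (TensorSquare.lact f (f b) _), C.galoisMap_lact hf (hb b), ← he]
    simp only [LinearMap.comp_apply, LinearEquiv.coe_coe, LinearEquiv.apply_symm_apply, hσ,
      map_sum, mulCoinv_tmul]
  · intro a v
    apply e.injective
    rw [he (TensorSquare.ract f a _), galoisMap_ract, ← he]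
    simp only [LinearMap.comp_apply, LinearEquiv.coe_coe, LinearEquiv.apply_symm_apply, hσ,
      map_sum, LTensor.mulSnd_tmul]
  · intro x
    apply e.injective
    rw [LinearMap.comp_apply, LinearEquiv.coe_coe, LinearEquiv.apply_symm_apply, hσ, he]
    exact D.sum_slice C.base _

end LeftComoduleAlgebra

/-- Right multiplications lie in End(_B A), so a map commuting with End(_B A) is left multiplication
by its value at 1. -/
theorem isLeftBalanced_iff (f : B →ₐ[K] A) (hf : Function.Injective f) :
    IsLeftBalanced f ↔ ∀ x : A, (∀ g : A →+ A, (∀ b a, g (f b * a) = f b * g a) →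
      ∀ a, g (x * a) = x * g a) → x ∈ Set.range f := by
  let _ : Module B A := Module.compHom A (f : B →+* A)
  change Function.Bijective (Module.toModuleEnd (Module.End B A) (S := B) A) ↔ _
  constructor
  · intro h x hx
    obtain ⟨b, hb⟩ := h.2
      { toFun := fun a => x * a
        map_add' := fun a a' => mul_add _ _ _
        map_smul' := fun g a => (hx g.toAddMonoidHom (fun b a => g.map_smul b a) a).symm }
    refine ⟨b, ?_⟩
    have := LinearMap.congr_fun hb 1
    change f b * (1 : A) = x * 1 at this
    simpa using this
  · intro h
    constructor
    · intro b b' hbb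
      have := LinearMap.congr_fun hbb 1
      change f b * (1 : A) = f b' * 1 at this
      rw [mul_one, mul_one] at this
      exact hf this
    · intro φ
      have hφ : ∀ (g : A →+ A), (∀ b a, g (f b * a) = f b * g a) → ∀ a, φ (g a) = g (φ a) := by
        intro g hg a
        exact φ.map_smul (⟨⟨g, g.map_add⟩, fun b a => hg b a⟩ : Module.End B A) a
      have hφ1 : ∀ a, φ a = φ 1 * a := fun a => by
        simpa using hφ (AddMonoidHom.mulRight a) (fun b a => by simp [mul_assoc]) 1
      obtain ⟨b, hb⟩ := h (φ 1) (fun g hg a => by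
        rw [← hφ1, ← hφ g hg, hφ1])
      refine ⟨b, LinearMap.ext fun a => ?_⟩
      change f b * a = φ a
      rw [hb, ← hφ1]

/-- The left B-linear slices (cⱼ ⊗ id)δ give xr for the slice of δ(x), where r = cⱼ(1), and left
multiplication by r gives xr = rx, the slice of 1 ⊗ x. -/
theorem LeftComoduleAlgebra.isLeftBalanced_of_isGalois {H : LeftBialgebroid K R T}
    (C : LeftComoduleAlgebra H A) {f : B →ₐ[K] A} (hinj : Function.Injective f)
    (D : LeftDualBasis K H.st.tgt) (hf : Set.range f = C.coinvariants) : IsLeftBalanced f := by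
  rw [isLeftBalanced_iff f hinj]
  intro x hx
  have hb : ∀ b, f b ∈ C.coinvariants := fun b => hf ▸ Set.mem_range_self b
  rw [hf]
  change C.coact x = _
  refine D.ext_slice fun j => ?_
  have h := hx ((LTensor.slice H.st.tgt C.base (D.coord j) (D.coord_mul j) ∘ₗ
    C.coact).toAddMonoidHom) (fun b a => by
      simp only [LinearMap.toAddMonoidHom_coe, LinearMap.comp_apply,
        C.coact_coinvariant_mul (hb b), C.slice_mulCoinv]) 1
  simp only [LinearMap.toAddMonoidHom_coe, LinearMap.comp_apply, mul_one, C.coact_one,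
    LTensor.slice_tmul] at h
  have h' := hx (AddMonoidHom.mulLeft (C.base (D.coord j 1))) (fun b a => by
    simp [← mul_assoc, C.base_comm_of_mem_coinvariants (hb b)]) 1
  rw [h, LTensor.slice_tmul]
  simpa using h'.symm

theorem isLeftDepthTwo_and_isLeftBalanced {f : B →ₐ[K] A} (hinj : Function.Injective f)
    (h : IsLeftBialgebroidGalois.{uK, uB, uA, uR, uT} f) :
    IsLeftDepthTwo f ∧ IsLeftBalanced f := by
  obtain ⟨R, T, _, _, _, _, H, C, hfp, hG⟩ := h
  obtain ⟨D⟩ := hfp.exists_dualBasis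
  exact ⟨C.isLeftDepthTwo_of_isGalois D hG, C.isLeftBalanced_of_isGalois hinj D hG.1⟩

end LeftGaloisForward

/-! ### Left bialgebroids and comodule algebras from actions of a dual monoid of functionals -/

section LeftDualSystem

variable {K : Type uK} {R : Type uR} {T : Type uT} [CommRing K] [Ring R] [Algebra K R] [Ring T]
  [Algebra K T]

@[simp]
theorem SourceTarget.ractL_tmul (S : SourceTarget K R T) (r : R) (x y : T) :
    S.ractL r (LTensor.tmul K S.tgt S.src x y) = LTensor.tmul K S.tgt S.src x (S.tgt r * y) := by
  exact BTensor.onRight_tmul _ _ _ _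

@[simp]
theorem SourceTarget.colactL_tmul (S : SourceTarget K R T) {P : Type*} [Ring P] [Algebra K P]
    (i : R → P) (r : R) (x : T) (y : P) : S.colactL i r (LTensor.tmul K S.tgt i x y) =
      LTensor.tmul K S.tgt i (S.src r * x) y := by
  exact BTensor.onLeft_tmul _ _ _ _

theorem SourceTarget.colactL_mul (S : SourceTarget K R T) {P : Type*} [Ring P] [Algebra K P]
    (i : R → P) (r r' : R) (w : LTensor K S.tgt i) :
    S.colactL i (r * r') w = S.colactL i r (S.colactL i r' w) := by
  refine LinearMap.congr_fun (g := S.colactL i r * S.colactL i r')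
    (BTensor.hom_ext fun x y => ?_) w
  rw [Module.End.mul_apply, colactL_tmul, colactL_tmul, colactL_tmul, map_mul, mul_assoc]

/-- `r ↦ (t ⊗ p ↦ src r * t ⊗ p)` as a linear map. -/
def SourceTarget.colactLₗ (S : SourceTarget K R T) {P : Type*} [Ring P] [Algebra K P]
    (i : R → P) : R →ₗ[K] Module.End K (LTensor K S.tgt i) where
  toFun := S.colactL i
  map_add' r r' := BTensor.hom_ext fun x y => by
    rw [LinearMap.add_apply, colactL_tmul, colactL_tmul, colactL_tmul, map_add, add_mul,
      LTensor.add_tmul]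
  map_smul' c r := BTensor.hom_ext fun x y => by
    rw [RingHom.id_apply, LinearMap.smul_apply, colactL_tmul, colactL_tmul, map_smul,
      smul_mul_assoc, LTensor.smul_tmul]

theorem LeftDualBasis.finite_projective {S : SourceTarget K R T} (D : LeftDualBasis K S.tgt) :
    let _ : Module Rᵐᵒᵖ T := S.rightModuleL
    Module.Finite Rᵐᵒᵖ T ∧ Module.Projective Rᵐᵒᵖ T := by
  intro _
  have smul_def : ∀ (r : Rᵐᵒᵖ) (x : T), r • x = S.tgt r.unop * x := fun _ _ => rfl
  let i : T →ₗ[Rᵐᵒᵖ] (Fin D.n → Rᵐᵒᵖ) :=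
    LinearMap.pi fun j =>
      { toFun := fun x => MulOpposite.op (D.coord j x)
        map_add' := fun x y => by rw [map_add, MulOpposite.op_add]
        map_smul' := fun r x => congrArg MulOpposite.op (D.coord_mul j r.unop x) }
  let s : (Fin D.n → Rᵐᵒᵖ) →ₗ[Rᵐᵒᵖ] T := Fintype.linearCombination Rᵐᵒᵖ D.elem
  have hs : s ∘ₗ i = LinearMap.id := LinearMap.ext fun x => by
    simp only [LinearMap.comp_apply, s, Fintype.linearCombination_apply, smul_def]
    exact D.sum_eq x
  exact ⟨Module.Finite.of_surjective s fun x => ⟨i x, LinearMap.congr_fun hs x⟩,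
    Module.Projective.of_split i s hs⟩

/-- A monoid `Γ` of right `R`-linear functionals on `T`, containing a finite dual basis and closed
under the operations by which `T` and `R` act on functionals. -/
structure LeftDualSystem (S : SourceTarget K R T) (Γ : Type*) [Monoid Γ] where
  coord : Γ → T →ₗ[K] R
  coord_tgt_mul : ∀ γ r t, coord γ (S.tgt r * t) = coord γ t * r
  mulSrc : Γ → R → Γ
  coord_src_mul : ∀ γ r t, coord γ (S.src r * t) = coord (mulSrc γ r) t
  act : T → Γ → Γ
  coord_mul : ∀ γ t t', coord γ (t * t') = coord (act t' γ) t
  n : ℕ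
  elem : Fin n → T
  map : Fin n → Γ
  sum_eq : ∀ t, ∑ j, S.tgt (coord (map j) t) * elem j = t

variable {S : SourceTarget K R T} {Γ : Type*} [Monoid Γ]

namespace LeftDualSystem

variable (D : LeftDualSystem S Γ)

/-- The dual basis of a dual system. -/
def dualBasis : LeftDualBasis K S.tgt where
  n := D.n
  elem := D.elem
  coord j := D.coord (D.map j)
  coord_mul j := D.coord_tgt_mul (D.map j)
  sum_eq := D.sum_eq

variable {P : Type*} [Ring P] [Algebra K P] {v : R →ₐ[K] P}

variable (v) in
/-- The slice `γ ⊗ id : T ⊗_R P → P`. -/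
def slice (γ : Γ) : LTensor K S.tgt v →ₗ[K] P :=
  LTensor.slice S.tgt v (D.coord γ) (D.coord_tgt_mul γ)

theorem slice_tmul (γ : Γ) (t : T) (p : P) :
    D.slice v γ (LTensor.tmul K S.tgt v t p) = v (D.coord γ t) * p :=
  LTensor.slice_tmul _ _ _ _ _ _

theorem slice_mulSnd (γ : Γ) (p : P) (w : LTensor K S.tgt v) :
    D.slice v γ (LTensor.mulSnd K S.tgt v p w) = D.slice v γ w * p :=
  LTensor.slice_mulSnd _ _ _ _ _ _

theorem sum_slice (w : LTensor K S.tgt v) :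
    ∑ j, LTensor.tmul K S.tgt v (D.elem j) (D.slice v (D.map j) w) = w :=
  D.dualBasis.sum_slice v w

theorem ext_slice {w w' : LTensor K S.tgt v} (h : ∀ γ, D.slice v γ w = D.slice v γ w') : w = w' :=
  D.dualBasis.ext_slice fun j => h (D.map j)

theorem slice_colactL {P : Type uA} [Ring P] [Algebra K P] {v : R →ₐ[K] P} (γ : Γ) (r : R)
    (w : LTensor K S.tgt v) :
    D.slice v γ (S.colactL v r w) = D.slice v (D.mulSrc γ r) w := by
  refine LinearMap.congr_fun (f := D.slice v γ ∘ₗ S.colactL v r)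
    (BTensor.hom_ext fun t p => ?_) w
  rw [LinearMap.comp_apply, SourceTarget.colactL_tmul, slice_tmul, slice_tmul, D.coord_src_mul]

theorem slice_mulFst (γ : Γ) (t : T) (w : LTensor K S.tgt v) :
    D.slice v γ (LTensor.mulFst K S.tgt v t w) = D.slice v (D.act t γ) w := by
  refine LinearMap.congr_fun (f := D.slice v γ ∘ₗ LTensor.mulFst K S.tgt v t)
    (BTensor.hom_ext fun q p => ?_) w
  rw [LinearMap.comp_apply, LTensor.mulFst_tmul, slice_tmul, slice_tmul, D.coord_mul]

variable (v) in
/-- The slice `γ ⊗ id ⊗ id : T ⊗_R T ⊗_R P → T ⊗_R P`. -/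
def mapSlice (γ : Γ) :
    BTensor (fun r => LinearMap.mulLeft K (S.tgt r)) (fun r => S.colactL v r) →ₗ[K]
      LTensor K S.tgt v :=
  BTensor.lift (S.colactLₗ v ∘ₗ D.coord γ) (fun r t w => by
    change S.colactL v (D.coord γ (S.tgt r * t)) w = S.colactL v (D.coord γ t) (S.colactL v r w)
    rw [D.coord_tgt_mul, S.colactL_mul])

theorem mapSlice_tmul (γ : Γ) (t : T) (w : LTensor K S.tgt v) :
    D.mapSlice v γ (BTensor.tmul _ _ t w) = S.colactL v (D.coord γ t) w :=
  BTensor.lift_tmul _ _ _ _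

/-- The sliced factor is the outer one in T ⊗_R (T ⊗_R P), so this is the dual basis identity in
that factor, with the scalars acting on the rest through the source map. -/
theorem sum_mapSlice
    (x : BTensor (fun r => LinearMap.mulLeft K (S.tgt r)) (fun r => S.colactL v r)) :
    ∑ j, BTensor.tmul (fun r => LinearMap.mulLeft K (S.tgt r)) (fun r => S.colactL v r)
      (D.elem j) (D.mapSlice v (D.map j) x) = x := by
  have key : ∑ j, (BTensor.mk (fun r => LinearMap.mulLeft K (S.tgt r)) (fun r => S.colactL v r)
      (D.elem j)) ∘ₗ D.mapSlice v (D.map j) = LinearMap.id := by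
    refine BTensor.hom_ext fun t w => ?_
    have h : ∀ j, BTensor.mk (fun r => LinearMap.mulLeft K (S.tgt r)) (fun r => S.colactL v r)
        (D.elem j) (D.mapSlice v (D.map j) (BTensor.tmul _ _ t w)) =
        (BTensor.mk (fun r => LinearMap.mulLeft K (S.tgt r)) (fun r => S.colactL v r)).flip w
          (S.tgt (D.coord (D.map j) t) * D.elem j) := by
      intro j
      rw [LinearMap.flip_apply, BTensor.mk_apply, BTensor.mk_apply, D.mapSlice_tmul]
      exact (BTensor.tmul_balanced (D.coord (D.map j) t) (D.elem j) w).symm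
    simp only [LinearMap.sum_apply, LinearMap.comp_apply]
    rw [Finset.sum_congr rfl fun j _ => h j, ← map_sum, D.sum_eq]
    rfl
  refine Eq.trans ?_ (LinearMap.congr_fun key x)
  rw [LinearMap.sum_apply]
  rfl

theorem ext_mapSlice
    {x y : BTensor (fun r => LinearMap.mulLeft K (S.tgt r)) (fun r => S.colactL v r)}
    (h : ∀ γ, D.mapSlice v γ x = D.mapSlice v γ y) : x = y := by
  rw [← D.sum_mapSlice x, ← D.sum_mapSlice y]
  exact Finset.sum_congr rfl fun j _ => by rw [h]

theorem mapSlice_assoc_tmul {P : Type uA} [Ring P] [Algebra K P] {v : R →ₐ[K] P} (γ : Γ)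
    (h : ∀ r s n, LinearMap.mulLeft K (S.src r) (LinearMap.mulLeft K (S.tgt s) n) =
      LinearMap.mulLeft K (S.tgt s) (LinearMap.mulLeft K (S.src r) n))
    (w : S.TL) (p : P) :
    D.mapSlice v γ (BTensor.assoc (fun r => LinearMap.mulLeft K (S.tgt r)) _ _ _ h
      (BTensor.tmul _ (fun r => LinearMap.mulLeft K (v r)) w p)) =
      LTensor.tmul K S.tgt v (D.slice S.src γ w) p := by
  refine LinearMap.congr_fun (f := D.mapSlice v γ ∘ₗ
    BTensor.assoc (fun r => LinearMap.mulLeft K (S.tgt r)) _ _ _ h ∘ₗ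
    (BTensor.mk _ (fun r => LinearMap.mulLeft K (v r))).flip p)
    (g := (BTensor.mk _ _).flip p ∘ₗ D.slice S.src γ)
    (BTensor.hom_ext fun x y => ?_) w
  refine (congrArg (D.mapSlice v γ) (BTensor.assoc_tmul _ _ _ h x y p)).trans ?_
  refine (D.mapSlice_tmul γ x _).trans ?_
  refine (S.colactL_tmul v _ _ _).trans ?_
  rw [LinearMap.comp_apply, slice_tmul]
  rfl

end LeftDualSystem

/-- An algebra `P` over `R` with a compatible action of a dual system `Γ` of `T`; this is the same
as a coaction of `T`. -/
structure LeftModuleAlgebra (D : LeftDualSystem S Γ) {P : Type*} [Ring P] [Algebra K P]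
    (v : R →ₐ[K] P) where
  act : Γ → P →ₗ[K] P
  act_mul : ∀ γ γ' p, act (γ' * γ) p = act γ' (act γ p)
  act_one : ∀ p, act 1 p = p
  act_mul_base : ∀ γ r p, act γ p * v r = act (D.act (S.tgt r) γ) p
  act_base_mul : ∀ γ r p, act γ (v r * p) = act (D.mulSrc γ r) p
  act_apply_one : ∀ γ, act γ 1 = v (D.coord γ 1)
  sum_base_mul_act : ∀ γ p, ∑ j, v (D.coord γ (D.elem j)) * act (D.map j) p = act γ p
  sum_act_mul_act : ∀ γ p p', ∑ j, act (D.act (D.elem j) γ) p * act (D.map j) p' = act γ (p * p')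

namespace LeftModuleAlgebra

variable {D : LeftDualSystem S Γ} {P : Type uA} [Ring P] [Algebra K P] {v : R →ₐ[K] P}
  (C : LeftModuleAlgebra D v)

/-- The coaction `p ↦ ∑ uⱼ ⊗ γⱼ(p)`. -/
def coact : P →ₗ[K] LTensor K S.tgt v :=
  ∑ j, BTensor.mk (K := K) (fun r => LinearMap.mulLeft K (S.tgt r))
    (fun r => LinearMap.mulLeft K (v r)) (D.elem j) ∘ₗ C.act (D.map j)

theorem coact_apply (p : P) : C.coact p =
    ∑ j, LTensor.tmul K S.tgt v (D.elem j) (C.act (D.map j) p) := by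
  rw [coact, LinearMap.sum_apply]
  rfl

/-- As in the right-handed case, δ is characterized by its slices being the action of Γ. -/
theorem slice_coact (γ : Γ) (p : P) : D.slice v γ (C.coact p) = C.act γ p := by
  rw [coact_apply, map_sum]
  simp only [D.slice_tmul]
  exact C.sum_base_mul_act γ p

theorem coact_base_mul (r : R) (p : P) :
    C.coact (v r * p) = S.colactL v r (C.coact p) :=
  D.ext_slice fun γ => by
    rw [D.slice_colactL, slice_coact, slice_coact, C.act_base_mul]

theorem coact_one : C.coact 1 = LTensor.tmul K S.tgt v 1 1 :=
  D.ext_slice fun γ => by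
    rw [slice_coact, D.slice_tmul, C.act_apply_one, mul_one]

theorem takeuchi (p : P) : LTensor.IsTakeuchi K S.tgt v (C.coact p) :=
  fun r => D.ext_slice fun γ => by
    rw [D.slice_mulFst, D.slice_mulSnd, slice_coact, slice_coact, C.act_mul_base]

theorem coact_mul (p p' : P) : C.coact (p * p') =
    LTensor.mul K S.tgt v (C.coact p) (C.coact p') (C.takeuchi p) :=
  D.ext_slice fun γ => by
    rw [slice_coact, C.coact_apply p', LTensor.mul, map_sum, map_sum, ← C.sum_act_mul_act]
    refine Finset.sum_congr rfl fun j _ => ?_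
    rw [BTensor.lift_tmul]
    change _ = D.slice v γ (LTensor.mulFst K _ _ _ (LTensor.mulSnd K _ _ _ _))
    rw [D.slice_mulFst, D.slice_mulSnd, slice_coact]

/-- Slicing the first factor commutes with id ⊗ δ because δ is left R-linear. -/
theorem mapSlice_map_coact (γ : Γ) (z : LTensor K S.tgt v) :
    D.mapSlice v γ (BTensor.map (ρ' := fun r => LinearMap.mulLeft K (S.tgt r))
      (l' := fun r => S.colactL v r) LinearMap.id C.coact (fun _ _ => rfl)
      (fun r p => C.coact_base_mul r p) z) = C.coact (D.slice v γ z) := by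
  refine LinearMap.congr_fun (f := D.mapSlice v γ ∘ₗ
    BTensor.map (ρ' := fun r => LinearMap.mulLeft K (S.tgt r)) (l' := fun r => S.colactL v r)
      LinearMap.id C.coact (fun _ _ => rfl) (fun r p => C.coact_base_mul r p))
    (g := C.coact ∘ₗ D.slice v γ) (BTensor.hom_ext fun t p => ?_) z
  refine (congrArg (D.mapSlice v γ)
    (BTensor.map_tmul (ρ := fun r => LinearMap.mulLeft K (S.tgt r))
      (l := fun r => LinearMap.mulLeft K (v r)) (ρ' := fun r => LinearMap.mulLeft K (S.tgt r))
      (l' := fun r => S.colactL v r) LinearMap.id C.coact (fun _ _ => rfl)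
      (fun r p => C.coact_base_mul r p) t p)).trans ?_
  rw [D.mapSlice_tmul, LinearMap.comp_apply, D.slice_tmul, C.coact_base_mul, LinearMap.id_apply]

variable (C₀ : LeftModuleAlgebra D S.src)

theorem comul_tgt_mul (hact : ∀ γ r t, C₀.act γ (S.tgt r * t) = S.tgt r * C₀.act γ t) (r : R)
    (t : T) : C₀.coact (S.tgt r * t) = S.ractL r (C₀.coact t) := by
  rw [coact_apply, coact_apply, map_sum]
  refine Finset.sum_congr rfl fun j _ => ?_
  rw [hact, S.ractL_tmul]

theorem slice_mapSlice_assoc_map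
    (hact : ∀ γ r t, C₀.act γ (S.tgt r * t) = S.tgt r * C₀.act γ t)
    (hcoord : ∀ γ γ' t, D.coord γ' (C₀.act γ t) = D.coord (γ' * γ) t)
    (h : ∀ r s n, LinearMap.mulLeft K (S.src r) (LinearMap.mulLeft K (S.tgt s) n) =
      LinearMap.mulLeft K (S.tgt s) (LinearMap.mulLeft K (S.src r) n))
    (γ γ' : Γ) (z : LTensor K S.tgt v) :
    D.slice v γ' (D.mapSlice v γ (BTensor.assoc _ _ _ _ h
      (BTensor.map (ρ' := fun r => S.ractL r) (l' := fun r => LinearMap.mulLeft K (v r))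
        C₀.coact LinearMap.id (fun r t => C₀.comul_tgt_mul hact r t) (fun _ _ => rfl) z))) =
      D.slice v (γ' * γ) z := by
  refine LinearMap.congr_fun (f := D.slice v γ' ∘ₗ D.mapSlice v γ ∘ₗ BTensor.assoc _ _ _ _ h ∘ₗ
    BTensor.map (ρ' := fun r => S.ractL r) (l' := fun r => LinearMap.mulLeft K (v r))
        C₀.coact LinearMap.id (fun r t => C₀.comul_tgt_mul hact r t) (fun _ _ => rfl))
    (BTensor.hom_ext fun t p => ?_) z
  refine (congrArg (fun y => D.slice v γ' (D.mapSlice v γ (BTensor.assoc _ _ _ _ h y)))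
    (BTensor.map_tmul (ρ := fun r => LinearMap.mulLeft K (S.tgt r))
      (l := fun r => LinearMap.mulLeft K (v r)) (ρ' := fun r => S.ractL r)
      (l' := fun r => LinearMap.mulLeft K (v r)) C₀.coact LinearMap.id
      (fun r t => C₀.comul_tgt_mul hact r t) (fun _ _ => rfl) t p)).trans ?_
  refine (congrArg (D.slice v γ') (D.mapSlice_assoc_tmul γ h _ p)).trans ?_
  rw [slice_coact, D.slice_tmul, D.slice_tmul, hcoord]

/-- Sliced by γ in the first factor and γ' in the middle one, the left side is (γ'γ)(p) and the
right side γ'(γ(p)). -/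
theorem coassoc (hact : ∀ γ r t, C₀.act γ (S.tgt r * t) = S.tgt r * C₀.act γ t)
    (hcoord : ∀ γ γ' t, D.coord γ' (C₀.act γ t) = D.coord (γ' * γ) t)
    (h : ∀ r s n, LinearMap.mulLeft K (S.src r) (LinearMap.mulLeft K (S.tgt s) n) =
      LinearMap.mulLeft K (S.tgt s) (LinearMap.mulLeft K (S.src r) n)) (p : P) :
    BTensor.assoc _ _ _ _ h
      (BTensor.map (ρ' := fun r => S.ractL r) (l' := fun r => LinearMap.mulLeft K (v r))
        C₀.coact LinearMap.id (fun r t => C₀.comul_tgt_mul hact r t) (fun _ _ => rfl)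
        (C.coact p)) =
      BTensor.map (ρ' := fun r => LinearMap.mulLeft K (S.tgt r)) (l' := fun r => S.colactL v r)
        LinearMap.id C.coact (fun _ _ => rfl) (fun r p => C.coact_base_mul r p) (C.coact p) :=
  D.ext_mapSlice fun γ => D.ext_slice fun γ' => by
    refine (C₀.slice_mapSlice_assoc_map hact hcoord h γ γ' _).trans ?_
    rw [C.mapSlice_map_coact, slice_coact, slice_coact, slice_coact, C.act_mul]

end LeftModuleAlgebra

/-- An action of a dual system of `T` on `T` that makes `T` a left bialgebroid with the given
functionals as slices of the comultiplication. -/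
structure LeftRegularAction (D : LeftDualSystem S Γ) extends LeftModuleAlgebra D S.src where
  act_tgt_mul : ∀ γ r t, act γ (S.tgt r * t) = S.tgt r * act γ t
  coord_act : ∀ γ γ' t, D.coord γ' (act γ t) = D.coord (γ' * γ) t
  coord_one_src_mul : ∀ r t, D.coord 1 (S.src r * t) = r * D.coord 1 t
  coord_one_one : D.coord 1 1 = 1
  coord_mul_tgt : ∀ t t', D.coord 1 (t * t') = D.coord 1 (t * S.tgt (D.coord 1 t'))
  coord_mul_src : ∀ t t', D.coord 1 (t * t') = D.coord 1 (t * S.src (D.coord 1 t'))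

namespace LeftRegularAction

variable {D : LeftDualSystem S Γ} (C₀ : LeftRegularAction D)

/-- The left bialgebroid dual to a dual system. -/
def bialgebroid : LeftBialgebroid K R T where
  st := S
  comul := C₀.coact
  counit := D.coord 1
  comul_lact := C₀.coact_base_mul
  comul_ract := C₀.comul_tgt_mul C₀.act_tgt_mul
  counit_lact := C₀.coord_one_src_mul
  counit_ract := D.coord_tgt_mul 1
  coassoc := C₀.coassoc _ C₀.act_tgt_mul C₀.coord_act _
  counit_comul t := (C₀.slice_coact 1 t).trans (C₀.act_one t)
  comul_counit t := by
    rw [LeftModuleAlgebra.coact_apply, map_sum]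
    refine Eq.trans (Finset.sum_congr rfl fun j _ => BTensor.lift_tmul _ _ _ _) ?_
    -- Again ε of the action of γⱼ on t is the functional of γⱼ, and the sum is the dual basis
    -- expansion.
    refine Eq.trans (Finset.sum_congr rfl fun j _ => ?_) (D.sum_eq t)
    rw [LinearMap.mk₂_apply, C₀.coord_act, one_mul]
  comul_one := C₀.coact_one
  counit_one := C₀.coord_one_one
  counit_mul_src := C₀.coord_mul_src
  counit_mul_tgt := C₀.coord_mul_tgt
  takeuchi := C₀.takeuchi
  comul_mul := C₀.coact_mul

theorem isRightFiniteProjective : C₀.bialgebroid.IsRightFiniteProjective :=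
  D.dualBasis.finite_projective

/-- The comodule algebra of a module algebra over a dual system. -/
def comoduleAlgebra {P : Type uA} [Ring P] [Algebra K P] {v : R →ₐ[K] P}
    (C : LeftModuleAlgebra D v) : LeftComoduleAlgebra C₀.bialgebroid P where
  base := v
  coact := C.coact
  coact_lact := C.coact_base_mul
  coassoc := C.coassoc _ C₀.act_tgt_mul C₀.coord_act _
  counital p := (C.slice_coact 1 p).trans (C.act_one p)
  coact_one := C.coact_one
  takeuchi := C.takeuchi
  coact_mul := C.coact_mul

theorem mem_coinvariants_iff {P : Type uA} [Ring P] [Algebra K P] {v : R →ₐ[K] P}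
    (C : LeftModuleAlgebra D v) (p : P) :
    p ∈ (C₀.comoduleAlgebra C).coinvariants ↔ ∀ γ, C.act γ p = C.act γ 1 * p := by
  change C.coact p = LTensor.tmul K S.tgt v 1 p ↔ _
  refine ⟨fun h γ => ?_, fun h => D.ext_slice fun γ => ?_⟩
  · rw [← C.slice_coact, h, D.slice_tmul, C.act_apply_one]
  · rw [C.slice_coact, h, D.slice_tmul, C.act_apply_one]

theorem slice_galoisMap {A : Type uA} [Ring A] [Algebra K A] {v : R →ₐ[K] A}
    (C : LeftModuleAlgebra D v) {B : Type uB} [Ring B] [Algebra K B] {f : B →ₐ[K] A}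
    (hf : Set.range f = (C₀.comoduleAlgebra C).coinvariants) (γ : Γ) (x y : A) :
    D.slice v γ ((C₀.comoduleAlgebra C).galoisMap f hf (TensorSquare.tmul f x y)) =
      C.act γ x * y := by
  rw [LeftComoduleAlgebra.galoisMap_tmul, ← C.slice_coact]
  exact D.slice_mulSnd γ y _

end LeftRegularAction

end LeftDualSystem

/-! ### Functionals and twists in the first leg of A ⊗_B A; left quasibases -/

section Extension

variable {K : Type uK} {B : Type uB} {A : Type uA} [CommRing K] [Ring B] [Algebra K B] [Ring A]
  [Algebra K A] {f : B →ₐ[K] A}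

namespace TensorSquare

/-- `x ⊗ y ↦ γ x ⊗ y` -/
def mapFst (γ : Module.End K A) (hγ : ∀ b a, γ (a * f b) = γ a * f b) :
    Module.End K (TensorSquare f) :=
  BTensor.onLeft _ _ γ hγ

@[simp]
theorem mapFst_tmul (γ : Module.End K A) (hγ : ∀ b a, γ (a * f b) = γ a * f b) (x y : A) :
    mapFst γ hγ (tmul f x y) = tmul f (γ x) y := by
  exact BTensor.onLeft_tmul _ _ _ _

theorem mapFst_ract (γ : Module.End K A) (hγ : ∀ b a, γ (a * f b) = γ a * f b) (a : A)
    (w : TensorSquare f) : mapFst γ hγ (ract f a w) = ract f a (mapFst γ hγ w) := by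
  refine LinearMap.congr_fun (f := mapFst γ hγ * ract f a) (g := ract f a * mapFst γ hγ)
    (hom_ext fun x y => ?_) w
  simp

/-- `x ⊗ y ↦ γ x * y` -/
def contractFst (γ : Module.End K A) (hγ : ∀ b a, γ (a * f b) = γ a * f b) :
    TensorSquare f →ₗ[K] A :=
  BTensor.lift ((LinearMap.mul K A).comp γ) (fun b x y => by simp [hγ, mul_assoc])

@[simp]
theorem contractFst_tmul (γ : Module.End K A) (hγ : ∀ b a, γ (a * f b) = γ a * f b) (x y : A) :
    contractFst γ hγ (tmul f x y) = γ x * y := by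
  exact BTensor.lift_tmul _ _ _ _

theorem contractFst_ract (γ : Module.End K A) (hγ : ∀ b a, γ (a * f b) = γ a * f b) (a : A)
    (w : TensorSquare f) : contractFst γ hγ (ract f a w) = contractFst γ hγ w * a := by
  refine LinearMap.congr_fun (f := contractFst γ hγ ∘ₗ ract f a)
    (g := LinearMap.mulRight K a ∘ₗ contractFst γ hγ) (hom_ext fun x y => ?_) w
  simp [mul_assoc]

theorem contractFst_lact (γ : Module.End K A) (hγ : ∀ b a, γ (a * f b) = γ a * f b) (a : A)
    (h : ∀ b x, (γ * LinearMap.mulLeft K a) (x * f b) = (γ * LinearMap.mulLeft K a) x * f b)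
    (w : TensorSquare f) : contractFst γ hγ (lact f a w) =
      contractFst (γ * LinearMap.mulLeft K a) h w := by
  refine LinearMap.congr_fun (f := contractFst γ hγ ∘ₗ lact f a) (hom_ext fun x y => ?_) w
  simp

theorem contractFst_mapFst (γ γ' : Module.End K A) (hγ : ∀ b a, γ (a * f b) = γ a * f b)
    (hγ' : ∀ b a, γ' (a * f b) = γ' a * f b)
    (h : ∀ b x, (γ' * γ) (x * f b) = (γ' * γ) x * f b) (w : TensorSquare f) :
    contractFst γ' hγ' (mapFst γ hγ w) = contractFst (γ' * γ) h w := by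
  refine LinearMap.congr_fun (f := contractFst γ' hγ' ∘ₗ mapFst γ hγ) (hom_ext fun x y => ?_) w
  simp

theorem mapFst_lact (γ : bimoduleEnd f) (b : B) (w : TensorSquare f) :
    mapFst γ.1 (bimoduleEnd_mul_right γ) (lact f (f b) w) =
      lact f (f b) (mapFst γ.1 (bimoduleEnd_mul_right γ) w) := by
  refine LinearMap.congr_fun (f := mapFst γ.1 (bimoduleEnd_mul_right γ) * lact f (f b))
    (g := lact f (f b) * mapFst γ.1 (bimoduleEnd_mul_right γ)) (hom_ext fun x y => ?_) w
  simp [bimoduleEnd_mul_left]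

theorem contractFst_lact_base (γ : bimoduleEnd f) (b : B) (w : TensorSquare f) :
    contractFst γ.1 (bimoduleEnd_mul_right γ) (lact f (f b) w) =
      f b * contractFst γ.1 (bimoduleEnd_mul_right γ) w := by
  refine LinearMap.congr_fun (f := contractFst γ.1 (bimoduleEnd_mul_right γ) ∘ₗ lact f (f b))
    (g := LinearMap.mulLeft K (f b) ∘ₗ contractFst γ.1 (bimoduleEnd_mul_right γ))
    (hom_ext fun x y => ?_) w
  simp [bimoduleEnd_mul_left, mul_assoc]

theorem contractFst_mem (γ : bimoduleEnd f) {w : TensorSquare f} (hw : w ∈ central f) :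
    contractFst γ.1 (bimoduleEnd_mul_right γ) w ∈ centralizer f := by
  refine (Subalgebra.mem_centralizer_iff K).2 ?_
  rintro _ ⟨b, rfl⟩
  rw [← contractFst_ract, ← mem_central.1 hw, contractFst_lact_base]

/-- The right `R`-linear functional `t ↦ γ(t¹) t²`, where `R` is the centralizer. -/
def coordFst (γ : bimoduleEnd f) : endAlgebra f →ₗ[K] centralizer f :=
  LinearMap.codRestrict (Subalgebra.toSubmodule (centralizer f))
    (contractFst γ.1 (bimoduleEnd_mul_right γ) ∘ₗ (central f).subtype ∘ₗ
      (endAlgebraEquiv f).toLinearMap)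
    (fun t => contractFst_mem γ (endAlgebraEquiv f t).2)

theorem coordFst_coe (γ : bimoduleEnd f) (t : endAlgebra f) :
    (coordFst γ t : A) =
      contractFst γ.1 (bimoduleEnd_mul_right γ) (endAlgebraEquiv f t).1 := rfl

theorem coordFst_mul_insertRight (γ : bimoduleEnd f) (r : centralizer f)
    (t : endAlgebra f) : coordFst γ (t * insertRight f r) = coordFst γ t * r := by
  refine Subtype.ext ?_
  rw [coordFst_coe, endAlgebraEquiv_mul_insertRight, contractFst_ract]
  rfl

theorem coordFst_mul_insertLeft (γ : bimoduleEnd f) (r : centralizer f)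
    (t : endAlgebra f) :
    coordFst γ (t * insertLeft f r) = coordFst (γ * centralizerMulLeft r) t := by
  refine Subtype.ext ?_
  rw [coordFst_coe, endAlgebraEquiv_mul_insertLeft]
  exact contractFst_lact _ _ _ (bimoduleEnd_mul_right (γ * centralizerMulLeft r)) _

theorem contractFst_one_lact (a : A) (w : TensorSquare f) :
    contractFst (1 : bimoduleEnd f).1 (bimoduleEnd_mul_right 1) (lact f a w) =
      a * contractFst (1 : bimoduleEnd f).1 (bimoduleEnd_mul_right 1) w := by
  refine LinearMap.congr_fun
    (f := contractFst (1 : bimoduleEnd f).1 (bimoduleEnd_mul_right 1) ∘ₗ lact f a)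
    (g := LinearMap.mulLeft K a ∘ₗ contractFst (1 : bimoduleEnd f).1
      (bimoduleEnd_mul_right 1)) (hom_ext fun x y => ?_) w
  simp [mul_assoc]

theorem coordFst_one_mul_insertLeft (r : centralizer f) (t : endAlgebra f) :
    coordFst (1 : bimoduleEnd f) (t * insertLeft f r) = r * coordFst 1 t := by
  refine Subtype.ext ?_
  rw [coordFst_coe, endAlgebraEquiv_mul_insertLeft, contractFst_one_lact]
  rfl

theorem coordFst_apply_one (γ : bimoduleEnd f) :
    (coordFst γ 1 : A) = γ.1 1 := by
  rw [coordFst_coe, endAlgebraEquiv_one, contractFst_tmul, mul_one]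

/-- The endomorphism `t ↦ γ(t¹) ⊗ t²`. -/
def twistFst (γ : bimoduleEnd f) : endAlgebra f →ₗ[K] endAlgebra f :=
  (endAlgebraEquiv f).symm.toLinearMap ∘ₗ
    (mapFst γ.1 (bimoduleEnd_mul_right γ)).restrict (p := central f) (q := central f)
      (fun w hw => mem_central.2 fun b => by
        rw [← mapFst_ract, ← mem_central.1 hw, mapFst_lact]) ∘ₗ
    (endAlgebraEquiv f).toLinearMap

theorem endAlgebraEquiv_twistFst (γ : bimoduleEnd f) (t : endAlgebra f) :
    (endAlgebraEquiv f (twistFst γ t) : TensorSquare f) =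
      mapFst γ.1 (bimoduleEnd_mul_right γ) (endAlgebraEquiv f t).1 :=
  congrArg Subtype.val ((endAlgebraEquiv f).apply_symm_apply _)

theorem twistFst_mul_insertRight (γ : bimoduleEnd f) (r : centralizer f)
    (t : endAlgebra f) : twistFst γ (t * insertRight f r) = twistFst γ t * insertRight f r := by
  refine endAlgebra_ext ?_
  rw [endAlgebraEquiv_twistFst, endAlgebraEquiv_mul_insertRight, endAlgebraEquiv_mul_insertRight,
    endAlgebraEquiv_twistFst, mapFst_ract]

theorem twistFst_mul_insertLeft (γ : bimoduleEnd f) (r : centralizer f)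
    (t : endAlgebra f) :
    twistFst γ (t * insertLeft f r) = twistFst (γ * centralizerMulLeft r) t := by
  refine endAlgebra_ext ?_
  rw [endAlgebraEquiv_twistFst, endAlgebraEquiv_mul_insertLeft, endAlgebraEquiv_twistFst]
  refine LinearMap.congr_fun (f := mapFst γ.1 (bimoduleEnd_mul_right γ) ∘ₗ lact f (r : A))
    (g := mapFst (γ * centralizerMulLeft r).1 _) (hom_ext fun x y => ?_) _
  simp [centralizerMulLeft]

theorem coordFst_twistFst (γ γ' : bimoduleEnd f) (t : endAlgebra f) :
    coordFst γ' (twistFst γ t) = coordFst (γ' * γ) t := by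
  refine Subtype.ext ?_
  rw [coordFst_coe, coordFst_coe, endAlgebraEquiv_twistFst, contractFst_mapFst]
  rfl

theorem twistFst_twistFst (γ γ' : bimoduleEnd f) (t : endAlgebra f) :
    twistFst γ' (twistFst γ t) = twistFst (γ' * γ) t := by
  refine endAlgebra_ext ?_
  rw [endAlgebraEquiv_twistFst, endAlgebraEquiv_twistFst, endAlgebraEquiv_twistFst]
  refine LinearMap.congr_fun (f := mapFst γ'.1 (bimoduleEnd_mul_right γ') ∘ₗ
    mapFst γ.1 (bimoduleEnd_mul_right γ)) (g := mapFst (γ' * γ).1 _) (hom_ext fun x y => ?_) _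
  simp

theorem twistFst_one_apply (t : endAlgebra f) : twistFst 1 t = t := by
  refine endAlgebra_ext ?_
  rw [endAlgebraEquiv_twistFst]
  refine LinearMap.congr_fun (f := mapFst _ _) (g := LinearMap.id) (hom_ext fun x y => ?_) _
  simp

theorem twistFst_apply_one (γ : bimoduleEnd f) :
    twistFst γ 1 = insertLeft f (coordFst γ 1) := by
  refine endAlgebra_ext ?_
  rw [endAlgebraEquiv_twistFst, endAlgebraEquiv_one, mapFst_tmul, endAlgebraEquiv_coe,
    insertLeft_tmul, coordFst_apply_one, one_mul]

/-- The endomorphism `a ↦ γ(a t¹) t²` of the `B`-`B`-bimodule `A`. -/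
def actFst (t : endAlgebra f) (γ : bimoduleEnd f) : bimoduleEnd f :=
  ⟨contractFst γ.1 (bimoduleEnd_mul_right γ) ∘ₗ (lactₗ f).flip (endAlgebraEquiv f t).1,
    mem_bimoduleEnd.2 ⟨fun b a => by
      simp only [LinearMap.comp_apply, LinearMap.flip_apply, lactₗ_apply, lact_mul]
      rw [contractFst_lact_base], fun b a => by
      simp only [LinearMap.comp_apply, LinearMap.flip_apply, lactₗ_apply, lact_mul]
      rw [mem_central.1 (endAlgebraEquiv f t).2, lact_ract, contractFst_ract]⟩⟩

theorem actFst_apply (t : endAlgebra f) (γ : bimoduleEnd f) (a : A) :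
    (actFst t γ).1 a =
      contractFst γ.1 (bimoduleEnd_mul_right γ) (lact f a (endAlgebraEquiv f t).1) := rfl

theorem actFst_insertRight_apply (γ : bimoduleEnd f) (r : centralizer f) (a : A) :
    (actFst (insertRight f r) γ).1 a = γ.1 a * r := by
  rw [actFst_apply, endAlgebraEquiv_coe, insertRight_tmul, lact_tmul, contractFst_tmul, mul_one,
    mul_one]

/-- Both sides put r to the right of γ(t¹). Read in the opposite algebra, this is the Takeuchi
condition for Δ. -/
theorem twistFst_actFst_insertRight (γ : bimoduleEnd f) (r : centralizer f) (t : endAlgebra f) :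
    twistFst (actFst (insertRight f r) γ) t = insertLeft f r * twistFst γ t := by
  refine endAlgebra_ext ?_
  rw [endAlgebraEquiv_twistFst, endAlgebraEquiv_mul, endAlgebraEquiv_twistFst]
  refine LinearMap.congr_fun (f := mapFst (actFst (insertRight f r) γ).1 _)
    (g := (insertLeft f r).1 ∘ₗ mapFst γ.1 (bimoduleEnd_mul_right γ)) (hom_ext fun x y => ?_) _
  simp [actFst_insertRight_apply]

/-- From t t' = t'¹ t¹ ⊗ t² t'² the value is γ(t'¹ t¹) t² · t'². Passing to the opposite algebra
exchanges the factors, as a left bialgebroid requires. -/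
theorem coordFst_mul (γ : bimoduleEnd f) (t t' : endAlgebra f) :
    coordFst γ (t * t') = coordFst (actFst t γ) t' := by
  refine Subtype.ext ?_
  rw [coordFst_coe, coordFst_coe, endAlgebraEquiv_mul]
  refine LinearMap.congr_fun (f := contractFst γ.1 (bimoduleEnd_mul_right γ) ∘ₗ t.1)
    (g := contractFst (actFst t γ).1 (bimoduleEnd_mul_right (actFst t γ)))
    (hom_ext fun x y => ?_) _
  rw [LinearMap.comp_apply, endAlgebra_apply_tmul, lact_ract, contractFst_ract, contractFst_tmul,
    actFst_apply]

/-- As for `coordSnd_one_mul`: the counit of t t' is t'¹ ε(t) t'², so t may be replaced by the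
source or target of ε(t). -/
theorem coordFst_one_mul (t t' s : endAlgebra f)
    (h : ∀ x y, contractFst (1 : bimoduleEnd f).1 (bimoduleEnd_mul_right 1)
      (s.1 (tmul f x y)) = x * (coordFst 1 t : A) * y) :
    coordFst 1 (t * t') = coordFst 1 (s * t') := by
  refine Subtype.ext ?_
  rw [coordFst_coe, coordFst_coe, endAlgebraEquiv_mul, endAlgebraEquiv_mul]
  refine LinearMap.congr_fun
    (f := contractFst (1 : bimoduleEnd f).1 (bimoduleEnd_mul_right 1) ∘ₗ t.1)
    (g := contractFst (1 : bimoduleEnd f).1 (bimoduleEnd_mul_right 1) ∘ₗ s.1)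
    (hom_ext fun x y => ?_) _
  rw [LinearMap.comp_apply, LinearMap.comp_apply, h, endAlgebra_apply_tmul, contractFst_one_lact,
    contractFst_ract, mul_assoc, coordFst_coe]

variable (f) in
/-- The source and target maps `r ↦ r ⊗ 1` and `r ↦ 1 ⊗ r` into the opposite of the algebra of
bimodule endomorphisms of `A ⊗_B A`. -/
def sourceTargetOp : SourceTarget K (centralizer f) (endAlgebra f)ᵐᵒᵖ where
  src := (AlgHom.op (sourceTarget f).tgtOp).comp (AlgEquiv.opOp K (centralizer f)).toAlgHom
  tgtOp := AlgHom.op (sourceTarget f).src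
  src_comm_tgtOp r r' := congrArg MulOpposite.op ((sourceTarget f).src_comm_tgtOp r' r)

theorem sourceTargetOp_src (r : centralizer f) :
    (sourceTargetOp f).src r = MulOpposite.op (insertLeft f r) := rfl

theorem sourceTargetOp_tgt (r : centralizer f) :
    (sourceTargetOp f).tgt r = MulOpposite.op (insertRight f r) := rfl

theorem mul_map_eq_of_tmul_eq (g : A →+ A) (hg : ∀ b a, g (f b * a) = f b * g a)
    {x y x' y' : A} (h : tmul f x y = tmul f x' y') : x * g y = x' * g y' := by
  let g' : A →ₗ[K] A := { g with
    map_smul' := fun c a => by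
      have e : ∀ a : A, c • a = f (algebraMap K B c) * a := fun a => by
        rw [AlgHom.commutes, Algebra.smul_def]
      change g (c • a) = c • g a
      rw [e, e, hg] }
  exact congrArg (BTensor.lift ((LinearMap.mul K A).compl₂ g') (fun b x y => by
    change x * f b * g y = x * g (f b * y)
    rw [hg, mul_assoc]) : TensorSquare f →ₗ[K] A) h |> fun h => by
      rwa [tmul, tmul, BTensor.lift_tmul, BTensor.lift_tmul] at h

end TensorSquare

/-- A left depth two quasibasis: `x ⊗ y = ∑ uⱼ γⱼ(x) y`. -/
structure LeftQuasibasis (f : B →ₐ[K] A) where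
  n : ℕ
  map : Fin n → bimoduleEnd f
  elem : Fin n → TensorSquare.endAlgebra f
  sum_eq : ∀ a, ∑ j, TensorSquare.ract f ((map j).1 a)
    (TensorSquare.endAlgebraEquiv f (elem j)).1 = TensorSquare.tmul f a 1

/-- Here γⱼ(a) is the j-th component of ι(a ⊗ 1) and uⱼ = π(eⱼ); right A-linearity of π gives the
quasibasis identity. -/
theorem IsLeftDepthTwo.exists_quasibasis (h : IsLeftDepthTwo f) :
    Nonempty (LeftQuasibasis f) := by
  obtain ⟨n, ι, π, h1, h2, h3, h4, h5⟩ := h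
  refine ⟨⟨n, fun j => ⟨LinearMap.proj j ∘ₗ ι ∘ₗ (BTensor.mk _ _).flip 1, mem_bimoduleEnd.2
    ⟨fun b a => ?_, fun b a => ?_⟩⟩, fun j => (TensorSquare.endAlgebraEquiv f).symm
    ⟨π (Pi.single j 1), TensorSquare.mem_central.2 fun b => ?_⟩, fun a => ?_⟩⟩
  · simp only [LinearMap.comp_apply, LinearMap.proj_apply, LinearMap.flip_apply, BTensor.mk_apply]
    rw [← h1, TensorSquare.lact_tmul]
  · simp only [LinearMap.comp_apply, LinearMap.proj_apply, LinearMap.flip_apply, BTensor.mk_apply]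
    rw [← h2, TensorSquare.ract_tmul, one_mul]
    exact congrArg (ι · j) (by simpa using TensorSquare.tmul_mul_base (f := f) a b 1)
  · rw [← h3, ← h4]
    congr 1
    funext j'
    by_cases hj : j' = j
    · subst hj; simp
    · simp [hj]
  · simp only [LinearEquiv.apply_symm_apply, LinearMap.comp_apply, LinearMap.proj_apply,
      LinearMap.flip_apply, BTensor.mk_apply, ← h4]
    rw [← map_sum]
    refine Eq.trans ?_ (h5 _)
    congr 1
    funext j
    simp [Finset.sum_apply, Pi.single_apply]

/-! ### Left depth two and left balanced imply left Galois -/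

open TensorSquare

namespace LeftQuasibasis

variable (D : LeftQuasibasis f)

theorem sum_contractFst_mul_map (γ : Module.End K A) (hγ : ∀ b a, γ (a * f b) = γ a * f b) (a : A) :
    ∑ j, contractFst γ hγ (endAlgebraEquiv f (D.elem j)).1 * (D.map j).1 a = γ a := by
  simpa [contractFst_ract] using congrArg (contractFst γ hγ) (D.sum_eq a)

theorem sum_ract_contractFst (w : TensorSquare f) :
    ∑ j, ract f (contractFst (D.map j).1 (bimoduleEnd_mul_right (D.map j)) w)
      (endAlgebraEquiv f (D.elem j)).1 = w := by
  have key : ∑ j, (ractₗ f).flip (endAlgebraEquiv f (D.elem j)).1 ∘ₗ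
      contractFst (D.map j).1 (bimoduleEnd_mul_right (D.map j)) = LinearMap.id := by
    refine hom_ext fun x y => ?_
    simp only [LinearMap.sum_apply, LinearMap.comp_apply, LinearMap.flip_apply, ractₗ_apply,
      contractFst_tmul, ract_mul, LinearMap.id_apply, ← map_sum, D.sum_eq, ract_tmul, one_mul]
  refine Eq.trans ?_ (LinearMap.congr_fun key w)
  rw [LinearMap.sum_apply]
  rfl

theorem sum_elem_mul_insertRight (t : endAlgebra f) :
    ∑ j, D.elem j * insertRight f (coordFst (D.map j) t) = t :=
  endAlgebra_ext (by
    rw [map_sum, Submodule.coe_sum]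
    simp only [endAlgebraEquiv_mul_insertRight, coordFst_coe]
    exact D.sum_ract_contractFst _)

/-- This is `sum_contractFst_mul_map` for the right B-linear map x ↦ γ(a x). -/
theorem sum_actFst_mul_map (γ : bimoduleEnd f) (a a' : A) :
    ∑ j, (actFst (D.elem j) γ).1 a * (D.map j).1 a' = γ.1 (a * a') := by
  have h : ∀ b x, (γ.1 * LinearMap.mulLeft K a) (x * f b) =
      (γ.1 * LinearMap.mulLeft K a) x * f b := fun b x => by
    simp [← mul_assoc, bimoduleEnd_mul_right]
  simp only [actFst_apply, contractFst_lact γ.1 (bimoduleEnd_mul_right γ) a h]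
  exact D.sum_contractFst_mul_map _ h a'

theorem sum_twistFst_mul_insertLeft (γ : bimoduleEnd f) (t : endAlgebra f) :
    ∑ j, twistFst (D.map j) t * insertLeft f (coordFst γ (D.elem j)) = twistFst γ t := by
  refine endAlgebra_ext ?_
  rw [map_sum, Submodule.coe_sum]
  simp only [endAlgebraEquiv_mul_insertLeft, endAlgebraEquiv_twistFst]
  have key : ∑ j, lact f (coordFst γ (D.elem j) : A) ∘ₗ
      mapFst (D.map j).1 (bimoduleEnd_mul_right (D.map j)) =
      mapFst γ.1 (bimoduleEnd_mul_right γ) := by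
    refine hom_ext fun x y => ?_
    simp only [LinearMap.sum_apply, LinearMap.comp_apply, mapFst_tmul, lact_tmul]
    simp only [tmul, ← BTensor.mk_apply, ← LinearMap.sum_apply, ← map_sum]
    rw [← D.sum_contractFst_mul_map γ.1 (bimoduleEnd_mul_right γ) x]
    rfl
  refine Eq.trans ?_ (LinearMap.congr_fun key _)
  rw [LinearMap.sum_apply]
  rfl

/-- The product rule `sum_actFst_mul_map` in the first legs: on x ⊗ y both sides give γ(x t¹) ⊗ t²
y. -/
theorem sum_twistFst_mul_twistFst (γ : bimoduleEnd f) (t t' : endAlgebra f) :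
    ∑ j, twistFst (D.map j) t * twistFst (actFst (D.elem j) γ) t' = twistFst γ (t * t') := by
  refine endAlgebra_ext ?_
  rw [map_sum, Submodule.coe_sum, endAlgebraEquiv_twistFst]
  simp only [endAlgebraEquiv_mul, endAlgebraEquiv_twistFst]
  have key : ∑ j, (twistFst (D.map j) t).1 ∘ₗ mapFst (actFst (D.elem j) γ).1
      (bimoduleEnd_mul_right (actFst (D.elem j) γ)) =
      mapFst γ.1 (bimoduleEnd_mul_right γ) ∘ₗ t.1 := by
    refine hom_ext fun x y => ?_
    simp only [LinearMap.sum_apply, LinearMap.comp_apply, mapFst_tmul, endAlgebra_apply_tmul,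
      endAlgebraEquiv_twistFst, lact_ract, mapFst_ract, ← map_sum]
    congr 1
    have key' : ∑ j, lact f ((actFst (D.elem j) γ).1 x) ∘ₗ
        mapFst (D.map j).1 (bimoduleEnd_mul_right (D.map j)) =
        mapFst γ.1 (bimoduleEnd_mul_right γ) ∘ₗ lact f x := by
      refine hom_ext fun v w => ?_
      simp only [LinearMap.sum_apply, LinearMap.comp_apply, mapFst_tmul, lact_tmul]
      simp only [tmul, ← BTensor.mk_apply, ← LinearMap.sum_apply, ← map_sum]
      rw [D.sum_actFst_mul_map]
    refine Eq.trans ?_ (LinearMap.congr_fun key' _)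
    rw [LinearMap.sum_apply]
    rfl
  refine Eq.trans ?_ (LinearMap.congr_fun key _)
  rw [LinearMap.sum_apply]
  rfl

/-- The endomorphisms of the `B`-`B`-bimodule `A` as functionals on the opposite of the algebra of
bimodule endomorphisms of `A ⊗_B A`. -/
def dualSystem : LeftDualSystem (sourceTargetOp f) (bimoduleEnd f) where
  coord γ := coordFst γ ∘ₗ (MulOpposite.opLinearEquiv K).symm.toLinearMap
  coord_tgt_mul γ r t := coordFst_mul_insertRight γ r t.unop
  mulSrc γ r := γ * centralizerMulLeft r
  coord_src_mul γ r t := coordFst_mul_insertLeft γ r t.unop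
  act t γ := actFst t.unop γ
  coord_mul γ t t' := coordFst_mul γ t'.unop t.unop
  n := D.n
  elem j := MulOpposite.op (D.elem j)
  map := D.map
  sum_eq t := MulOpposite.unop_injective (by
    rw [← MulOpposite.opAddEquiv_symm_apply, map_sum]
    exact D.sum_elem_mul_insertRight t.unop)

/-- The action of the endomorphisms of the `B`-`B`-bimodule `A` on the opposite of the algebra of
bimodule endomorphisms of `A ⊗_B A`. -/
def regularAction : LeftRegularAction D.dualSystem where
  act γ := (MulOpposite.opLinearEquiv K).toLinearMap ∘ₗ twistFst γ ∘ₗ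
    (MulOpposite.opLinearEquiv K).symm.toLinearMap
  act_mul γ γ' p := congrArg MulOpposite.op (twistFst_twistFst γ γ' p.unop).symm
  act_one p := congrArg MulOpposite.op (twistFst_one_apply p.unop)
  act_mul_base γ r p :=
    congrArg MulOpposite.op (twistFst_actFst_insertRight γ r p.unop).symm
  act_base_mul γ r p := congrArg MulOpposite.op (twistFst_mul_insertLeft γ r p.unop)
  act_apply_one γ := congrArg MulOpposite.op (twistFst_apply_one γ)
  sum_base_mul_act γ p := MulOpposite.unop_injective (by
    rw [← MulOpposite.opAddEquiv_symm_apply, map_sum]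
    exact D.sum_twistFst_mul_insertLeft γ p.unop)
  sum_act_mul_act γ p p' := MulOpposite.unop_injective (by
    rw [← MulOpposite.opAddEquiv_symm_apply, map_sum]
    exact D.sum_twistFst_mul_twistFst γ p'.unop p.unop)
  act_tgt_mul γ r p := congrArg MulOpposite.op (twistFst_mul_insertRight γ r p.unop)
  coord_act γ γ' t := coordFst_twistFst γ γ' t.unop
  coord_one_src_mul r t := coordFst_one_mul_insertLeft r t.unop
  coord_one_one := Subtype.ext (coordFst_apply_one 1)
  coord_mul_tgt t t' := coordFst_one_mul t'.unop t.unop _ fun x y => by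
    rw [sourceTargetOp_tgt, MulOpposite.unop_op, insertRight_tmul, contractFst_tmul, mul_assoc]
    rfl
  coord_mul_src t t' := coordFst_one_mul t'.unop t.unop _ fun x y => by
    rw [sourceTargetOp_src, MulOpposite.unop_op, insertLeft_tmul, contractFst_tmul]
    rfl

/-- The action of the endomorphisms of the `B`-`B`-bimodule `A` on `A`. -/
def moduleAlgebra : LeftModuleAlgebra D.dualSystem (centralizer f).val where
  act γ := γ.1
  act_mul _ _ _ := rfl
  act_one _ := rfl
  act_mul_base γ r a := (actFst_insertRight_apply γ r a).symm
  act_base_mul _ _ _ := rfl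
  act_apply_one γ := (coordFst_apply_one γ).symm
  sum_base_mul_act γ a := D.sum_contractFst_mul_map γ.1 (bimoduleEnd_mul_right γ) a
  sum_act_mul_act := D.sum_actFst_mul_map

/-- The coaction on `A` of the left bialgebroid opposite to the endomorphisms of the
`A`-`A`-bimodule `A ⊗_B A`. -/
def comoduleAlgebra : LeftComoduleAlgebra D.regularAction.bialgebroid A :=
  D.regularAction.comoduleAlgebra D.moduleAlgebra

/-- A coinvariant a satisfies γ(a) = γ(1)a for all γ, so the quasibasis gives a ⊗ 1 = 1 ⊗ a and left
multiplication by a commutes with End(_B A); balancedness then puts a in B. -/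
theorem range_eq_coinvariants (hinj : Function.Injective f) (hbal : IsLeftBalanced f) :
    Set.range f = D.comoduleAlgebra.coinvariants := by
  ext a
  refine Iff.trans ?_ (D.regularAction.mem_coinvariants_iff D.moduleAlgebra a).symm
  change _ ↔ ∀ γ : bimoduleEnd f, γ.1 a = γ.1 1 * a
  constructor
  · rintro ⟨b, rfl⟩ γ
    rw [← bimoduleEnd_mul_right, one_mul]
  · intro h
    refine (isLeftBalanced_iff f hinj).1 hbal a fun g hg x => ?_
    have h1 : tmul f 1 a = tmul f a 1 := by
      have := congrArg (ract f a) (D.sum_eq 1)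
      rw [ract_tmul, one_mul, map_sum] at this
      rw [← D.sum_eq a, ← this]
      exact Finset.sum_congr rfl fun j _ => by rw [h, ract_mul]
    have h2 : tmul f 1 (a * x) = tmul f a x := by
      simpa using congrArg (ract f x) h1
    simpa using mul_map_eq_of_tmul_eq g hg h2

theorem isGalois (hinj : Function.Injective f) (hbal : IsLeftBalanced f) :
    D.comoduleAlgebra.IsGalois f := by
  refine ⟨D.range_eq_coinvariants hinj hbal, ?_⟩
  have hs : ∀ γ w, D.dualSystem.slice (centralizer f).val γ
      (D.comoduleAlgebra.galoisMap f (D.range_eq_coinvariants hinj hbal) w) =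
      contractFst γ.1 (bimoduleEnd_mul_right γ) w := fun γ w => by
    refine LinearMap.congr_fun (f := D.dualSystem.slice (centralizer f).val γ ∘ₗ
      D.comoduleAlgebra.galoisMap f (D.range_eq_coinvariants hinj hbal))
      (hom_ext fun x y => ?_) w
    rw [contractFst_tmul]
    exact D.regularAction.slice_galoisMap D.moduleAlgebra _ γ x y
  constructor
  · intro w w' h
    rw [← D.sum_ract_contractFst w, ← D.sum_ract_contractFst w']
    simp only [← hs, h]
  · intro z
    -- The preimage of z = ∑ uⱼ ⊗ zⱼ, with zⱼ the slice by γⱼ, is ∑ uⱼ zⱼ.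
    refine ⟨∑ j, ract f (D.dualSystem.slice (centralizer f).val (D.map j) z)
      (endAlgebraEquiv f (D.elem j)).1, D.dualSystem.ext_slice fun γ => ?_⟩
    refine (hs γ _).trans ?_
    rw [map_sum]
    simp only [contractFst_ract]
    refine Eq.trans ?_ (congrArg _ (D.dualSystem.sum_slice z))
    rw [map_sum]
    exact Finset.sum_congr rfl fun j _ =>
      (D.dualSystem.slice_tmul (v := (centralizer f).val) γ (MulOpposite.op (D.elem j)) _).symm

end LeftQuasibasis

theorem isLeftBialgebroidGalois (hinj : Function.Injective f) (h : IsLeftDepthTwo f)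
    (hbal : IsLeftBalanced f) : IsLeftBialgebroidGalois.{uK, uB, uA, uA, uA} f := by
  obtain ⟨D⟩ := h.exists_quasibasis
  exact ⟨_, _, _, _, _, _, D.regularAction.bialgebroid, D.comoduleAlgebra,
    D.regularAction.isRightFiniteProjective, D.isGalois hinj hbal⟩

end Extension

end DepthTwo

/-- Characterization of right (left) Galois extensions over left (right) finite projective right
(left) bialgebroids. In each part, the equivalence finds `R` and `T` in the universe of `A`, and the
extra implication says that the forward direction also holds for `R` and `T` in any universes. -/
theorem theorem2p1 {K : Type uK} {B : Type uB} {A : Type uA}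
    [CommRing K] [Ring B] [Algebra K B] [Ring A] [Algebra K A]
    (f : B →ₐ[K] A) (hf : Function.Injective f) :
    ((DepthTwo.IsRightBialgebroidGalois.{uK, uB, uA, uA, uA} f ↔
        DepthTwo.IsRightDepthTwo f ∧ DepthTwo.IsRightBalanced f) ∧
      (DepthTwo.IsRightBialgebroidGalois.{uK, uB, uA, uR, uT} f →
        DepthTwo.IsRightDepthTwo f ∧ DepthTwo.IsRightBalanced f)) ∧
    ((DepthTwo.IsLeftBialgebroidGalois.{uK, uB, uA, uA, uA} f ↔
        DepthTwo.IsLeftDepthTwo f ∧ DepthTwo.IsLeftBalanced f) ∧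
      (DepthTwo.IsLeftBialgebroidGalois.{uK, uB, uA, uR, uT} f →
        DepthTwo.IsLeftDepthTwo f ∧ DepthTwo.IsLeftBalanced f)) := by
  exact ⟨⟨⟨DepthTwo.isRightDepthTwo_and_isRightBalanced hf,
      fun h => DepthTwo.isRightBialgebroidGalois hf h.1 h.2⟩,
      DepthTwo.isRightDepthTwo_and_isRightBalanced hf⟩,
    ⟨⟨DepthTwo.isLeftDepthTwo_and_isLeftBalanced hf,
      fun h => DepthTwo.isLeftBialgebroidGalois hf h.1 h.2⟩,
      DepthTwo.isLeftDepthTwo_and_isLeftBalanced hf⟩⟩
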